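/- Let $M$ be a smooth 2-manifold (Hausdorff, second countable, not necessarily connected, complete or orientable) and let $x:M\to\mathbf E^3$ be a smooth immersion into Euclidean 3-space. Let $T^\perp M=\{(p,\xi): p\in M,\ \xi\in\mathbf E^3,\ \xi\perp dx_p(T_pM)\}$ be its normal bundle, a smooth 3-manifold, immersed in $\mathbf E^3\times\mathbf E^3=\mathbf E^6$ by $f(p,\xi)=(x(p),\xi)$. Equip $M$ and $T^\perp M$ with the Riemannian metrics induced by $x$ and $f$. An isometric immersion is called minimal if its mean curvature vector field $H=\frac1m\operatorname{trace}h$ vanishes identically ($m$ the dimension of the domain, $h$ the second fundamental form), and biharmonic if it is a critical point of the bienergy $E_2(F)=\int_\Omega|\tau(F)|^2\,dv_g$, where $\tau(F)=\operatorname{trace}_g(\nabla dF)$ is the tension field and $g$ is the (fixed) induced metric, for every compact domain $\Omega$ and all smooth variations supported in $\Omega$. Then the following are equivalent: 1. the normal bundle $f:T^\perp M\to\mathbf E^6$ is biharmonic; 2. the normal bundle $f:T^\perp M\to\mathbf E^6$ is minimal; 3. the surface $x:M\to\mathbf E^3$ is minimal. -/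

import Mathlib

open scoped Manifold ContDiff

noncomputable section

namespace Submanifold

/-! ### Immersed submanifolds of Euclidean spaces -/

/-- The Euclidean space `Eⁿ`. -/
abbrev E (n : ℕ) : Type := EuclideanSpace ℝ (Fin n)

/-- A smooth immersion `f : X → V` of an `m`-dimensional manifold into a Euclidean space, that is,
an immersed submanifold.  The manifold `X` is always equipped with the metric induced by `f`, so
that `f` is an isometric immersion. -/
structure Immersion (m : ℕ) (X : Type*) [TopologicalSpace X] [ChartedSpace (E m) X]
    (V : Type*) [NormedAddCommGroup V] [InnerProductSpace ℝ V] where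
  toFun : X → V
  contMDiff : ContMDiff 𝓘(ℝ, E m) 𝓘(ℝ, V) ∞ toFun
  injective_mfderiv : ∀ p, Function.Injective (mfderiv 𝓘(ℝ, E m) 𝓘(ℝ, V) toFun p)

section Geometry

variable {m : ℕ} {X : Type*} [TopologicalSpace X] [ChartedSpace (E m) X]
  {V : Type*} [NormedAddCommGroup V] [InnerProductSpace ℝ V]

instance : CoeFun (Immersion m X V) fun _ => X → V := ⟨Immersion.toFun⟩

/-- The differential of `f` at `p`, as a linear map into `V`. -/
def Immersion.differential (f : Immersion m X V) (p : X) : TangentSpace 𝓘(ℝ, E m) p →L[ℝ] V :=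
  mfderiv 𝓘(ℝ, E m) 𝓘(ℝ, V) f p

/-- The partial derivative `∂u/∂yᵢ`. -/
def pd {W : Type*} [NormedAddCommGroup W] [NormedSpace ℝ W]
    (i : Fin m) (u : E m → W) (y : E m) : W :=
  fderiv ℝ u y (EuclideanSpace.single i 1)

/-- The matrix `(g i j)` of the metric induced by `f`, in the coordinates of the chart `e`. -/
def metric (f : Immersion m X V) (e : OpenPartialHomeomorph X (E m)) (y : E m) :
    Matrix (Fin m) (Fin m) ℝ :=
  Matrix.of fun i j => inner ℝ (pd i (f ∘ e.symm) y) (pd j (f ∘ e.symm) y)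

/-- The Christoffel symbols `Γᵏᵢⱼ` of the Levi-Civita connection of the induced metric. -/
def christoffel (f : Immersion m X V) (e : OpenPartialHomeomorph X (E m)) (k i j : Fin m)
    (y : E m) : ℝ :=
  (1 / 2) * ∑ l, (metric f e y)⁻¹ k l *
    (pd i (fun z => metric f e z j l) y + pd j (fun z => metric f e z i l) y
      - pd l (fun z => metric f e z i j) y)

/-- The tension field `trace_g (∇ dF)` at `p` of a map `F : (X, g) → V` into a Euclidean space,
where `g` is the metric induced by the immersion `f`:
`∑ gⁱʲ (∂ᵢ∂ⱼF - ∑ Γᵏᵢⱼ ∂ₖF)`, computed in the preferred chart at `p`. -/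
def tension (f : Immersion m X V) (F : X → V) (p : X) : V :=
  let e := chartAt (E m) p
  let u : E m → V := F ∘ e.symm
  let y : E m := e p
  ∑ i, ∑ j, (metric f e y)⁻¹ i j •
    (pd i (pd j u) y - ∑ k, christoffel f e k i j y • pd k u y)

/-- The Riemannian volume measure of the metric induced by `f`: the least measure which on each
coordinate domain dominates `√(det g) dy¹ ⋯ dyᵐ`.  (These measures agree on the intersections of
coordinate domains, so that on each coordinate domain it is equal to `√(det g) dy¹ ⋯ dyᵐ`.) -/
def volumeMeasure [MeasurableSpace X] (f : Immersion m X V) : MeasureTheory.Measure X :=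
  ⨆ e ∈ atlas (E m) X, MeasureTheory.Measure.map e.symm
    ((MeasureTheory.volume.restrict e.target).withDensity
      fun y => ENNReal.ofReal (Real.sqrt (metric f e y).det))

/-- The bienergy over `Ω` of a map `F : (X, g) → V`, where `g` is the metric induced by `f`. -/
def bienergy [MeasurableSpace X] (f : Immersion m X V) (F : X → V) (Ω : Set X) : ℝ :=
  ∫ p in Ω, ‖tension f F p‖ ^ 2 ∂(volumeMeasure f)

/-- `f` is biharmonic: it is a critical point of the bienergy over each compact domain `Ω`, with
respect to all smooth variations `F s` of `f` supported in `Ω`. -/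
def IsBiharmonic [MeasurableSpace X] (f : Immersion m X V) : Prop :=
  ∀ (Ω : Set X) (F : ℝ → X → V), IsCompact Ω →
    ContMDiff (𝓘(ℝ, ℝ).prod 𝓘(ℝ, E m)) 𝓘(ℝ, V) ∞ (fun q : ℝ × X => F q.1 q.2) →
    F 0 = f → (∀ s, ∀ p ∉ Ω, F s p = f p) →
    HasDerivAt (fun s => bienergy f (F s) Ω) 0 0

/-- The second fundamental form `h(∂ᵢ, ∂ⱼ)` at the point with coordinates `y` in the chart `e`:
the component of `∂ᵢ∂ⱼf` orthogonal to the tangent space. -/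
def secondFundamentalForm (f : Immersion m X V) (e : OpenPartialHomeomorph X (E m))
    (i j : Fin m) (y : E m) : V :=
  (fderiv ℝ (f ∘ e.symm) y).rangeᗮ.starProjection (pd i (pd j (f ∘ e.symm)) y)

/-- The mean curvature vector field `H = (1/m) trace_g h`. -/
def meanCurvature (f : Immersion m X V) (p : X) : V :=
  let e := chartAt (E m) p
  (1 / (m : ℝ)) • ∑ i, ∑ j, (metric f e (e p))⁻¹ i j • secondFundamentalForm f e i j (e p)

/-- `f` is minimal: its mean curvature vector field vanishes identically. -/
def IsMinimal (f : Immersion m X V) : Prop := ∀ p, meanCurvature f p = 0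

variable [IsManifold 𝓘(ℝ, E m) ∞ X]

theorem Immersion.contDiffOn (f : Immersion m X V) {e : OpenPartialHomeomorph X (E m)}
    (he : e ∈ atlas (E m) X) : ContDiffOn ℝ ∞ (f ∘ e.symm) e.target := by
  rw [← contMDiffOn_iff_contDiffOn]
  exact f.contMDiff.comp_contMDiffOn (contMDiffOn_symm_of_mem_maximalAtlas
    (IsManifold.subset_maximalAtlas he))

theorem Immersion.mfderiv_eq (f : Immersion m X V) {e : OpenPartialHomeomorph X (E m)}
    (he : e ∈ atlas (E m) X) {y : E m} (hy : y ∈ e.target) :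
    fderiv ℝ (f ∘ e.symm) y =
      (mfderiv 𝓘(ℝ, E m) 𝓘(ℝ, V) f (e.symm y)).comp
        (mfderiv 𝓘(ℝ, E m) 𝓘(ℝ, E m) e.symm y) := by
  have : IsManifold 𝓘(ℝ, E m) 1 X := IsManifold.of_le (n := ∞) (by simp)
  rw [← mfderiv_eq_fderiv]
  exact mfderiv_comp y ((f.contMDiff _).mdifferentiableAt (by simp))
    (mdifferentiableAt_atlas_symm he hy)

theorem Immersion.injective_fderiv (f : Immersion m X V) {e : OpenPartialHomeomorph X (E m)}
    (he : e ∈ atlas (E m) X) {y : E m} (hy : y ∈ e.target) :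
    Function.Injective (fderiv ℝ (f ∘ e.symm) y) := by
  have : IsManifold 𝓘(ℝ, E m) 1 X := IsManifold.of_le (n := ∞) (by simp)
  rw [f.mfderiv_eq he hy]
  exact (f.injective_mfderiv _).comp
    ((mdifferentiable_of_mem_atlas he).symm.mfderiv_injective hy)

theorem Immersion.range_fderiv (f : Immersion m X V) {e : OpenPartialHomeomorph X (E m)}
    (he : e ∈ atlas (E m) X) {y : E m} (hy : y ∈ e.target) :
    Set.range (fderiv ℝ (f ∘ e.symm) y) =
      Set.range (f.differential (e.symm y)) := by
  have : IsManifold 𝓘(ℝ, E m) 1 X := IsManifold.of_le (n := ∞) (by simp)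
  rw [f.mfderiv_eq he hy]
  exact ((mdifferentiable_of_mem_atlas he).symm.mfderiv_surjective hy).range_comp _

theorem Immersion.contDiffOn_pd (f : Immersion m X V) {e : OpenPartialHomeomorph X (E m)}
    (he : e ∈ atlas (E m) X) (i : Fin m) : ContDiffOn ℝ ∞ (pd i (f ∘ e.symm)) e.target :=
  ((f.contDiffOn he).fderiv_of_isOpen e.open_target (by simp)).clm_apply contDiffOn_const

end Geometry

/-! ### The normal bundle of a surface in `E³` -/

section NormalBundle

/-- The vector product in `E³`. -/
def cross (a b : E 3) : E 3 := WithLp.toLp 2 (crossProduct a.ofLp b.ofLp)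

theorem inner_E3 (a b : E 3) : inner ℝ a b = a 0 * b 0 + a 1 * b 1 + a 2 * b 2 := by
  simp [PiLp.inner_apply, Fin.sum_univ_three]; ring

theorem inner_cross_left (a b : E 3) : inner ℝ a (cross a b) = 0 := by
  simp [inner_E3, cross, cross_apply]; ring

theorem inner_cross_right (a b : E 3) : inner ℝ b (cross a b) = 0 := by
  simp [inner_E3, cross, cross_apply]; ring

theorem smul_eq_of_orthogonal {a b ξ : E 3} (ha : inner ℝ a ξ = 0) (hb : inner ℝ b ξ = 0) :
    (inner ℝ (cross a b) (cross a b) : ℝ) • ξ = (inner ℝ (cross a b) ξ : ℝ) • cross a b := by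
  rw [inner_E3] at ha hb
  rw [inner_E3, inner_E3]
  ext i
  fin_cases i <;> simp [cross, cross_apply]
  · linear_combination
      ((a 2 * b 0 - a 0 * b 2) * a 2 - (a 0 * b 1 - a 1 * b 0) * a 1) * hb
      - ((a 2 * b 0 - a 0 * b 2) * b 2 - (a 0 * b 1 - a 1 * b 0) * b 1) * ha
  · linear_combination
      ((a 0 * b 1 - a 1 * b 0) * a 0 - (a 1 * b 2 - a 2 * b 1) * a 2) * hb
      - ((a 0 * b 1 - a 1 * b 0) * b 0 - (a 1 * b 2 - a 2 * b 1) * b 2) * ha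
  · linear_combination
      ((a 1 * b 2 - a 2 * b 1) * a 1 - (a 2 * b 0 - a 0 * b 2) * a 0) * hb
      - ((a 1 * b 2 - a 2 * b 1) * b 1 - (a 2 * b 0 - a 0 * b 2) * b 0) * ha

theorem contDiff_cross : ContDiff ℝ ∞ (fun p : E 3 × E 3 => cross p.1 p.2) := by
  rw [contDiff_euclidean]
  intro i
  fin_cases i <;> simp [cross, cross_apply] <;> fun_prop

theorem fderiv_eq_pd {W : Type*} [NormedAddCommGroup W] [NormedSpace ℝ W] (u : E 2 → W)
    (y v : E 2) : fderiv ℝ u y v = v 0 • pd 0 u y + v 1 • pd 1 u y := by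
  have : v = v 0 • EuclideanSpace.single 0 1 + v 1 • EuclideanSpace.single 1 1 := by
    ext i; fin_cases i <;> simp
  conv_lhs => rw [this]
  simp only [map_add, map_smul, pd]

variable {M : Type*} [TopologicalSpace M] [ChartedSpace (E 2) M]

/-- The unit normal vector field along `x` on the domain of the chart `e` (a function of the
coordinates). -/
def unitNormal (x : Immersion 2 M (E 3)) (e : OpenPartialHomeomorph M (E 2)) (y : E 2) : E 3 :=
  ‖cross (pd 0 (x ∘ e.symm) y) (pd 1 (x ∘ e.symm) y)‖⁻¹ •
    cross (pd 0 (x ∘ e.symm) y) (pd 1 (x ∘ e.symm) y)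

theorem inner_fderiv_unitNormal (x : Immersion 2 M (E 3))
    (e : OpenPartialHomeomorph M (E 2)) (y v : E 2) :
    inner ℝ (fderiv ℝ (x ∘ e.symm) y v) (unitNormal x e y) = 0 := by
  rw [fderiv_eq_pd, unitNormal, inner_add_left, inner_smul_left, inner_smul_left,
    inner_smul_right, inner_smul_right, inner_cross_left, inner_cross_right]
  simp

/-- The total space of the normal bundle of the surface `x : M → E³`: the pairs of a point `p` of
`M` and a vector `ξ` of `E³` orthogonal to the tangent plane of `x` at `p`. -/
@[ext]
structure NormalBundle (x : Immersion 2 M (E 3)) where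
  pt : M
  vec : E 3
  orthogonal : ∀ v, inner ℝ (x.differential pt v) vec = 0

/-- The inclusion of the normal bundle in `M × E³`. -/
def NormalBundle.incl {x : Immersion 2 M (E 3)} (q : NormalBundle x) : M × E 3 := (q.pt, q.vec)

/-- The topology of the normal bundle as a subspace of `M × E³`. -/
instance (x : Immersion 2 M (E 3)) : TopologicalSpace (NormalBundle x) :=
  TopologicalSpace.induced NormalBundle.incl inferInstance

theorem NormalBundle.continuous_incl (x : Immersion 2 M (E 3)) : Continuous (NormalBundle.incl (x := x)) :=
  continuous_induced_dom

theorem NormalBundle.continuous_pt (x : Immersion 2 M (E 3)) : Continuous (NormalBundle.pt (x := x)) :=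
  continuous_fst.comp (continuous_incl x)

theorem NormalBundle.continuous_vec (x : Immersion 2 M (E 3)) : Continuous (NormalBundle.vec (x := x)) :=
  continuous_snd.comp (continuous_incl x)

instance (x : Immersion 2 M (E 3)) : MeasurableSpace (NormalBundle x) := borel _

instance (x : Immersion 2 M (E 3)) : BorelSpace (NormalBundle x) := ⟨rfl⟩

section

variable [IsManifold 𝓘(ℝ, E 2) ∞ M] (x : Immersion 2 M (E 3))
  {e : OpenPartialHomeomorph M (E 2)}

theorem cross_ne_zero (he : e ∈ atlas (E 2) M) {y : E 2} (hy : y ∈ e.target) :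
    cross (pd 0 (x ∘ e.symm) y) (pd 1 (x ∘ e.symm) y) ≠ 0 := by
  have hi := x.injective_fderiv he hy
  have h : LinearIndependent ℝ ![(pd 0 (x ∘ e.symm) y).ofLp, (pd 1 (x ∘ e.symm) y).ofLp] := by
    rw [LinearIndependent.pair_iff]
    intro s t hst
    have h0 : fderiv ℝ (x ∘ e.symm) y !₂[s, t] = fderiv ℝ (x ∘ e.symm) y 0 := by
      rw [fderiv_eq_pd, map_zero]
      ext i
      simpa using congrFun hst i
    have h1 := hi h0
    exact ⟨by simpa using congrArg (fun v : E 2 => v 0) h1,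
      by simpa using congrArg (fun v : E 2 => v 1) h1⟩
  intro h0
  exact crossProduct_ne_zero_iff_linearIndependent.2 h (congrArg WithLp.ofLp h0)

theorem contDiffOn_unitNormal (he : e ∈ atlas (E 2) M) :
    ContDiffOn ℝ ∞ (unitNormal x e) e.target := by
  have h : ContDiffOn ℝ ∞ (fun y => cross (pd 0 (x ∘ e.symm) y) (pd 1 (x ∘ e.symm) y)) e.target :=
    contDiff_cross.comp_contDiffOn ((x.contDiffOn_pd he 0).prodMk (x.contDiffOn_pd he 1))
  exact ((h.norm ℝ fun y hy => cross_ne_zero x he hy).inv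
    fun y hy => norm_ne_zero_iff.2 (cross_ne_zero x he hy)).smul h

theorem norm_unitNormal (he : e ∈ atlas (E 2) M) {y : E 2} (hy : y ∈ e.target) :
    ‖unitNormal x e y‖ = 1 := by
  rw [unitNormal, norm_smul, norm_inv, norm_norm,
    inv_mul_cancel₀ (norm_ne_zero_iff.2 (cross_ne_zero x he hy))]

theorem inner_differential_unitNormal (he : e ∈ atlas (E 2) M) {y : E 2} (hy : y ∈ e.target) (v) :
    inner ℝ (x.differential (e.symm y) v) (unitNormal x e y) = 0 := by
  obtain ⟨w, hw⟩ : x.differential (e.symm y) v ∈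
      Set.range (fderiv ℝ (x ∘ e.symm) y) := by
    rw [x.range_fderiv he hy]; exact ⟨v, rfl⟩
  rw [← hw]
  exact inner_fderiv_unitNormal x e y w

theorem eq_smul_unitNormal (he : e ∈ atlas (E 2) M) {y : E 2} (hy : y ∈ e.target) {ξ : E 3}
    (h : ∀ v, inner ℝ (x.differential (e.symm y) v) ξ = 0) :
    (inner ℝ ξ (unitNormal x e y) : ℝ) • unitNormal x e y = ξ := by
  have h' : ∀ i, inner ℝ (pd i (x ∘ e.symm) y) ξ = 0 := by
    intro i
    obtain ⟨w, hw⟩ : pd i (x ∘ e.symm) y ∈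
        Set.range (x.differential (e.symm y)) := by
      rw [← x.range_fderiv he hy]; exact ⟨_, rfl⟩
    rw [← hw]; exact h w
  have h1 := smul_eq_of_orthogonal (h' 0) (h' 1)
  have h2 := norm_ne_zero_iff.2 (cross_ne_zero x he hy)
  rw [unitNormal]
  set c := cross (pd 0 (x ∘ e.symm) y) (pd 1 (x ∘ e.symm) y)
  rw [real_inner_self_eq_norm_sq] at h1
  rw [inner_smul_right, smul_smul, real_inner_comm,
    show ‖c‖⁻¹ * inner ℝ c ξ * ‖c‖⁻¹ = (‖c‖ ^ 2)⁻¹ * inner ℝ c ξ by field_simp, mul_smul, ← h1,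
    smul_smul, inv_mul_cancel₀ (pow_ne_zero 2 h2), one_smul]

/-- The point of `E²` with the first two coordinates of a point of `E³`. -/
def base (z : E 3) : E 2 := !₂[z 0, z 1]

theorem contDiff_base : ContDiff ℝ ∞ base := by
  rw [contDiff_euclidean]
  intro i
  fin_cases i <;> simp [base] <;> fun_prop

theorem base_mk (y : E 2) (t : ℝ) : base !₂[y 0, y 1, t] = y := by
  ext i; fin_cases i <;> simp [base]

open Classical in
/-- The point `(p, t N)` of the normal bundle, where `p` has coordinates `(z 0, z 1)` in the chart
`e`, `t = z 2`, and `N` is the unit normal vector at `p`. -/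
def NormalBundle.ofCoord (he : e ∈ atlas (E 2) M) (z : E 3) : NormalBundle x where
  pt := e.symm (base z)
  vec := if base z ∈ e.target then z 2 • unitNormal x e (base z) else 0
  orthogonal v := by
    split_ifs with hz
    · rw [inner_smul_right, inner_differential_unitNormal x he hz, mul_zero]
    · exact inner_zero_right _

theorem NormalBundle.ofCoord_vec (he : e ∈ atlas (E 2) M) {z : E 3} (hz : base z ∈ e.target) :
    (ofCoord x he z).vec = z 2 • unitNormal x e (base z) := if_pos hz

/-- The chart `(p, t N) ↦ (y₁, y₂, t)` of the normal bundle, where `(y₁, y₂)` are the coordinates of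
`p` in a chart `e` of the surface, and `N` is the unit normal vector at `p`. -/
def NormalBundle.chart (he : e ∈ atlas (E 2) M) :
    OpenPartialHomeomorph (NormalBundle x) (E 3) where
  toFun q := !₂[e q.pt 0, e q.pt 1, inner ℝ q.vec (unitNormal x e (e q.pt))]
  invFun := ofCoord x he
  source := pt ⁻¹' e.source
  target := base ⁻¹' e.target
  map_source' q hq := by
    rw [Set.mem_preimage, base_mk]
    exact e.map_source hq
  map_target' z hz := e.map_target hz
  left_inv' q hq := by
    have hq' : e q.pt ∈ e.target := e.map_source hq
    have h : base !₂[e q.pt 0, e q.pt 1, inner ℝ q.vec (unitNormal x e (e q.pt))] ∈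
      e.target := by rwa [base_mk]
    apply NormalBundle.ext
    · simp only [ofCoord, base_mk]
      exact e.left_inv hq
    · rw [ofCoord_vec x he h, base_mk]
      refine eq_smul_unitNormal x he hq' ?_
      rw [e.left_inv hq]
      exact q.orthogonal
  right_inv' z hz := by
    have hz' : base z ∈ e.target := hz
    rw [ofCoord_vec x he hz']
    simp only [ofCoord]
    rw [e.right_inv hz', real_inner_smul_left, real_inner_self_eq_norm_sq,
      norm_unitNormal x he hz']
    ext i; fin_cases i <;> simp [base]
  open_source := e.open_source.preimage (continuous_pt x)
  open_target := e.open_target.preimage contDiff_base.continuous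
  continuousOn_toFun := by
    have h3 : ContinuousOn (fun q : NormalBundle x => e q.pt) (pt ⁻¹' e.source) :=
      e.continuousOn.comp (continuous_pt x).continuousOn fun q hq => hq
    have h4 : ContinuousOn (fun q : NormalBundle x => unitNormal x e (e q.pt))
        (pt ⁻¹' e.source) :=
      (contDiffOn_unitNormal x he).continuousOn.comp h3 fun q hq => e.map_source hq
    have h5 := (continuous_vec x).continuousOn.inner (𝕜 := ℝ) h4
    refine (PiLp.continuous_toLp 2 _).comp_continuousOn (continuousOn_pi.2 fun i => ?_)
    have hc : ∀ j : Fin 2, Continuous fun y : E 2 => y j := fun j => by fun_prop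
    fin_cases i
    · exact (hc 0).comp_continuousOn h3
    · exact (hc 1).comp_continuousOn h3
    · exact h5
  continuousOn_invFun := by
    have hb : ContinuousOn base (base ⁻¹' e.target) := contDiff_base.continuous.continuousOn
    have h1 : ContinuousOn (fun z => (e.symm (base z), z 2 • unitNormal x e (base z)))
        (base ⁻¹' e.target) :=
      (e.continuousOn_symm.comp hb fun z hz => hz).prodMk
        ((by fun_prop : Continuous fun z : E 3 => z 2).continuousOn.smul
          ((contDiffOn_unitNormal x he).continuousOn.comp hb fun z hz => hz))
    have hi : Topology.IsInducing (incl (x := x)) := ⟨rfl⟩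
    refine hi.continuousOn_iff.2 (h1.congr fun z hz => ?_)
    exact Prod.ext rfl (ofCoord_vec x he hz)

instance : ChartedSpace (E 3) (NormalBundle x) where
  atlas := {c | ∃ (e : OpenPartialHomeomorph M (E 2)) (he : e ∈ atlas (E 2) M),
    c = NormalBundle.chart x he}
  chartAt q := NormalBundle.chart x (chart_mem_atlas (E 2) q.pt)
  mem_chart_source q := mem_chart_source (E 2) q.pt
  chart_mem_atlas q := ⟨_, chart_mem_atlas (E 2) q.pt, rfl⟩

theorem contDiffOn_euclideanThree {F : E 3 → E 3} {s : Set (E 3)}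
    (h : ContDiffOn ℝ ∞ (fun z => base (F z)) s) (h' : ContDiffOn ℝ ∞ (fun z => F z 2) s) :
    ContDiffOn ℝ ∞ F s := by
  rw [contDiffOn_euclidean] at h ⊢
  intro i
  fin_cases i
  · simpa [base] using h 0
  · simpa [base] using h 1
  · simpa using h'

instance : IsManifold 𝓘(ℝ, E 3) ∞ (NormalBundle x) := by
  apply isManifold_of_contDiffOn
  rintro _ _ ⟨e, he, rfl⟩ ⟨e', he', rfl⟩
  have ht : ContDiffOn ℝ ∞ (e' ∘ e.symm) (e.symm ≫ₕ e').source := by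
    have h := (mem_groupoid_of_pregroupoid.1
      (StructureGroupoid.compatible (contDiffGroupoid ∞ 𝓘(ℝ, E 2)) he he')).1
    simpa [contDiffPregroupoid] using h
  set S := ((NormalBundle.chart x he).symm ≫ₕ NormalBundle.chart x he').source
  have hS : ∀ z ∈ S, base z ∈ (e.symm ≫ₕ e').source := fun z hz => hz
  have hb : ContDiffOn ℝ ∞ base S := contDiff_base.contDiffOn
  have h1 : ContDiffOn ℝ ∞ (fun z => e' (e.symm (base z))) S := ht.comp hb hS
  have h2 : ContDiffOn ℝ ∞ (fun z : E 3 => z 2 • unitNormal x e (base z)) S :=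
    (by fun_prop : ContDiff ℝ ∞ fun z : E 3 => z 2).contDiffOn.smul
      ((contDiffOn_unitNormal x he).comp hb fun z hz => (hS z hz).1)
  have h3 : ContDiffOn ℝ ∞ (fun z => unitNormal x e' (e' (e.symm (base z)))) S :=
    (contDiffOn_unitNormal x he').comp h1 fun z hz => e'.map_source (hS z hz).2
  have h4 := h2.inner ℝ h3
  have key : ContDiffOn ℝ ∞ ((NormalBundle.chart x he).symm ≫ₕ NormalBundle.chart x he') S := by
    refine contDiffOn_euclideanThree (h1.congr fun z hz => ?_) (h4.congr fun z hz => ?_)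
    · exact base_mk _ _
    · rw [← NormalBundle.ofCoord_vec x he (hS z hz).1]
      rfl
  simpa using key

/-- The identification `E³ × E³ = E⁶`. -/
def pair (q : E 3 × E 3) : E 6 := !₂[q.1 0, q.1 1, q.1 2, q.2 0, q.2 1, q.2 2]

/-- `pair` as a continuous linear map. -/
def pairL : E 3 × E 3 →L[ℝ] E 6 :=
  LinearMap.toContinuousLinearMap
    { toFun := pair
      map_add' := fun a b => by ext i; fin_cases i <;> simp [pair]
      map_smul' := fun a b => by ext i; fin_cases i <;> simp [pair] }

theorem pair_injective : Function.Injective pair := by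
  intro a b h
  have h' : ∀ i, pair a i = pair b i := fun i => by rw [h]
  refine Prod.ext ?_ ?_ <;> ext i <;> fin_cases i
  · exact h' 0
  · exact h' 1
  · exact h' 2
  · exact h' 3
  · exact h' 4
  · exact h' 5

/-- The map `f (p, ξ) = (x p, ξ)` from the normal bundle to `E³ × E³ = E⁶`. -/
def normalBundleMap (q : NormalBundle x) : E 6 := pair (x q.pt, q.vec)

theorem normalBundleMap_comp_symm (he : e ∈ atlas (E 2) M) {z : E 3} (hz : base z ∈ e.target) :
    normalBundleMap x ((NormalBundle.chart x he).symm z) =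
      pair ((x ∘ e.symm) (base z), z 2 • unitNormal x e (base z)) := by
  rw [← NormalBundle.ofCoord_vec x he hz]
  rfl

theorem contDiffOn_normalBundleMap (he : e ∈ atlas (E 2) M) :
    ContDiffOn ℝ ∞ (normalBundleMap x ∘ (NormalBundle.chart x he).symm) (base ⁻¹' e.target) := by
  have hb : ContDiffOn ℝ ∞ base (base ⁻¹' e.target) := contDiff_base.contDiffOn
  have h1 : ContDiffOn ℝ ∞ (fun z : E 3 => z 2 • unitNormal x e (base z)) (base ⁻¹' e.target) :=
    (by fun_prop : ContDiff ℝ ∞ fun z : E 3 => z 2).contDiffOn.smul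
      ((contDiffOn_unitNormal x he).comp hb fun z hz => hz)
  exact (pairL.contDiff.comp_contDiffOn
    (((x.contDiffOn he).comp hb fun z hz => hz).prodMk h1)).congr
      fun z hz => normalBundleMap_comp_symm x he hz

theorem contMDiff_normalBundleMap :
    ContMDiff 𝓘(ℝ, E 3) 𝓘(ℝ, E 6) ∞ (normalBundleMap x) := by
  intro q
  have he := chart_mem_atlas (E 2) q.pt
  have h := contDiffOn_normalBundleMap x he
  have h' : ContMDiffOn 𝓘(ℝ, E 3) 𝓘(ℝ, E 6) ∞
      ((normalBundleMap x ∘ (NormalBundle.chart x he).symm) ∘ NormalBundle.chart x he)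
      (NormalBundle.chart x he).source :=
    h.contMDiffOn.comp (contMDiffOn_chart (I := 𝓘(ℝ, E 3)) (x := q))
      fun p hp => (NormalBundle.chart x he).map_source hp
  refine (h'.congr fun p hp => ?_).contMDiffAt
    ((NormalBundle.chart x he).open_source.mem_nhds (mem_chart_source (E 2) q.pt))
  exact congrArg (normalBundleMap x) ((NormalBundle.chart x he).left_inv hp).symm

theorem injective_fderiv_normalBundleMap (he : e ∈ atlas (E 2) M) {z : E 3}
    (hz : base z ∈ e.target) :
    Function.Injective (fderiv ℝ (normalBundleMap x ∘ (NormalBundle.chart x he).symm) z) := by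
  obtain ⟨L, hL⟩ : ∃ L : E 3 →L[ℝ] E 2, ⇑L = base :=
    ⟨LinearMap.toContinuousLinearMap
      { toFun := base
        map_add' := fun a b => by ext i; fin_cases i <;> simp [base]
        map_smul' := fun a b => by ext i; fin_cases i <;> simp [base] }, rfl⟩
  have hB : HasFDerivAt base L z := by rw [← hL]; exact L.hasFDerivAt
  have hn := e.open_target.mem_nhds hz
  have hu : HasFDerivAt (x ∘ e.symm) (fderiv ℝ (x ∘ e.symm) (base z)) (base z) :=
    (((x.contDiffOn he).contDiffAt hn).differentiableAt (by simp)).hasFDerivAt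
  have hN : HasFDerivAt (unitNormal x e) (fderiv ℝ (unitNormal x e) (base z)) (base z) :=
    (((contDiffOn_unitNormal x he).contDiffAt hn).differentiableAt (by simp)).hasFDerivAt
  have h2 : HasFDerivAt (fun w : E 3 => w 2) (EuclideanSpace.proj (𝕜 := ℝ) (2 : Fin 3)) z :=
    (EuclideanSpace.proj (𝕜 := ℝ) (2 : Fin 3)).hasFDerivAt
  obtain ⟨D, hP, hD⟩ : ∃ D : E 3 →L[ℝ] E 3 × E 3,
      HasFDerivAt (fun w : E 3 => ((x ∘ e.symm) (base w), w 2 • unitNormal x e (base w))) D z ∧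
      ∀ w, D w = (fderiv ℝ (x ∘ e.symm) (base z) (L w),
        z 2 • fderiv ℝ (unitNormal x e) (base z) (L w) + w 2 • unitNormal x e (base z)) :=
    ⟨_, (hu.comp z hB).prodMk (h2.smul (hN.comp z hB)), fun w => rfl⟩
  have hG : HasFDerivAt (fun w : E 3 => pair ((x ∘ e.symm) (base w),
      w 2 • unitNormal x e (base w))) (pairL.comp D) z := pairL.hasFDerivAt.comp z hP
  have hev := hG.congr_of_eventuallyEq (f₁ := normalBundleMap x ∘ (NormalBundle.chart x he).symm)
    (Filter.eventually_of_mem ((e.open_target.preimage contDiff_base.continuous).mem_nhds hz)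
      fun w hw => normalBundleMap_comp_symm x he hw)
  rw [hev.fderiv, injective_iff_map_eq_zero]
  intro w hw
  have hw' : D w = 0 := pair_injective (hw.trans (map_zero pairL).symm)
  rw [hD] at hw'
  have hw1 : fderiv ℝ (x ∘ e.symm) (base z) (L w) = 0 := congrArg Prod.fst hw'
  have hw2 : z 2 • fderiv ℝ (unitNormal x e) (base z) (L w) + w 2 • unitNormal x e (base z) = 0 :=
    congrArg Prod.snd hw'
  have h0 : L w = 0 := x.injective_fderiv he hz (hw1.trans (map_zero _).symm)
  have hN0 : unitNormal x e (base z) ≠ 0 :=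
    norm_ne_zero_iff.1 (by rw [norm_unitNormal x he hz]; exact one_ne_zero)
  rw [h0, map_zero, smul_zero, zero_add, smul_eq_zero, or_iff_left hN0] at hw2
  rw [hL] at h0
  ext i
  fin_cases i
  · simpa [base] using congrArg (fun v : E 2 => v 0) h0
  · simpa [base] using congrArg (fun v : E 2 => v 1) h0
  · exact hw2

theorem injective_mfderiv_normalBundleMap (q : NormalBundle x) :
    Function.Injective (mfderiv 𝓘(ℝ, E 3) 𝓘(ℝ, E 6) (normalBundleMap x) q) := by
  rw [((contMDiff_normalBundleMap x q).mdifferentiableAt (by simp)).mfderiv]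
  have he := chart_mem_atlas (E 2) q.pt
  have hz : base (NormalBundle.chart x he q) ∈ (chartAt (E 2) q.pt).target :=
    (NormalBundle.chart x he).map_source (mem_chart_source (E 2) q.pt)
  have := injective_fderiv_normalBundleMap x he hz
  simpa using! this

/-- The normal bundle as an immersed submanifold of `E³ × E³ = E⁶`. -/
def normalBundleImmersion : Immersion 3 (NormalBundle x) (E 6) where
  toFun := normalBundleMap x
  contMDiff := contMDiff_normalBundleMap x
  injective_mfderiv := injective_mfderiv_normalBundleMap x

end

end NormalBundle

end Submanifold

end

namespace Submanifold

open Topology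

/-! ### Partial derivatives -/

section PartialDerivatives

variable {m n : ℕ} {V : Type*} [NormedAddCommGroup V] [InnerProductSpace ℝ V]
  {W : Type*} [NormedAddCommGroup W] [NormedSpace ℝ W]
  {W' : Type*} [NormedAddCommGroup W'] [NormedSpace ℝ W']

/-! Let `N` be a local unit normal of the surface `u` with metric `g`, `A` the shape operator, `τ =
tr A`, and `III` the Gram matrix of the derivatives of `N`. In the coordinates `(y, t)` the normal
bundle is `f = (u, t N)`, with metric `G_t + dt²` where `G_t = g + t² III`. Hence `Δφ = φ_tt +
Δ_{G_t} φ + t tr_{G_t}(III) φ_t` (`IsNormalField.lap_normalMap`), and `Δf = (P, t T)`, where `P =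
Δ_{G_t} u` and `T` is the part of `Δ_{G_t} N` orthogonal to `N`
(`IsNormalField.lap_normalMap_self`). The tension field of an immersion is its Laplacian, so
minimality means `Δf = 0`.

On the zero section `P` is `Δ_g u`, so a minimal bundle comes from a minimal surface. Conversely, if
`τ = 0` then `A²` is a multiple of the identity and `G_t` is conformal to `g`; in dimension two this
keeps `u` harmonic and `Δ_{G_t} N` parallel to `N`, so that `P = T = 0`
(`IsNormalField.lap_normalMap_eq_zero`).

A minimal immersion is biharmonic because the tension of a variation is `O(s)` and its bienergy
`O(s²)` (`isBiharmonic_of_tension_eq_zero`).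

If the bundle is biharmonic, variations supported in a chart give `Δ²f = 0` (`lap_lap_eq_zero`),
that is, `ΔP = 0` and `Δ(t T) = 0`. These are used along the zero section only. The expansion of `P`
to second order in `t` turns the first into `4 A∇τ = −τ∇τ` and `Δτ = τ|A|² + 2 tr A³`. The normal
component of the second, combined with the divergence of `4 A∇τ = −τ∇τ`, gives `3|∇τ|² = −τ Δτ`
(`IsNormalField.three_mul_sum_sq`). These equations are algebraic in `A` and `∇τ` once `Δτ` is
eliminated, and they force `τ = 0` (`eq_zero_of_shape`). Pointwise computations are made in
coordinates normal at the point (`ImmersionOn.exists_normal`). -/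

theorem pd_congr (i : Fin m) {φ ψ : E m → W} {y : E m} (h : φ =ᶠ[𝓝 y] ψ) :
    pd i φ =ᶠ[𝓝 y] pd i ψ :=
  (h.fderiv (𝕜 := ℝ)).mono fun z hz => by simp only [pd, hz]

theorem pd_congr_at (i : Fin m) {φ ψ : E m → W} {y : E m} (h : φ =ᶠ[𝓝 y] ψ) :
    pd i φ y = pd i ψ y := (pd_congr i h).eq_of_nhds

theorem eventuallyEq_of_isOpen {α β : Type*} [TopologicalSpace α] {U : Set α} (hU : IsOpen U)
    {φ ψ : α → β} (h : ∀ z ∈ U, φ z = ψ z) {y : α} (hy : y ∈ U) : φ =ᶠ[𝓝 y] ψ :=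
  Filter.eventually_of_mem (hU.mem_nhds hy) h

theorem differentiableAt_of_contDiffOn {φ : E m → W} {U : Set (E m)} (hU : IsOpen U)
    (h : ContDiffOn ℝ ∞ φ U) {y : E m} (hy : y ∈ U) : DifferentiableAt ℝ φ y :=
  (h.contDiffAt (hU.mem_nhds hy)).differentiableAt (by simp)

theorem contDiffOn_pd {φ : E m → W} {U : Set (E m)} (hU : IsOpen U)
    (h : ContDiffOn ℝ ∞ φ U) (i : Fin m) : ContDiffOn ℝ ∞ (pd i φ) U :=
  (h.fderiv_of_isOpen hU (by simp)).clm_apply contDiffOn_const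

theorem fderiv_eq_sum_pd (φ : E m → W) (y v : E m) :
    fderiv ℝ φ y v = ∑ i, v i • pd i φ y := by
  have : v = ∑ i, v i • EuclideanSpace.single i (1 : ℝ) := by
    ext j; simp [Finset.sum_apply, Pi.single_apply]
  conv_lhs => rw [this]
  simp only [map_sum, map_smul, pd]

@[simp] theorem pd_const (i : Fin m) (w : W) (y : E m) : pd i (fun _ => w) y = 0 := by
  simp [pd]

theorem pd_add (i : Fin m) {φ ψ : E m → W} {y : E m} (hφ : DifferentiableAt ℝ φ y)
    (hψ : DifferentiableAt ℝ ψ y) :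
    pd i (fun z => φ z + ψ z) y = pd i φ y + pd i ψ y := by
  simp only [pd, fderiv_fun_add hφ hψ, add_apply]

theorem pd_sub (i : Fin m) {φ ψ : E m → W} {y : E m} (hφ : DifferentiableAt ℝ φ y)
    (hψ : DifferentiableAt ℝ ψ y) :
    pd i (fun z => φ z - ψ z) y = pd i φ y - pd i ψ y := by
  simp only [pd, fderiv_fun_sub hφ hψ, sub_apply]

theorem pd_sum {ι : Type*} (s : Finset ι) (i : Fin m) {φ : ι → E m → W} {y : E m}
    (hφ : ∀ a ∈ s, DifferentiableAt ℝ (φ a) y) :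
    pd i (fun z => ∑ a ∈ s, φ a z) y = ∑ a ∈ s, pd i (φ a) y := by
  simp only [pd, fderiv_fun_sum hφ, _root_.sum_apply]

theorem pd_smul (i : Fin m) {c : E m → ℝ} {φ : E m → W} {y : E m} (hc : DifferentiableAt ℝ c y)
    (hφ : DifferentiableAt ℝ φ y) :
    pd i (fun z => c z • φ z) y = c y • pd i φ y + pd i c y • φ y := by
  simp [pd, fderiv_fun_smul hc hφ]

theorem pd_mul (i : Fin m) {c φ : E m → ℝ} {y : E m} (hc : DifferentiableAt ℝ c y)
    (hφ : DifferentiableAt ℝ φ y) :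
    pd i (fun z => c z * φ z) y = c y * pd i φ y + pd i c y * φ y := pd_smul i hc hφ

theorem pd_const_smul (i : Fin m) (c : ℝ) {φ : E m → W} {y : E m}
    (hφ : DifferentiableAt ℝ φ y) : pd i (fun z => c • φ z) y = c • pd i φ y := by
  simp [pd, fderiv_fun_const_smul hφ]

theorem pd_const_mul (i : Fin m) (c : ℝ) {φ : E m → ℝ} {y : E m}
    (hφ : DifferentiableAt ℝ φ y) : pd i (fun z => c * φ z) y = c * pd i φ y :=
  pd_const_smul i c hφ

theorem pd_inner (i : Fin m) {φ ψ : E m → V} {y : E m} (hφ : DifferentiableAt ℝ φ y)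
    (hψ : DifferentiableAt ℝ ψ y) :
    pd i (fun z => (inner ℝ (φ z) (ψ z) : ℝ)) y =
      inner ℝ (pd i φ y) (ψ y) + inner ℝ (φ y) (pd i ψ y) := by
  simp only [pd, fderiv_inner_apply ℝ hφ hψ]; ring

theorem pd_clm (i : Fin m) (L : W →L[ℝ] W') {φ : E m → W} {y : E m}
    (hφ : DifferentiableAt ℝ φ y) : pd i (fun z => L (φ z)) y = L (pd i φ y) := by
  have := (L.hasFDerivAt.comp y hφ.hasFDerivAt).fderiv
  simp only [pd]
  rw [show (fun z => L (φ z)) = L ∘ φ from rfl, this]; rfl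

theorem pd_comp (i : Fin n) {φ : E m → W} {ψ : E n → E m} {y : E n}
    (hφ : DifferentiableAt ℝ φ (ψ y)) (hψ : DifferentiableAt ℝ ψ y) :
    pd i (φ ∘ ψ) y = ∑ a, pd i ψ y a • pd a φ (ψ y) := by
  rw [pd, fderiv_comp y hφ hψ, ContinuousLinearMap.comp_apply, fderiv_eq_sum_pd]; rfl

theorem pd_apply (i : Fin n) {ψ : E n → E m} {y : E n} (hψ : DifferentiableAt ℝ ψ y)
    (a : Fin m) : pd i ψ y a = pd i (fun z => ψ z a) y :=
  (pd_clm i (EuclideanSpace.proj (𝕜 := ℝ) a) hψ).symm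

theorem pd_pd_eq_fderiv_fderiv {φ : E m → W} {y : E m} (h : ContDiffAt ℝ 2 φ y) (i j : Fin m) :
    pd i (pd j φ) y =
      fderiv ℝ (fderiv ℝ φ) y (EuclideanSpace.single i 1) (EuclideanSpace.single j 1) := by
  have hd : DifferentiableAt ℝ (fderiv ℝ φ) y :=
    (h.fderiv_right (m := 1) (by norm_num)).differentiableAt (by norm_num)
  exact pd_clm i (ContinuousLinearMap.apply ℝ W (EuclideanSpace.single j (1 : ℝ))) hd

theorem pd_comm {φ : E m → W} {y : E m} (h : ContDiffAt ℝ 2 φ y) (i j : Fin m) :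
    pd i (pd j φ) y = pd j (pd i φ) y := by
  rw [pd_pd_eq_fderiv_fderiv h, pd_pd_eq_fderiv_fderiv h]
  exact (h.isSymmSndFDerivAt (by simp)).eq _ _

/-- The second-order chain rule. The last sum, linear in the second derivatives of `ψ`, is what the
Christoffel symbols absorb in `ImmersionOn.lap_comp`. -/
theorem pd_pd_comp {φ : E m → W} {ψ : E n → E m} {U : Set (E m)} {U' : Set (E n)}
    (hU : IsOpen U) (hU' : IsOpen U') (hφ : ContDiffOn ℝ ∞ φ U) (hψ : ContDiffOn ℝ ∞ ψ U')
    (hm : Set.MapsTo ψ U' U) {y : E n} (hy : y ∈ U') (i j : Fin n) :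
    pd i (pd j (φ ∘ ψ)) y = (∑ a, ∑ b, (pd i ψ y a * pd j ψ y b) • pd a (pd b φ) (ψ y)) +
      ∑ a, pd i (pd j ψ) y a • pd a φ (ψ y) := by
  have h1 : pd j (φ ∘ ψ) =ᶠ[𝓝 y] fun z => ∑ a, pd j ψ z a • pd a φ (ψ z) :=
    eventuallyEq_of_isOpen hU' (fun z hz => pd_comp j
      (differentiableAt_of_contDiffOn hU hφ (hm hz)) (differentiableAt_of_contDiffOn hU' hψ hz)) hy
  have hdψ := differentiableAt_of_contDiffOn hU' (contDiffOn_pd hU' hψ j) hy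
  have h2 : ∀ a : Fin m, DifferentiableAt ℝ (fun z => pd j ψ z a) y := fun a =>
    (EuclideanSpace.proj (𝕜 := ℝ) a).differentiableAt.comp y hdψ
  have h3 : ∀ a : Fin m, DifferentiableAt ℝ (pd a φ ∘ ψ) y := fun a =>
    (differentiableAt_of_contDiffOn hU (contDiffOn_pd hU hφ a) (hm hy)).comp y
      (differentiableAt_of_contDiffOn hU' hψ hy)
  rw [pd_congr_at i h1, pd_sum (φ := fun a z => pd j ψ z a • pd a φ (ψ z)) _ _
    fun a _ => (h2 a).smul (h3 a)]
  have h4 : ∀ a : Fin m, pd i (fun z => pd j ψ z a • pd a φ (ψ z)) y =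
      pd j ψ y a • (∑ b, pd i ψ y b • pd b (pd a φ) (ψ y)) +
        pd i (pd j ψ) y a • pd a φ (ψ y) := fun a => by
    rw [pd_smul (φ := fun z => pd a φ (ψ z)) i (h2 a) (h3 a), ← pd_apply i hdψ a]
    congr 2
    exact pd_comp i (differentiableAt_of_contDiffOn hU (contDiffOn_pd hU hφ a) (hm hy))
      (differentiableAt_of_contDiffOn hU' hψ hy)
  simp only [h4, Finset.sum_add_distrib, Finset.smul_sum, smul_smul]
  congr 1
  rw [Finset.sum_comm]
  simp only [mul_comm]

end PartialDerivatives

/-! ### Derivatives of determinants and inverses -/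

section Matrices

variable {m n : ℕ}

theorem contDiffOn_det {A : E m → Matrix (Fin n) (Fin n) ℝ} {U : Set (E m)}
    (h : ∀ i j, ContDiffOn ℝ ∞ (fun z => A z i j) U) : ContDiffOn ℝ ∞ (fun z => (A z).det) U := by
  simp only [Matrix.det_apply']
  exact ContDiffOn.sum fun σ _ => contDiffOn_const.mul (contDiffOn_prod fun i _ => h _ _)

/-- Each entry is the reciprocal of the determinant times a cofactor, itself the determinant of a
matrix with one row replaced by a constant one. -/
theorem contDiffOn_inv_apply {A : E m → Matrix (Fin n) (Fin n) ℝ} {U : Set (E m)}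
    (h : ∀ i j, ContDiffOn ℝ ∞ (fun z => A z i j) U) (h0 : ∀ z ∈ U, (A z).det ≠ 0) (i j : Fin n) :
    ContDiffOn ℝ ∞ (fun z => (A z)⁻¹ i j) U := by
  have h1 : ∀ z, (A z)⁻¹ i j = ((A z).det)⁻¹ * ((A z).updateRow j (Pi.single i 1)).det := by
    intro z
    rw [Matrix.inv_def, Matrix.smul_apply, Matrix.adjugate_apply, Ring.inverse_eq_inv', smul_eq_mul]
  simp only [h1]
  refine ((contDiffOn_det h).inv h0).mul (contDiffOn_det fun a b => ?_)
  by_cases ha : a = j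
  · simp only [ha, Matrix.updateRow_self]; exact contDiffOn_const
  · simp only [Matrix.updateRow_ne ha]; exact h a b

/-- Jacobi's formula. Differentiating the Leibniz expansion gives the determinants with one column
replaced by its derivative; Cramer's rule expresses these through the adjugate, that is, `det A •
A⁻¹`. -/
theorem pd_det {A : E m → Matrix (Fin n) (Fin n) ℝ} {y : E m}
    (h : ∀ i j, DifferentiableAt ℝ (fun z => A z i j) y) (h0 : (A y).det ≠ 0) (p : Fin m) :
    pd p (fun z => (A z).det) y =
      (A y).det * ∑ i, ∑ j, (A y)⁻¹ i j * pd p (fun z => A z j i) y := by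
  have h1 : HasFDerivAt (fun z => (A z).det)
      (∑ σ : Equiv.Perm (Fin n), ((Equiv.Perm.sign σ : ℤ) : ℝ) •
        ∑ i, (∏ j ∈ Finset.univ.erase i, A y (σ j) j) • fderiv ℝ (fun z => A z (σ i) i) y) y := by
    simp only [Matrix.det_apply']
    refine HasFDerivAt.fun_sum fun σ _ => ?_
    exact (HasFDerivAt.finsetProd fun i _ => (h (σ i) i).hasFDerivAt).const_mul
      ((Equiv.Perm.sign σ : ℤ) : ℝ)
  have h2 : ∀ i, ∑ σ : Equiv.Perm (Fin n), ((Equiv.Perm.sign σ : ℤ) : ℝ) •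
      ((∏ j ∈ Finset.univ.erase i, A y (σ j) j) * pd p (fun z => A z (σ i) i) y) =
      ((A y).updateCol i fun j => pd p (fun z => A z j i) y).det := by
    intro i
    rw [Matrix.det_apply']
    refine Finset.sum_congr rfl fun σ _ => ?_
    rw [← Finset.mul_prod_erase _ _ (Finset.mem_univ i), Matrix.updateCol_self, smul_eq_mul,
      mul_comm (pd p _ y)]
    congr 2
    refine Finset.prod_congr rfl fun j hj => ?_
    rw [Matrix.updateCol_ne (Finset.ne_of_mem_erase hj)]
  rw [pd, h1.fderiv]
  simp only [_root_.sum_apply, _root_.smul_apply, Finset.smul_sum,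
    smul_eq_mul]
  rw [Finset.sum_comm, Finset.mul_sum]
  refine Finset.sum_congr rfl fun i _ => (h2 i).trans ?_
  rw [← Matrix.cramer_apply, Matrix.cramer_eq_adjugate_mulVec, Matrix.mulVec, dotProduct,
    Finset.mul_sum]
  refine Finset.sum_congr rfl fun j _ => ?_
  rw [Matrix.inv_def, Matrix.smul_apply, Ring.inverse_eq_inv', smul_eq_mul, ← mul_assoc,
    ← mul_assoc, mul_inv_cancel₀ h0, one_mul]

/-- Differentiate `A * A⁻¹ = 1` and multiply on the left by `A⁻¹`. -/
theorem pd_inv_apply {A : E m → Matrix (Fin n) (Fin n) ℝ} {U : Set (E m)} (hU : IsOpen U)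
    (h : ∀ i j, ContDiffOn ℝ ∞ (fun z => A z i j) U) (h0 : ∀ z ∈ U, (A z).det ≠ 0) {y : E m}
    (hy : y ∈ U) (p : Fin m) (i j : Fin n) :
    pd p (fun z => (A z)⁻¹ i j) y =
      -∑ a, ∑ b, (A y)⁻¹ i a * pd p (fun z => A z a b) y * (A y)⁻¹ b j := by
  have hu : ∀ z ∈ U, IsUnit (A z).det := fun z hz => (h0 z hz).isUnit
  have hdA : ∀ i j, DifferentiableAt ℝ (fun z => A z i j) y := fun i j =>
    differentiableAt_of_contDiffOn hU (h i j) hy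
  have hdB : ∀ i j, DifferentiableAt ℝ (fun z => (A z)⁻¹ i j) y := fun i j =>
    differentiableAt_of_contDiffOn hU (contDiffOn_inv_apply h h0 i j) hy
  set A' : Matrix (Fin n) (Fin n) ℝ := Matrix.of fun i j => pd p (fun z => A z i j) y with hA'
  set B' : Matrix (Fin n) (Fin n) ℝ := Matrix.of fun i j => pd p (fun z => (A z)⁻¹ i j) y with hB'
  have key : A y * B' + A' * (A y)⁻¹ = 0 := by
    ext a c
    have h1 : (fun z => ∑ b, A z a b * (A z)⁻¹ b c) =ᶠ[𝓝 y]
        fun _ => (1 : Matrix (Fin n) (Fin n) ℝ) a c :=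
      eventuallyEq_of_isOpen hU (fun z hz => by
        rw [← Matrix.mul_apply, Matrix.mul_nonsing_inv _ (hu z hz)]) hy
    have h2 := pd_congr_at p h1
    rw [pd_const, pd_sum (φ := fun b z => A z a b * (A z)⁻¹ b c) _ _
      fun b _ => (hdA a b).mul (hdB b c)] at h2
    simp only [pd_mul p (hdA a _) (hdB _ c), Finset.sum_add_distrib] at h2
    simpa [Matrix.mul_apply, hA', hB'] using h2
  have h3 : B' = -((A y)⁻¹ * A' * (A y)⁻¹) := by
    have h4 : (A y)⁻¹ * (A y * B' + A' * (A y)⁻¹) = 0 := by rw [key, Matrix.mul_zero]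
    rw [Matrix.mul_add, ← Matrix.mul_assoc, Matrix.nonsing_inv_mul _ (hu y hy), Matrix.one_mul,
      ← Matrix.mul_assoc] at h4
    exact eq_neg_of_add_eq_zero_left h4
  have h5 := congrFun (congrFun h3 i) j
  simp only [hB', Matrix.of_apply] at h5
  rw [h5, Matrix.neg_apply, Matrix.mul_apply, Finset.sum_comm]
  simp only [Matrix.mul_apply, Finset.sum_mul]
  rfl

end Matrices

end Submanifold

namespace Submanifold

open Topology

/-! ### The Laplacian of an immersion in coordinates -/

section Laplacian

variable {m n : ℕ} {V : Type*} [NormedAddCommGroup V] [InnerProductSpace ℝ V]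
  {W : Type*} [NormedAddCommGroup W] [NormedSpace ℝ W]
  {W' : Type*} [NormedAddCommGroup W'] [NormedSpace ℝ W']

/-- The Gram matrix of the partial derivatives of `f`. -/
noncomputable def gram (f : E m → V) (y : E m) : Matrix (Fin m) (Fin m) ℝ :=
  Matrix.of fun i j => inner ℝ (pd i f y) (pd j f y)

/-- The Christoffel symbols `Γᵏᵢⱼ` of the metric induced by `f`, as the coefficients of the
tangential part of `∂ᵢ∂ⱼf`. -/
noncomputable def gamma (f : E m → V) (k i j : Fin m) (y : E m) : ℝ :=
  ∑ l, (gram f y)⁻¹ k l * inner ℝ (pd i (pd j f) y) (pd l f y)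

/-- The Laplacian of `φ` with respect to the metric induced by `f`. -/
noncomputable def lap (f : E m → V) (φ : E m → W) (y : E m) : W :=
  ∑ i, ∑ j, (gram f y)⁻¹ i j • (pd i (pd j φ) y - ∑ k, gamma f k i j y • pd k φ y)

/-- The map `f` is a smooth immersion of the open set `U`. -/
structure ImmersionOn (f : E m → V) (U : Set (E m)) : Prop where
  isOpen : IsOpen U
  contDiffOn : ContDiffOn ℝ ∞ f U
  injective : ∀ y ∈ U, Function.Injective (fderiv ℝ f y)

theorem gram_apply (f : E m → V) (y : E m) (i j : Fin m) :
    gram f y i j = inner ℝ (pd i f y) (pd j f y) := rfl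

theorem gram_symm (f : E m → V) (y : E m) : (gram f y).transpose = gram f y := by
  ext i j; exact real_inner_comm _ _

theorem gram_inv_symm (f : E m → V) (y : E m) (i j : Fin m) :
    (gram f y)⁻¹ i j = (gram f y)⁻¹ j i := by
  conv_lhs => rw [← gram_symm, ← Matrix.transpose_nonsing_inv]
  rfl

theorem contDiffAt_two {φ : E m → W} {U : Set (E m)} (hU : IsOpen U)
    (h : ContDiffOn ℝ ∞ φ U) {y : E m} (hy : y ∈ U) : ContDiffAt ℝ 2 φ y :=
  (h.contDiffAt (hU.mem_nhds hy)).of_le (WithTop.coe_le_coe.2 (le_top : (2 : ℕ∞) ≤ ⊤))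

variable {f : E m → V} {U : Set (E m)}

theorem ImmersionOn.det_pos (hf : ImmersionOn f U) {y : E m} (hy : y ∈ U) :
    0 < (gram f y).det := by
  refine Matrix.PosDef.det_pos (Matrix.posDef_gram_of_linearIndependent (𝕜 := ℝ)
    (v := fun i => pd i f y) ?_)
  rw [Fintype.linearIndependent_iff]
  intro c hc i
  have h : fderiv ℝ f y (WithLp.toLp 2 c) = fderiv ℝ f y 0 := by
    rw [fderiv_eq_sum_pd, map_zero]; exact hc
  exact congrArg (fun v : E m => v i) (hf.injective y hy h)

theorem ImmersionOn.isUnit_det (hf : ImmersionOn f U) {y : E m} (hy : y ∈ U) :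
    IsUnit (gram f y).det := (hf.det_pos hy).ne'.isUnit

theorem ImmersionOn.contDiffOn_pd (hf : ImmersionOn f U) (i : Fin m) :
    ContDiffOn ℝ ∞ (pd i f) U := Submanifold.contDiffOn_pd hf.isOpen hf.contDiffOn i

theorem ImmersionOn.contDiffOn_gram (hf : ImmersionOn f U) (i j : Fin m) :
    ContDiffOn ℝ ∞ (fun z => gram f z i j) U := (hf.contDiffOn_pd i).inner ℝ (hf.contDiffOn_pd j)

theorem ImmersionOn.contDiffOn_gram_inv (hf : ImmersionOn f U) (i j : Fin m) :
    ContDiffOn ℝ ∞ (fun z => (gram f z)⁻¹ i j) U :=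
  contDiffOn_inv_apply hf.contDiffOn_gram (fun _ hz => (hf.det_pos hz).ne') i j

theorem ImmersionOn.contDiffOn_gamma (hf : ImmersionOn f U) (k i j : Fin m) :
    ContDiffOn ℝ ∞ (gamma f k i j) U :=
  ContDiffOn.sum fun l _ => (hf.contDiffOn_gram_inv k l).mul
    ((Submanifold.contDiffOn_pd hf.isOpen (hf.contDiffOn_pd j) i).inner ℝ (hf.contDiffOn_pd l))

theorem ImmersionOn.contDiffOn_lap (hf : ImmersionOn f U) {φ : E m → W}
    (hφ : ContDiffOn ℝ ∞ φ U) : ContDiffOn ℝ ∞ (lap f φ) U :=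
  ContDiffOn.sum fun i _ => ContDiffOn.sum fun j _ => (hf.contDiffOn_gram_inv i j).smul
    ((Submanifold.contDiffOn_pd hf.isOpen (Submanifold.contDiffOn_pd hf.isOpen hφ j) i).sub
      (ContDiffOn.sum fun k _ => (hf.contDiffOn_gamma k i j).smul
        (Submanifold.contDiffOn_pd hf.isOpen hφ k)))

theorem ImmersionOn.pd_gram (hf : ImmersionOn f U) {y : E m} (hy : y ∈ U) (p i j : Fin m) :
    pd p (fun z => gram f z i j) y =
      inner ℝ (pd p (pd i f) y) (pd j f y) + inner ℝ (pd p (pd j f) y) (pd i f y) := by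
  rw [real_inner_comm (pd i f y)]
  exact pd_inner p (differentiableAt_of_contDiffOn hf.isOpen (hf.contDiffOn_pd i) hy)
    (differentiableAt_of_contDiffOn hf.isOpen (hf.contDiffOn_pd j) hy)

theorem ImmersionOn.pd_pd_comm (hf : ImmersionOn f U) {y : E m} (hy : y ∈ U) (i j : Fin m) :
    pd i (pd j f) y = pd j (pd i f) y := pd_comm (contDiffAt_two hf.isOpen hf.contDiffOn hy) i j

/-- The Christoffel symbols are given by the derivatives of the metric. -/
theorem ImmersionOn.gamma_eq (hf : ImmersionOn f U) {y : E m} (hy : y ∈ U) (k i j : Fin m) :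
    (1 / 2) * ∑ l, (gram f y)⁻¹ k l * (pd i (fun z => gram f z j l) y
      + pd j (fun z => gram f z i l) y - pd l (fun z => gram f z i j) y) = gamma f k i j y := by
  rw [gamma, Finset.mul_sum]
  refine Finset.sum_congr rfl fun l _ => ?_
  rw [hf.pd_gram hy, hf.pd_gram hy, hf.pd_gram hy, hf.pd_pd_comm hy j i, hf.pd_pd_comm hy l i,
    hf.pd_pd_comm hy l j]
  ring

/-- The linear system that characterises the Christoffel symbols: `∑ Γˡᵢⱼ ∂ₗf` has the same inner
products with the tangent vectors as `∂ᵢ∂ⱼf`. -/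
theorem ImmersionOn.sum_gamma_mul_gram (hf : ImmersionOn f U) {y : E m} (hy : y ∈ U)
    (i j k : Fin m) :
    ∑ l, gamma f l i j y * gram f y l k = inner ℝ (pd i (pd j f) y) (pd k f y) := by
  have h := Matrix.nonsing_inv_mul _ (hf.isUnit_det hy)
  simp only [gamma, Finset.sum_mul]
  rw [Finset.sum_comm]
  have h1 : ∀ a, ∑ l, (gram f y)⁻¹ l a * inner ℝ (pd i (pd j f) y) (pd a f y) * gram f y l k =
      (1 : Matrix (Fin m) (Fin m) ℝ) a k * inner ℝ (pd i (pd j f) y) (pd a f y) := by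
    intro a
    rw [← h, Matrix.mul_apply, Finset.sum_mul]
    refine Finset.sum_congr rfl fun l _ => ?_
    rw [gram_inv_symm f y l a]; ring
  simp [h1, Matrix.one_apply]

/-- The inverse metric and the Christoffel symbols are the unique solutions of linear systems, so
candidates need only be verified. The transformation law under a change of coordinates is checked in
this way. -/
theorem lap_eq_of {H : Matrix (Fin m) (Fin m) ℝ} {C : Fin m → Fin m → Fin m → ℝ} {y : E m}
    (hH : gram f y * H = 1)
    (hC : ∀ i j k, ∑ l, C l i j * gram f y l k = inner ℝ (pd i (pd j f) y) (pd k f y))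
    (φ : E m → W) :
    lap f φ y = ∑ i, ∑ j, H i j • (pd i (pd j φ) y - ∑ k, C k i j • pd k φ y) := by
  have h1 : (gram f y)⁻¹ = H := Matrix.inv_eq_right_inv hH
  have h2 : ∀ k i j, gamma f k i j y = C k i j := by
    intro k i j
    have hHs : ∀ l, H k l = H l k := fun l => by rw [← h1, gram_inv_symm]
    simp only [gamma, ← hC, h1, Finset.mul_sum]
    rw [Finset.sum_comm]
    have h3 : ∀ a, ∑ l, H k l * (C a i j * gram f y a l) =
        C a i j * (1 : Matrix (Fin m) (Fin m) ℝ) a k := fun a => by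
      rw [← hH, Matrix.mul_apply, Finset.mul_sum]
      exact Finset.sum_congr rfl fun l _ => by rw [hHs]; ring
    simp [h3, Matrix.one_apply]
  simp only [lap, h1, h2]

theorem lap_congr {φ ψ : E m → W} {y : E m} (h : φ =ᶠ[𝓝 y] ψ) : lap f φ y = lap f ψ y := by
  simp only [lap, fun i j => pd_congr_at i (pd_congr j h), fun k => pd_congr_at k h]

theorem lap_congr_left {g : E m → V} {φ : E m → W} {y : E m} (h : f =ᶠ[𝓝 y] g) :
    lap f φ y = lap g φ y := by
  have h1 : gram f y = gram g y := by
    ext i j; rw [gram_apply, gram_apply, pd_congr_at i h, pd_congr_at j h]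
  simp only [lap, gamma, h1, fun i j => pd_congr_at i (pd_congr j h), fun k => pd_congr_at k h]

theorem lap_add {φ ψ : E m → W} (hU : IsOpen U) (hφ : ContDiffOn ℝ ∞ φ U)
    (hψ : ContDiffOn ℝ ∞ ψ U) {y : E m} (hy : y ∈ U) :
    lap f (fun z => φ z + ψ z) y = lap f φ y + lap f ψ y := by
  have h1 : ∀ k, pd k (fun z => φ z + ψ z) y = pd k φ y + pd k ψ y := fun k =>
    pd_add k (differentiableAt_of_contDiffOn hU hφ hy) (differentiableAt_of_contDiffOn hU hψ hy)
  have h2 : ∀ i j, pd i (pd j fun z => φ z + ψ z) y = pd i (pd j φ) y + pd i (pd j ψ) y := by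
    intro i j
    rw [pd_congr_at i (eventuallyEq_of_isOpen hU (fun z hz => pd_add j
      (differentiableAt_of_contDiffOn hU hφ hz) (differentiableAt_of_contDiffOn hU hψ hz)) hy)]
    exact pd_add i (differentiableAt_of_contDiffOn hU (contDiffOn_pd hU hφ j) hy)
      (differentiableAt_of_contDiffOn hU (contDiffOn_pd hU hψ j) hy)
  simp only [lap, h1, h2, smul_add, ← Finset.sum_add_distrib, smul_sub]
  refine Finset.sum_congr rfl fun i _ => Finset.sum_congr rfl fun j _ => ?_
  rw [Finset.sum_add_distrib, smul_add]; abel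

theorem lap_clm (L : W →L[ℝ] W') {φ : E m → W} (hU : IsOpen U) (hφ : ContDiffOn ℝ ∞ φ U)
    {y : E m} (hy : y ∈ U) : lap f (fun z => L (φ z)) y = L (lap f φ y) := by
  have h1 : ∀ k, pd k (fun z => L (φ z)) y = L (pd k φ y) := fun k =>
    pd_clm k L (differentiableAt_of_contDiffOn hU hφ hy)
  have h2 : ∀ i j, pd i (pd j fun z => L (φ z)) y = L (pd i (pd j φ) y) := by
    intro i j
    rw [pd_congr_at i (eventuallyEq_of_isOpen hU (fun z hz =>
      pd_clm j L (differentiableAt_of_contDiffOn hU hφ hz)) hy)]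
    exact pd_clm i L (differentiableAt_of_contDiffOn hU (contDiffOn_pd hU hφ j) hy)
  simp only [lap, h1, h2, map_sum, map_smul, map_sub]

theorem lap_const_smul (c : ℝ) {φ : E m → W} (hU : IsOpen U) (hφ : ContDiffOn ℝ ∞ φ U)
    {y : E m} (hy : y ∈ U) : lap f (fun z => c • φ z) y = c • lap f φ y :=
  lap_clm (c • ContinuousLinearMap.id ℝ W) hU hφ hy

theorem pd_pd_smul {c : E m → ℝ} {φ : E m → W} (hU : IsOpen U) (hc : ContDiffOn ℝ ∞ c U)
    (hφ : ContDiffOn ℝ ∞ φ U) {y : E m} (hy : y ∈ U) (i j : Fin m) :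
    pd i (pd j fun z => c z • φ z) y = c y • pd i (pd j φ) y + pd i c y • pd j φ y +
      pd j c y • pd i φ y + pd i (pd j c) y • φ y := by
  have d1 := fun z hz => differentiableAt_of_contDiffOn hU hc (y := z) hz
  have d2 := fun z hz => differentiableAt_of_contDiffOn hU hφ (y := z) hz
  have d3 := differentiableAt_of_contDiffOn hU (contDiffOn_pd hU hc j) hy
  have d4 := differentiableAt_of_contDiffOn hU (contDiffOn_pd hU hφ j) hy
  rw [pd_congr_at i (eventuallyEq_of_isOpen hU
    (fun z hz => pd_smul j (d1 z hz) (d2 z hz)) hy),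
    pd_add (φ := fun z => c z • pd j φ z) (ψ := fun z => pd j c z • φ z) i
      ((d1 y hy).smul d4) (d3.smul (d2 y hy)), pd_smul i (d1 y hy) d4, pd_smul i d3 (d2 y hy)]
  abel

/-- The two mixed first-order terms agree by the symmetry of the inverse metric, whence the factor
`2`. -/
theorem lap_smul {c : E m → ℝ} {φ : E m → W} (hU : IsOpen U) (hc : ContDiffOn ℝ ∞ c U)
    (hφ : ContDiffOn ℝ ∞ φ U) {y : E m} (hy : y ∈ U) :
    lap f (fun z => c z • φ z) y = c y • lap f φ y +
      (2 : ℝ) • (∑ i, ∑ j, ((gram f y)⁻¹ i j * pd i c y) • pd j φ y) + lap f c y • φ y := by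
  have d1 := differentiableAt_of_contDiffOn hU hc hy
  have d2 := differentiableAt_of_contDiffOn hU hφ hy
  have hs : ∑ i, ∑ j, ((gram f y)⁻¹ i j * pd j c y) • pd i φ y =
      ∑ i, ∑ j, ((gram f y)⁻¹ i j * pd i c y) • pd j φ y := by
    rw [Finset.sum_comm]
    refine Finset.sum_congr rfl fun i _ => Finset.sum_congr rfl fun j _ => ?_
    rw [gram_inv_symm]
  rw [two_smul]
  nth_rewrite 2 [← hs]
  simp only [lap, pd_pd_smul hU hc hφ hy, fun k => pd_smul k d1 d2, Finset.smul_sum,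
    Finset.sum_smul, ← Finset.sum_add_distrib]
  refine Finset.sum_congr rfl fun i _ => Finset.sum_congr rfl fun j _ => ?_
  have h : ∑ k, gamma f k i j y • (c y • pd k φ y + pd k c y • φ y) =
      c y • (∑ k, gamma f k i j y • pd k φ y) + (∑ k, gamma f k i j y • pd k c y) • φ y := by
    rw [Finset.smul_sum, Finset.sum_smul, ← Finset.sum_add_distrib]
    refine Finset.sum_congr rfl fun k _ => ?_
    rw [smul_add, smul_comm, smul_assoc]
  rw [h]
  simp only [smul_eq_mul]
  module

/-- Each `∂ᵢ∂ⱼf − ∑ Γᵏᵢⱼ ∂ₖf` is the normal part of `∂ᵢ∂ⱼf`, so the trace is normal as well. -/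
theorem ImmersionOn.inner_lap_self (hf : ImmersionOn f U) {y : E m} (hy : y ∈ U) (k : Fin m) :
    inner ℝ (lap f f y) (pd k f y) = 0 := by
  simp only [lap, sum_inner, real_inner_smul_left, inner_sub_left]
  refine Finset.sum_eq_zero fun i _ => Finset.sum_eq_zero fun j _ => ?_
  have := hf.sum_gamma_mul_gram hy i j k
  simp only [gram_apply] at this
  rw [this, sub_self, mul_zero]

end Laplacian

end Submanifold

namespace Submanifold

open Topology

/-! ### Invariance and divergence form of the Laplacian -/

section Invariance

variable {m n : ℕ} {V : Type*} [NormedAddCommGroup V] [InnerProductSpace ℝ V]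
  {W : Type*} [NormedAddCommGroup W] [NormedSpace ℝ W]
  {f : E m → V} {U U' : Set (E m)} {ψ : E m → E m}

/-- The Jacobian matrix of `ψ`. -/
noncomputable def jacobian (ψ : E m → E m) (y : E m) : Matrix (Fin m) (Fin m) ℝ :=
  Matrix.of fun a i => pd i ψ y a

theorem jacobian_eq_toMatrix (y : E m) :
    jacobian ψ y = LinearMap.toMatrix (EuclideanSpace.basisFun (Fin m) ℝ).toBasis
      (EuclideanSpace.basisFun (Fin m) ℝ).toBasis (fderiv ℝ ψ y).toLinearMap := by
  ext a i
  simp [jacobian, pd, LinearMap.toMatrix_apply]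

theorem det_jacobian (y : E m) : (jacobian ψ y).det = (fderiv ℝ ψ y).det := by
  rw [jacobian_eq_toMatrix, LinearMap.det_toMatrix]

theorem det_jacobian_ne_zero {y : E m} (h : Function.Injective (fderiv ℝ ψ y)) :
    (jacobian ψ y).det ≠ 0 := by
  intro h0
  obtain ⟨v, hv, hv0⟩ := Matrix.exists_mulVec_eq_zero_iff.2 h0
  refine hv ?_
  have h1 : fderiv ℝ ψ y (WithLp.toLp 2 v) = fderiv ℝ ψ y 0 := by
    rw [map_zero, fderiv_eq_sum_pd]
    ext a
    have := congrFun hv0 a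
    simp only [Matrix.mulVec, dotProduct, jacobian, Matrix.of_apply] at this
    simpa [Finset.sum_apply, mul_comm] using this
  exact congrArg WithLp.ofLp (h h1)

theorem ImmersionOn.comp (hf : ImmersionOn f U) (hU' : IsOpen U') (hψ : ContDiffOn ℝ ∞ ψ U')
    (hm : Set.MapsTo ψ U' U) (hi : ∀ y ∈ U', Function.Injective (fderiv ℝ ψ y)) :
    ImmersionOn (f ∘ ψ) U' where
  isOpen := hU'
  contDiffOn := hf.contDiffOn.comp hψ hm
  injective y hy := by
    rw [fderiv_comp y (differentiableAt_of_contDiffOn hf.isOpen hf.contDiffOn (hm hy))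
      (differentiableAt_of_contDiffOn hU' hψ hy)]
    exact (hf.injective _ (hm hy)).comp (hi y hy)

theorem gram_comp {y : E m} (hf : DifferentiableAt ℝ f (ψ y)) (hψ : DifferentiableAt ℝ ψ y) :
    gram (f ∘ ψ) y = (jacobian ψ y).transpose * gram f (ψ y) * jacobian ψ y := by
  ext i j
  rw [gram_apply, pd_comp i hf hψ, pd_comp j hf hψ]
  simp only [sum_inner, inner_sum, real_inner_smul_left, real_inner_smul_right, Matrix.mul_apply,
    Finset.sum_mul, Matrix.transpose_apply, jacobian, Matrix.of_apply, gram_apply]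
  refine Finset.sum_congr rfl fun a _ => Finset.sum_congr rfl fun b _ => ?_
  rw [real_inner_comm]; ring

theorem sum_smul_pd_comp {φ : E m → W} {y : E m} (hφ : DifferentiableAt ℝ φ (ψ y))
    (hψ : DifferentiableAt ℝ ψ y) {c s : Fin m → ℝ}
    (h : ∀ a, ∑ l, c l * jacobian ψ y a l = s a) :
    ∑ l, c l • pd l (φ ∘ ψ) y = ∑ a, s a • pd a φ (ψ y) := by
  simp only [fun l => pd_comp l hφ hψ, Finset.smul_sum, smul_smul]
  rw [Finset.sum_comm]
  refine Finset.sum_congr rfl fun a _ => ?_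
  rw [← h, Finset.sum_smul]
  rfl

/-- The Laplacian does not depend on the coordinates. -/
theorem ImmersionOn.lap_comp (hf : ImmersionOn f U) (hU' : IsOpen U') (hψ : ContDiffOn ℝ ∞ ψ U')
    (hm : Set.MapsTo ψ U' U) {y : E m} (hy : y ∈ U') (hi : Function.Injective (fderiv ℝ ψ y))
    {φ : E m → W} (hφ : ContDiffOn ℝ ∞ φ U) :
    lap (f ∘ ψ) (φ ∘ ψ) y = lap f φ (ψ y) := by
  have df := differentiableAt_of_contDiffOn hf.isOpen hf.contDiffOn (hm hy)
  have dφ := differentiableAt_of_contDiffOn hf.isOpen hφ (hm hy)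
  have dψ := differentiableAt_of_contDiffOn hU' hψ hy
  set J := jacobian ψ y with hJ
  have hJu : IsUnit J.det := (det_jacobian_ne_zero hi).isUnit
  set G := gram f (ψ y) with hG
  have hGu : IsUnit G.det := hf.isUnit_det (hm hy)
  -- The transformation law of the Christoffel symbols, `C = J⁻¹ (J J Γ + ∂∂ψ)`. Afterwards `C` is
  -- only used through `J C = S`.
  set S : Fin m → Fin m → Fin m → ℝ := fun c i j =>
    (∑ a, ∑ b, J a i * J b j * gamma f c a b (ψ y)) + pd i (pd j ψ) y c with hS
  set C : Fin m → Fin m → Fin m → ℝ := fun l i j => ∑ c, J⁻¹ l c * S c i j with hC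
  have hJC : ∀ i j c, ∑ l, C l i j * J c l = S c i j := by
    intro i j c
    have h1 : ∀ d, ∑ l, J⁻¹ l d * S d i j * J c l =
        (1 : Matrix (Fin m) (Fin m) ℝ) c d * S d i j := fun d => by
      rw [← Matrix.mul_nonsing_inv J hJu, Matrix.mul_apply, Finset.sum_mul]
      exact Finset.sum_congr rfl fun l _ => by ring
    simp only [hC, Finset.sum_mul]
    rw [Finset.sum_comm]
    simp [h1, Matrix.one_apply]
  have hH : gram (f ∘ ψ) y * (J⁻¹ * G⁻¹ * J⁻¹.transpose) = 1 := by
    rw [gram_comp df dψ, ← hJ, ← hG]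
    have : J.transpose * G * J * (J⁻¹ * G⁻¹ * J⁻¹.transpose) =
        J.transpose * (G * (J * J⁻¹) * G⁻¹) * J⁻¹.transpose := by
      simp only [Matrix.mul_assoc]
    rw [this, Matrix.mul_nonsing_inv _ hJu, Matrix.mul_one, Matrix.mul_nonsing_inv _ hGu,
      Matrix.mul_one, ← Matrix.transpose_mul, Matrix.nonsing_inv_mul _ hJu, Matrix.transpose_one]
  have hCg : ∀ i j k, ∑ l, C l i j * gram (f ∘ ψ) y l k =
      inner ℝ (pd i (pd j (f ∘ ψ)) y) (pd k (f ∘ ψ) y) := by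
    intro i j k
    have h1 : ∑ l, C l i j * gram (f ∘ ψ) y l k =
        inner ℝ (∑ l, C l i j • pd l (f ∘ ψ) y) (pd k (f ∘ ψ) y) := by
      simp only [sum_inner, real_inner_smul_left, gram_apply]
    rw [h1, sum_smul_pd_comp df dψ (hJC i j), pd_pd_comp hf.isOpen hU' hf.contDiffOn hψ hm hy, pd_comp k df dψ,
      inner_sum, inner_sum]
    refine Finset.sum_congr rfl fun d _ => ?_
    rw [real_inner_smul_right, real_inner_smul_right]
    congr 1
    simp only [hS, add_smul, Finset.sum_add_distrib, inner_add_left]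
    congr 1
    simp only [sum_inner, real_inner_smul_left, ← hf.sum_gamma_mul_gram (hm hy), Finset.sum_mul,
      Finset.mul_sum]
    rw [Finset.sum_comm]
    refine Finset.sum_congr rfl fun a _ => ?_
    rw [Finset.sum_comm]
    refine Finset.sum_congr rfl fun b _ => Finset.sum_congr rfl fun c _ => ?_
    rw [gram_apply, hJ]
    simp only [jacobian, Matrix.of_apply]
    ring
  rw [lap_eq_of hH hCg]
  -- The second derivatives of `ψ` cancel: the covariant Hessian transforms as a tensor.
  have hT : ∀ i j, pd i (pd j (φ ∘ ψ)) y - ∑ k, C k i j • pd k (φ ∘ ψ) y =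
      ∑ a, ∑ b, (J a i * J b j) •
        (pd a (pd b φ) (ψ y) - ∑ k, gamma f k a b (ψ y) • pd k φ (ψ y)) := by
    intro i j
    rw [sum_smul_pd_comp dφ dψ (hJC i j), pd_pd_comp hf.isOpen hU' hφ hψ hm hy]
    simp only [hS, add_smul, Finset.sum_add_distrib, smul_sub, Finset.sum_sub_distrib]
    rw [add_sub_add_right_eq_sub]
    congr 1
    simp only [Finset.sum_smul, Finset.smul_sum]
    rw [Finset.sum_comm]
    refine Finset.sum_congr rfl fun a _ => ?_
    rw [Finset.sum_comm]
    refine Finset.sum_congr rfl fun b _ => Finset.sum_congr rfl fun c _ => ?_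
    rw [smul_smul]
  have hJH : J * (J⁻¹ * G⁻¹ * J⁻¹.transpose) * J.transpose = G⁻¹ := by
    have : J * (J⁻¹ * G⁻¹ * J⁻¹.transpose) * J.transpose =
        (J * J⁻¹) * G⁻¹ * (J⁻¹.transpose * J.transpose) := by simp only [Matrix.mul_assoc]
    rw [this, ← Matrix.transpose_mul, Matrix.mul_nonsing_inv _ hJu, Matrix.transpose_one,
      Matrix.one_mul, Matrix.mul_one]
  set H := J⁻¹ * G⁻¹ * J⁻¹.transpose
  simp only [hT, lap, ← hG, ← hJH, Matrix.mul_apply, Matrix.transpose_apply, Finset.sum_smul,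
    Finset.sum_mul]
  set T : Fin m → Fin m → W := fun a b =>
    pd a (pd b φ) (ψ y) - ∑ k, gamma f k a b (ψ y) • pd k φ (ψ y) with hT'
  simp only [Finset.smul_sum, smul_smul]
  calc ∑ i, ∑ j, ∑ a, ∑ b, (H i j * (J a i * J b j)) • T a b
      = ∑ i, ∑ a, ∑ j, ∑ b, (H i j * (J a i * J b j)) • T a b :=
        Finset.sum_congr rfl fun i _ => Finset.sum_comm
    _ = ∑ a, ∑ i, ∑ j, ∑ b, (H i j * (J a i * J b j)) • T a b := Finset.sum_comm
    _ = ∑ a, ∑ i, ∑ b, ∑ j, (H i j * (J a i * J b j)) • T a b :=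
        Finset.sum_congr rfl fun a _ => Finset.sum_congr rfl fun i _ => Finset.sum_comm
    _ = ∑ a, ∑ b, ∑ i, ∑ j, (H i j * (J a i * J b j)) • T a b :=
        Finset.sum_congr rfl fun a _ => Finset.sum_comm
    _ = ∑ a, ∑ b, ∑ j, ∑ i, (J a i * H i j * J b j) • T a b :=
        Finset.sum_congr rfl fun a _ => Finset.sum_congr rfl fun b _ => by
          rw [Finset.sum_comm]
          refine Finset.sum_congr rfl fun j _ => Finset.sum_congr rfl fun i _ => ?_
          congr 1; ring

/-- The square root of the determinant of the metric. -/
noncomputable def vol (f : E m → V) (y : E m) : ℝ := Real.sqrt (gram f y).det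

theorem ImmersionOn.vol_pos (hf : ImmersionOn f U) {y : E m} (hy : y ∈ U) : 0 < vol f y :=
  Real.sqrt_pos.2 (hf.det_pos hy)

theorem ImmersionOn.contDiffOn_vol (hf : ImmersionOn f U) : ContDiffOn ℝ ∞ (vol f) U :=
  (contDiffOn_det hf.contDiffOn_gram).sqrt fun _ hz => (hf.det_pos hz).ne'

theorem vol_comp {y : E m} (hf : DifferentiableAt ℝ f (ψ y)) (hψ : DifferentiableAt ℝ ψ y) :
    vol (f ∘ ψ) y = |(fderiv ℝ ψ y).det| * vol f (ψ y) := by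
  rw [vol, gram_comp hf hψ, Matrix.det_mul, Matrix.det_mul, Matrix.det_transpose, det_jacobian,
    show (fderiv ℝ ψ y).det * (gram f (ψ y)).det * (fderiv ℝ ψ y).det =
      (fderiv ℝ ψ y).det ^ 2 * (gram f (ψ y)).det by ring, Real.sqrt_mul (sq_nonneg _),
    Real.sqrt_sq_eq_abs, vol]

/-- Jacobi's formula under the square root. The two halves of `∂ₚ gᵢⱼ` contribute equally to the
trace, which cancels the `2` coming from the root. -/
theorem ImmersionOn.pd_vol (hf : ImmersionOn f U) {y : E m} (hy : y ∈ U) (p : Fin m) :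
    pd p (vol f) y = vol f y * ∑ i, ∑ j, (gram f y)⁻¹ i j * inner ℝ (pd p (pd i f) y) (pd j f y) := by
  have h0 := hf.det_pos hy
  have dg : ∀ i j, DifferentiableAt ℝ (fun z => gram f z i j) y := fun i j =>
    differentiableAt_of_contDiffOn hf.isOpen (hf.contDiffOn_gram i j) hy
  have dd : DifferentiableAt ℝ (fun z => (gram f z).det) y :=
    differentiableAt_of_contDiffOn hf.isOpen (contDiffOn_det hf.contDiffOn_gram) hy
  have h1 : pd p (vol f) y = (2 * vol f y)⁻¹ * pd p (fun z => (gram f z).det) y := by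
    have := (dd.hasFDerivAt.sqrt h0.ne').fderiv
    simp only [pd]
    rw [show vol f = fun z => Real.sqrt (gram f z).det from rfl, this]
    simp
  have h2 : ∑ i, ∑ j, (gram f y)⁻¹ i j * pd p (fun z => gram f z j i) y =
      2 * ∑ i, ∑ j, (gram f y)⁻¹ i j * inner ℝ (pd p (pd i f) y) (pd j f y) := by
    have h3 : ∑ i, ∑ j, (gram f y)⁻¹ i j * inner ℝ (pd p (pd j f) y) (pd i f y) =
        ∑ i, ∑ j, (gram f y)⁻¹ i j * inner ℝ (pd p (pd i f) y) (pd j f y) := by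
      rw [Finset.sum_comm]
      refine Finset.sum_congr rfl fun i _ => Finset.sum_congr rfl fun j _ => ?_
      rw [gram_inv_symm]
    rw [two_mul]
    nth_rewrite 1 [← h3]
    simp only [← Finset.sum_add_distrib, hf.pd_gram hy, mul_add]
  have h3 : (gram f y).det = vol f y ^ 2 := (Real.sq_sqrt h0.le).symm
  rw [h1, pd_det dg h0.ne', h2, h3]
  have := (hf.vol_pos hy).ne'
  field_simp

/-- The Laplacian in divergence form. -/
theorem ImmersionOn.vol_mul_lap (hf : ImmersionOn f U) {y : E m} (hy : y ∈ U) {φ : E m → ℝ}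
    (hφ : ContDiffOn ℝ ∞ φ U) :
    vol f y * lap f φ y =
      ∑ i, pd i (fun z => ∑ j, vol f z * (gram f z)⁻¹ i j * pd j φ z) y := by
  set B := (gram f y)⁻¹ with hB
  have hBs : ∀ i j, B i j = B j i := gram_inv_symm f y
  set F : Fin m → Fin m → Fin m → ℝ := fun i a b => inner ℝ (pd i (pd a f) y) (pd b f y) with hF
  have hFs : ∀ i a b, F i a b = F a i b := fun i a b => by simp only [hF, hf.pd_pd_comm hy i a]
  have dv := differentiableAt_of_contDiffOn hf.isOpen hf.contDiffOn_vol hy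
  have dB := fun i j => differentiableAt_of_contDiffOn hf.isOpen (hf.contDiffOn_gram_inv i j) hy
  have dφ := fun j => differentiableAt_of_contDiffOn hf.isOpen
    (Submanifold.contDiffOn_pd hf.isOpen hφ j) hy
  have hpB : ∀ i j, pd i (fun z => (gram f z)⁻¹ i j) y =
      -∑ a, ∑ b, B i a * (F i a b + F i b a) * B b j := by
    intro i j
    rw [pd_inv_apply hf.isOpen hf.contDiffOn_gram (fun z hz => (hf.det_pos hz).ne') hy]
    simp only [hf.pd_gram hy, hF, hB]
  have h1 : ∀ i j, pd i (fun z => vol f z * (gram f z)⁻¹ i j * pd j φ z) y =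
      vol f y * (B i j * pd i (pd j φ) y + ((∑ a, ∑ b, B a b * F i a b) * B i j
        - ∑ a, ∑ b, B i a * (F i a b + F i b a) * B b j) * pd j φ y) := by
    intro i j
    rw [pd_mul (c := fun z => vol f z * (gram f z)⁻¹ i j) i (dv.mul (dB i j)) (dφ j),
      pd_mul i dv (dB i j), hpB, hf.pd_vol hy]
    ring
  have h2 : ∀ i, pd i (fun z => ∑ j, vol f z * (gram f z)⁻¹ i j * pd j φ z) y =
      ∑ j, vol f y * (B i j * pd i (pd j φ) y + ((∑ a, ∑ b, B a b * F i a b) * B i j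
        - ∑ a, ∑ b, B i a * (F i a b + F i b a) * B b j) * pd j φ y) := by
    intro i
    rw [pd_sum (φ := fun j z => vol f z * (gram f z)⁻¹ i j * pd j φ z) _ _
      fun j _ => (dv.mul (dB i j)).mul (dφ j)]
    exact Finset.sum_congr rfl fun j _ => h1 i j
  -- The contracted identity for `∂ᵢ(√g gⁱʲ)`, divided by `√g`: of the two terms of `∂ᵢ gⁱʲ`, one
  -- cancels the derivative of `√g` and the other is the traced Christoffel symbol.
  have key : ∀ j, ∑ i, ((∑ a, ∑ b, B a b * F i a b) * B i j
      - ∑ a, ∑ b, B i a * (F i a b + F i b a) * B b j) = -∑ a, ∑ b, B a b * gamma f j a b y := by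
    intro j
    have e1 : ∑ i, (∑ a, ∑ b, B a b * F i a b) * B i j =
        ∑ i, ∑ a, ∑ b, B i a * F i b a * B b j := by
      simp only [Finset.sum_mul]
      rw [Finset.sum_comm]
      refine Finset.sum_congr rfl fun a _ => ?_
      rw [Finset.sum_comm]
      refine Finset.sum_congr rfl fun b _ => Finset.sum_congr rfl fun i _ => ?_
      rw [hFs]
    have e2 : ∑ a, ∑ b, B a b * gamma f j a b y = ∑ i, ∑ a, ∑ b, B i a * F i a b * B b j := by
      simp only [gamma, Finset.mul_sum, ← hB]
      refine Finset.sum_congr rfl fun a _ => Finset.sum_congr rfl fun b _ =>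
        Finset.sum_congr rfl fun c _ => ?_
      rw [hBs j c]; simp only [hF]; ring
    rw [Finset.sum_sub_distrib, e1, e2]
    simp only [mul_add, add_mul, Finset.sum_add_distrib]
    ring
  simp only [h2, ← Finset.mul_sum]
  congr 1
  simp only [Finset.sum_add_distrib]
  rw [Finset.sum_comm (f := fun i j => ((∑ a, ∑ b, B a b * F i a b) * B i j
        - ∑ a, ∑ b, B i a * (F i a b + F i b a) * B b j) * pd j φ y)]
  simp only [← Finset.sum_mul, key]
  simp only [lap, ← hB, smul_eq_mul, mul_sub, Finset.sum_sub_distrib, neg_mul,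
    Finset.sum_neg_distrib, ← sub_eq_add_neg]
  congr 1
  simp only [Finset.mul_sum, Finset.sum_mul]
  rw [Finset.sum_comm_cycle]
  refine Finset.sum_congr rfl fun k _ => Finset.sum_congr rfl fun i _ =>
    Finset.sum_congr rfl fun j _ => by ring

end Invariance

end Submanifold

namespace Submanifold

open Topology

/-! ### The tension field and the mean curvature in coordinates -/

section Transition

variable {m : ℕ} {X : Type*} [TopologicalSpace X]

theorem mapsTo_transition (e e' : OpenPartialHomeomorph X (E m)) :
    Set.MapsTo (e' ∘ e.symm) (e.symm ≫ₕ e').source (e'.symm ≫ₕ e).source := by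
  intro z hz
  rw [OpenPartialHomeomorph.trans_source] at hz ⊢
  refine ⟨e'.map_source hz.2, ?_⟩
  change e'.symm (e' (e.symm z)) ∈ e.source
  rw [e'.left_inv hz.2]
  exact e.map_target hz.1

theorem transition_transition (e e' : OpenPartialHomeomorph X (E m)) {z : E m}
    (hz : z ∈ (e.symm ≫ₕ e').source) : (e ∘ e'.symm) ((e' ∘ e.symm) z) = z := by
  rw [OpenPartialHomeomorph.trans_source] at hz
  change e (e'.symm (e' (e.symm z))) = z
  rw [e'.left_inv hz.2, e.right_inv hz.1]

/-- The coordinate expressions of a map in two charts. -/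
theorem comp_symm_eventuallyEq {W : Type*} (F : X → W) {e e' : OpenPartialHomeomorph X (E m)} {z : E m}
    (hz : z ∈ (e.symm ≫ₕ e').source) : F ∘ e.symm =ᶠ[𝓝 z] (F ∘ e'.symm) ∘ (e' ∘ e.symm) := by
  refine eventuallyEq_of_isOpen (e.symm ≫ₕ e').open_source (fun w hw => ?_) hz
  rw [OpenPartialHomeomorph.trans_source] at hw
  exact congrArg F (e'.left_inv hw.2).symm

end Transition

section Tension

variable {m : ℕ} {X : Type*} [TopologicalSpace X] [ChartedSpace (E m) X]
  {V : Type*} [NormedAddCommGroup V] [InnerProductSpace ℝ V]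
  [IsManifold 𝓘(ℝ, E m) ∞ X]

theorem contDiffOn_comp_symm {W : Type*} [NormedAddCommGroup W] [NormedSpace ℝ W] {F : X → W}
    (hF : ContMDiff 𝓘(ℝ, E m) 𝓘(ℝ, W) ∞ F) {e : OpenPartialHomeomorph X (E m)}
    (he : e ∈ atlas (E m) X) : ContDiffOn ℝ ∞ (F ∘ e.symm) e.target := by
  rw [← contMDiffOn_iff_contDiffOn]
  exact hF.comp_contMDiffOn (contMDiffOn_symm_of_mem_maximalAtlas
    (IsManifold.subset_maximalAtlas he))

theorem contDiffOn_transition {e e' : OpenPartialHomeomorph X (E m)} (he : e ∈ atlas (E m) X)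
    (he' : e' ∈ atlas (E m) X) : ContDiffOn ℝ ∞ (e' ∘ e.symm) (e.symm ≫ₕ e').source := by
  have h := (mem_groupoid_of_pregroupoid.1
    (StructureGroupoid.compatible (contDiffGroupoid ∞ 𝓘(ℝ, E m)) he he')).1
  simpa [contDiffPregroupoid] using h

/-- By the chain rule the inverse transition map supplies a left inverse of the differential. -/
theorem injective_fderiv_transition {e e' : OpenPartialHomeomorph X (E m)}
    (he : e ∈ atlas (E m) X) (he' : e' ∈ atlas (E m) X) {z : E m}
    (hz : z ∈ (e.symm ≫ₕ e').source) : Function.Injective (fderiv ℝ (e' ∘ e.symm) z) := by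
  have h1 := differentiableAt_of_contDiffOn (e.symm ≫ₕ e').open_source
    (contDiffOn_transition he he') hz
  have h2 := differentiableAt_of_contDiffOn (e'.symm ≫ₕ e).open_source
    (contDiffOn_transition he' he) (mapsTo_transition e e' hz)
  have h3 : (e ∘ e'.symm) ∘ (e' ∘ e.symm) =ᶠ[𝓝 z] id :=
    eventuallyEq_of_isOpen (e.symm ≫ₕ e').open_source
      (fun w hw => transition_transition e e' hw) hz
  have h4 := h3.fderiv_eq (𝕜 := ℝ)
  rw [fderiv_comp z h2 h1, fderiv_id] at h4
  exact Function.LeftInverse.injective (g := fderiv ℝ (e ∘ e'.symm) ((e' ∘ e.symm) z))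
    fun v => congrArg (fun L : E m →L[ℝ] E m => L v) h4

variable (f : Immersion m X V) {e e' : OpenPartialHomeomorph X (E m)}

theorem Immersion.immersionOn (he : e ∈ atlas (E m) X) : ImmersionOn (f ∘ e.symm) e.target :=
  ⟨e.open_target, f.contDiffOn he, fun _ hy => f.injective_fderiv he hy⟩

theorem Immersion.lap_transition {W : Type*} [NormedAddCommGroup W] [NormedSpace ℝ W] {F : X → W}
    (he : e ∈ atlas (E m) X) (he' : e' ∈ atlas (E m) X)
    (hF : ContDiffOn ℝ ∞ (F ∘ e'.symm) e'.target) {p : X} (hp : p ∈ e.source)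
    (hp' : p ∈ e'.source) :
    lap (f ∘ e.symm) (F ∘ e.symm) (e p) = lap (f ∘ e'.symm) (F ∘ e'.symm) (e' p) := by
  have hz : e p ∈ (e.symm ≫ₕ e').source := by
    rw [OpenPartialHomeomorph.trans_source]
    refine ⟨e.map_source hp, ?_⟩
    rw [Set.mem_preimage, e.left_inv hp]
    exact hp'
  have hm : Set.MapsTo (e' ∘ e.symm) (e.symm ≫ₕ e').source e'.target := fun w hw =>
    (mapsTo_transition e e' hw).1
  rw [lap_congr (comp_symm_eventuallyEq F hz), lap_congr_left (comp_symm_eventuallyEq f hz),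
    (f.immersionOn he').lap_comp (e.symm ≫ₕ e').open_source (contDiffOn_transition he he')
      hm hz (injective_fderiv_transition he he' hz) hF]
  congr 1
  change e' (e.symm (e p)) = e' p
  rw [e.left_inv hp]

theorem tension_eq_lap_chartAt (F : X → V) (p : X) :
    tension f F p = lap (f ∘ (chartAt (E m) p).symm) (F ∘ (chartAt (E m) p).symm)
      (chartAt (E m) p p) := by
  have he := chart_mem_atlas (E m) p
  have hy := (chartAt (E m) p).map_source (mem_chart_source (E m) p)
  have h : ∀ k i j, christoffel f (chartAt (E m) p) k i j (chartAt (E m) p p) =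
      gamma (f ∘ (chartAt (E m) p).symm) k i j (chartAt (E m) p p) := fun k i j =>
    (f.immersionOn he).gamma_eq hy k i j
  simp only [tension, h]
  rfl

/-- `tension` uses the preferred chart at each point, which may change abruptly from point to point.
Coordinate invariance replaces it by one chart on its whole domain, as smoothness and integration
require. -/
theorem tension_eq_lap {F : X → V} (he : e ∈ atlas (E m) X)
    (hF : ContDiffOn ℝ ∞ (F ∘ e.symm) e.target) {p : X} (hp : p ∈ e.source) :
    tension f F p = lap (f ∘ e.symm) (F ∘ e.symm) (e p) := by
  rw [tension_eq_lap_chartAt]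
  exact f.lap_transition (chart_mem_atlas (E m) p) he hF (mem_chart_source (E m) p) hp

/-- The tangential part is `∑ Γᵏᵢⱼ ∂ₖg`: it lies in the range of the differential, and the
difference is orthogonal to every `∂ₖg`. Hence `lap g g` is the trace of the second fundamental
form. -/
theorem ImmersionOn.starProjection_pd_pd {g : E m → V} {U : Set (E m)} (hg : ImmersionOn g U)
    {y : E m} (hy : y ∈ U) (i j : Fin m) :
    (fderiv ℝ g y).rangeᗮ.starProjection (pd i (pd j g) y) =
      pd i (pd j g) y - ∑ k, gamma g k i j y • pd k g y := by
  refine Submodule.eq_starProjection_of_mem_of_inner_eq_zero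
    (K := (fderiv ℝ g y).rangeᗮ) ?_ ?_
  · rw [Submodule.mem_orthogonal']
    rintro _ ⟨v, rfl⟩
    have h : ∀ k, inner ℝ (pd i (pd j g) y - ∑ k, gamma g k i j y • pd k g y) (pd k g y) = 0 := by
      intro k
      simp only [inner_sub_left, sum_inner, real_inner_smul_left, ← hg.sum_gamma_mul_gram hy,
        gram_apply, sub_self]
    change inner ℝ _ (fderiv ℝ g y v) = 0
    rw [fderiv_eq_sum_pd, inner_sum]
    exact Finset.sum_eq_zero fun k _ => by rw [real_inner_smul_right, h, mul_zero]
  · intro w hw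
    rw [sub_sub_cancel]
    refine (Submodule.mem_orthogonal _ _).1 hw _ ?_
    exact Submodule.sum_mem _ fun k _ => Submodule.smul_mem _ _ ⟨_, rfl⟩

theorem isMinimal_iff_tension (hm : m ≠ 0) : IsMinimal f ↔ ∀ p, tension f f p = 0 := by
  refine forall_congr' fun p => ?_
  have he := chart_mem_atlas (E m) p
  have hy := (chartAt (E m) p).map_source (mem_chart_source (E m) p)
  have h : meanCurvature f p = (1 / (m : ℝ)) • tension f f p := by
    rw [tension_eq_lap_chartAt]
    simp only [meanCurvature, secondFundamentalForm,
      (f.immersionOn he).starProjection_pd_pd hy]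
    rfl
  rw [h, smul_eq_zero, or_iff_right (by positivity)]

end Tension

end Submanifold

namespace Submanifold

open Topology MeasureTheory

/-! ### The Riemannian measure in coordinates -/

section SymmMeasurable

variable {m : ℕ} {X : Type*} [TopologicalSpace X] [MeasurableSpace X] [BorelSpace X]

theorem aemeasurable_symm (e : OpenPartialHomeomorph X (E m)) :
    AEMeasurable e.symm (volume.restrict e.target) :=
  e.continuousOn_symm.aemeasurable e.open_target.measurableSet

theorem measurableSet_preimage_symm (e : OpenPartialHomeomorph X (E m)) {A : Set X}
    (hA : MeasurableSet A) : MeasurableSet (e.symm ⁻¹' A ∩ e.target) := by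
  have h1 : Measurable (e.target.domRestrict e.symm) :=
    (continuousOn_iff_continuous_domRestrict.1 e.continuousOn_symm).measurable
  have h2 := e.open_target.measurableSet.subtype_image (h1 hA)
  convert h2 using 1
  ext y
  simp [Set.domRestrict_apply, and_comm]

end SymmMeasurable

section Volume

variable {m : ℕ} {X : Type*} [TopologicalSpace X] [ChartedSpace (E m) X]
  {V : Type*} [NormedAddCommGroup V] [InnerProductSpace ℝ V] [MeasurableSpace X]

/-- The measure `√(det g) dy¹ ⋯ dyᵐ` on the domain of the chart `e`. -/
noncomputable def coordMeasure (f : Immersion m X V) (e : OpenPartialHomeomorph X (E m)) :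
    Measure X :=
  Measure.map e.symm ((volume.restrict e.target).withDensity
    fun y => ENNReal.ofReal (vol (f ∘ e.symm) y))

theorem coordMeasure_le_volumeMeasure (f : Immersion m X V) {e : OpenPartialHomeomorph X (E m)}
    (he : e ∈ atlas (E m) X) : coordMeasure f e ≤ volumeMeasure f :=
  le_iSup₂_of_le e he le_rfl

section Symm

variable [BorelSpace X]

theorem coordMeasure_apply (f : Immersion m X V) (e : OpenPartialHomeomorph X (E m)) {A : Set X}
    (hA : MeasurableSet A) : coordMeasure f e A =
      ∫⁻ y in e.symm ⁻¹' A ∩ e.target, ENNReal.ofReal (vol (f ∘ e.symm) y) := by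
  rw [coordMeasure, Measure.map_apply_of_aemeasurable
    ((aemeasurable_symm e).mono_ac (withDensity_absolutelyContinuous _ _)) hA,
    withDensity_apply', Measure.restrict_restrict' e.open_target.measurableSet]

end Symm

variable [IsManifold 𝓘(ℝ, E m) ∞ X] [BorelSpace X] (f : Immersion m X V)
  {e e' : OpenPartialHomeomorph X (E m)}

/-- Change of variables: the Jacobian of the transition map is the ratio of the two densities.
Equality may fail because `A` may leave the domain of `e`; the inequality suffices since
`volumeMeasure` is a supremum. -/
theorem coordMeasure_le_of_subset (he : e ∈ atlas (E m) X) (he' : e' ∈ atlas (E m) X) {A : Set X}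
    (hA : MeasurableSet A) (hAe : A ⊆ e'.source) : coordMeasure f e A ≤ coordMeasure f e' A := by
  rw [coordMeasure_apply f e hA, coordMeasure_apply f e' hA]
  set S := e.symm ⁻¹' A ∩ e.target with hS
  have hSs : S ⊆ (e.symm ≫ₕ e').source := fun y hy => by
    rw [OpenPartialHomeomorph.trans_source]
    exact ⟨hy.2, hAe hy.1⟩
  have hψ := fun y (hy : y ∈ S) => differentiableAt_of_contDiffOn (e.symm ≫ₕ e').open_source
    (contDiffOn_transition he he') (hSs hy)
  have hinj : Set.InjOn (e' ∘ e.symm) S := fun y hy z hz hyz => by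
    rw [← transition_transition e e' (hSs hy), hyz, transition_transition e e' (hSs hz)]
  have hsub : (e' ∘ e.symm) '' S ⊆ e'.symm ⁻¹' A ∩ e'.target := by
    rintro _ ⟨y, hy, rfl⟩
    refine ⟨?_, (mapsTo_transition e e' (hSs hy)).1⟩
    rw [Set.mem_preimage, Function.comp_apply, e'.left_inv (hAe hy.1)]
    exact hy.1
  have h1 : ∫⁻ y in S, ENNReal.ofReal (vol (f ∘ e.symm) y) =
      ∫⁻ y in S, ENNReal.ofReal |(fderiv ℝ (e' ∘ e.symm) y).det| *
        ENNReal.ofReal (vol (f ∘ e'.symm) ((e' ∘ e.symm) y)) := by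
    refine setLIntegral_congr_fun (measurableSet_preimage_symm e hA) fun y hy => ?_
    have h2 : vol (f ∘ e.symm) y = vol ((f ∘ e'.symm) ∘ (e' ∘ e.symm)) y := by
      have h3 : gram (f ∘ e.symm) y = gram ((f ∘ e'.symm) ∘ (e' ∘ e.symm)) y := by
        ext i j
        rw [gram_apply, gram_apply, pd_congr_at i (comp_symm_eventuallyEq f (hSs hy)),
          pd_congr_at j (comp_symm_eventuallyEq f (hSs hy))]
      rw [vol, h3, vol]
    rw [← ENNReal.ofReal_mul (abs_nonneg _), h2, vol_comp
      (differentiableAt_of_contDiffOn e'.open_target (f.contDiffOn he')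
        (mapsTo_transition e e' (hSs hy)).1) (hψ y hy)]
  rw [h1, ← lintegral_image_eq_lintegral_abs_det_fderiv_mul volume
    (measurableSet_preimage_symm e hA)
    (fun y hy => (hψ y hy).hasFDerivAt.hasFDerivWithinAt) hinj
    (fun y => ENNReal.ofReal (vol (f ∘ e'.symm) y))]
  exact lintegral_mono_set hsub

theorem volumeMeasure_apply (he : e ∈ atlas (E m) X) {A : Set X} (hA : MeasurableSet A)
    (hAe : A ⊆ e.source) : volumeMeasure f A = coordMeasure f e A := by
  refine le_antisymm ?_ (coordMeasure_le_volumeMeasure f he A)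
  -- A single measure dominating every `coordMeasure`: on the domain of `e` by the change of
  -- variables, elsewhere by `volumeMeasure` itself. The second summand does not charge `A`.
  have h : volumeMeasure f ≤ coordMeasure f e + (volumeMeasure f).restrict e.sourceᶜ := by
    refine iSup₂_le fun e' he' => Measure.le_iff.2 fun B hB => ?_
    change coordMeasure f e' B ≤ _
    rw [← measure_inter_add_sdiff B e.open_source.measurableSet, Measure.add_apply,
      Measure.restrict_apply hB, ← Set.sdiff_eq]
    refine add_le_add ?_ ?_
    · exact (coordMeasure_le_of_subset f he' he (hB.inter e.open_source.measurableSet)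
        Set.inter_subset_right).trans (measure_mono Set.inter_subset_left)
    · exact coordMeasure_le_volumeMeasure f he' _
  refine (h A).trans ?_
  rw [Measure.add_apply, Measure.restrict_apply hA, ← Set.sdiff_eq, Set.sdiff_eq_empty.2 hAe,
    measure_empty, add_zero]

theorem volumeMeasure_restrict (he : e ∈ atlas (E m) X) :
    (volumeMeasure f).restrict e.source = coordMeasure f e := by
  ext A hA
  rw [Measure.restrict_apply hA, volumeMeasure_apply f he (hA.inter e.open_source.measurableSet)
    Set.inter_subset_right, coordMeasure_apply f e hA,
    coordMeasure_apply f e (hA.inter e.open_source.measurableSet)]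
  congr 2
  ext y
  simp only [Set.mem_inter_iff, Set.mem_preimage]
  exact ⟨fun h => ⟨h.1.1, h.2⟩, fun h => ⟨⟨h.1, e.map_target h.2⟩, h.2⟩⟩

theorem setIntegral_volumeMeasure (he : e ∈ atlas (E m) X) {A : Set X} (hA : MeasurableSet A)
    (hAe : A ⊆ e.source) {h : X → ℝ} (hh : ContinuousOn h e.source) :
    ∫ p in A, h p ∂(volumeMeasure f) =
      ∫ y in e.symm ⁻¹' A ∩ e.target, vol (f ∘ e.symm) y * h (e.symm y) := by
  have hac := withDensity_absolutelyContinuous (volume.restrict e.target)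
    fun y => ENNReal.ofReal (vol (f ∘ e.symm) y)
  have h1 : AEStronglyMeasurable h (coordMeasure f e) := by
    rw [← volumeMeasure_restrict f he]
    exact hh.aestronglyMeasurable e.open_source.measurableSet
  have h2 : (volumeMeasure f).restrict A = (coordMeasure f e).restrict A := by
    rw [← volumeMeasure_restrict f he, Measure.restrict_restrict hA,
      Set.inter_eq_left.2 hAe]
  have h3 : AEMeasurable (fun y => ENNReal.ofReal (vol (f ∘ e.symm) y))
      (volume.restrict e.target) :=
    ((f.immersionOn he).contDiffOn_vol.continuousOn.aemeasurable
      e.open_target.measurableSet).ennreal_ofReal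
  rw [h2, coordMeasure, setIntegral_map hA h1 ((aemeasurable_symm e).mono_ac hac),
    restrict_withDensity', integral_withDensity_eq_integral_toReal_smul₀,
    Measure.restrict_restrict' e.open_target.measurableSet]
  · refine setIntegral_congr_fun (measurableSet_preimage_symm e hA) fun y hy => ?_
    simp only [smul_eq_mul]
    rw [ENNReal.toReal_ofReal ((f.immersionOn he).vol_pos hy.2).le]
  · exact h3.restrict
  · exact Filter.Eventually.of_forall fun y => ENNReal.ofReal_lt_top

/-- The density is continuous on a compact ball inside the chart target. Local finiteness makes the
volume of a compact `Ω` finite, which bounds the bienergy below. -/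
instance isLocallyFiniteMeasure_volumeMeasure : IsLocallyFiniteMeasure (volumeMeasure f) := by
  refine ⟨fun p => ?_⟩
  set e := chartAt (E m) p
  have he : e ∈ atlas (E m) X := chart_mem_atlas (E m) p
  have hp : p ∈ e.source := mem_chart_source (E m) p
  obtain ⟨r, hr, hball⟩ := Metric.nhds_basis_closedBall.mem_iff.1
    (e.open_target.mem_nhds (e.map_source hp))
  have ho : IsOpen (e.source ∩ e ⁻¹' Metric.ball (e p) r) :=
    e.isOpen_inter_preimage Metric.isOpen_ball
  refine ⟨_, ho.mem_nhds ⟨hp, Metric.mem_ball_self hr⟩, ?_⟩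
  rw [volumeMeasure_apply f he ho.measurableSet Set.inter_subset_left,
    coordMeasure_apply f e ho.measurableSet]
  have h1 : IntegrableOn (vol (f ∘ e.symm)) (Metric.closedBall (e p) r) volume :=
    ((f.immersionOn he).contDiffOn_vol.continuousOn.mono hball).integrableOn_compact
      (isCompact_closedBall _ _)
  refine lt_of_le_of_lt (lintegral_mono_set ?_) h1.setLIntegral_lt_top
  rintro y ⟨hy, hyt⟩
  have := hy.2
  rw [Set.mem_preimage, e.right_inv hyt] at this
  exact Metric.ball_subset_closedBall this

end Volume

end Submanifold

namespace Submanifold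

open Topology MeasureTheory

/-! ### Immersions with vanishing tension field are biharmonic -/

section Parametric

variable {m : ℕ} {V : Type*} [NormedAddCommGroup V] [InnerProductSpace ℝ V]
  {W : Type*} [NormedAddCommGroup W] [NormedSpace ℝ W] {U : Set (E m)}

theorem pd_slice (i : Fin m) {G : ℝ × E m → W} {q : ℝ × E m} (hG : DifferentiableAt ℝ G q) :
    pd i (fun y => G (q.1, y)) q.2 = fderiv ℝ G q (0, EuclideanSpace.single i 1) := by
  have h1 : HasFDerivAt (fun y : E m => (q.1, y)) (ContinuousLinearMap.inr ℝ ℝ (E m)) q.2 :=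
    (hasFDerivAt_const q.1 q.2).prodMk (hasFDerivAt_id q.2)
  have h2 : HasFDerivAt G (fderiv ℝ G q) (q.1, q.2) := hG.hasFDerivAt
  rw [pd, show (fun y => G (q.1, y)) = G ∘ fun y => (q.1, y) from rfl, (h2.comp q.2 h1).fderiv]
  rfl

theorem contDiffOn_pd_slice (hU : IsOpen U) {G : ℝ × E m → W}
    (hG : ContDiffOn ℝ ∞ G (Set.univ ×ˢ U)) (i : Fin m) :
    ContDiffOn ℝ ∞ (fun q : ℝ × E m => pd i (fun y => G (q.1, y)) q.2) (Set.univ ×ˢ U) := by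
  have ho : IsOpen (Set.univ ×ˢ U : Set (ℝ × E m)) := isOpen_univ.prod hU
  refine ((hG.fderiv_of_isOpen ho (by simp)).clm_apply
    (contDiffOn_const (c := ((0 : ℝ), EuclideanSpace.single i (1 : ℝ))))).congr fun q hq => ?_
  exact pd_slice i ((hG.contDiffAt (ho.mem_nhds hq)).differentiableAt (by simp))

/-- Joint smoothness in the variation parameter and the point. The coefficients of the Laplacian do
not involve the parameter, as the metric stays that of `f`. -/
theorem ImmersionOn.contDiffOn_lap_slice {f : E m → V} (hf : ImmersionOn f U) {G : ℝ × E m → W}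
    (hG : ContDiffOn ℝ ∞ G (Set.univ ×ˢ U)) :
    ContDiffOn ℝ ∞ (fun q : ℝ × E m => lap f (fun y => G (q.1, y)) q.2) (Set.univ ×ˢ U) := by
  have h2 : ∀ {c : E m → ℝ}, ContDiffOn ℝ ∞ c U →
      ContDiffOn ℝ ∞ (fun q : ℝ × E m => c q.2) (Set.univ ×ˢ U) := fun hc =>
    hc.comp contDiff_snd.contDiffOn fun q hq => hq.2
  exact ContDiffOn.sum fun i _ => ContDiffOn.sum fun j _ => (h2 (hf.contDiffOn_gram_inv i j)).smul
    ((contDiffOn_pd_slice hf.isOpen (contDiffOn_pd_slice hf.isOpen hG j) i).sub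
      (ContDiffOn.sum fun k _ => (h2 (hf.contDiffOn_gamma k i j)).smul
        (contDiffOn_pd_slice hf.isOpen hG k)))

theorem contMDiff_slice {X : Type*} [TopologicalSpace X] [ChartedSpace (E m) X] {F : ℝ → X → V}
    (hF : ContMDiff (𝓘(ℝ, ℝ).prod 𝓘(ℝ, E m)) 𝓘(ℝ, V) ∞ (fun q : ℝ × X => F q.1 q.2)) (s : ℝ) :
    ContMDiff 𝓘(ℝ, E m) 𝓘(ℝ, V) ∞ (F s) :=
  hF.comp (contMDiff_const.prodMk contMDiff_id)

end Parametric

section Minimal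

variable {m : ℕ} {X : Type*} [TopologicalSpace X] [ChartedSpace (E m) X]
  {V : Type*} [NormedAddCommGroup V] [InnerProductSpace ℝ V]
  [IsManifold 𝓘(ℝ, E m) ∞ X] (f : Immersion m X V)

theorem contDiffOn_comp_symm_slice {F : ℝ → X → V}
    (hF : ContMDiff (𝓘(ℝ, ℝ).prod 𝓘(ℝ, E m)) 𝓘(ℝ, V) ∞ (fun q : ℝ × X => F q.1 q.2))
    {e : OpenPartialHomeomorph X (E m)} (he : e ∈ atlas (E m) X) :
    ContDiffOn ℝ ∞ (fun q : ℝ × E m => F q.1 (e.symm q.2)) (Set.univ ×ˢ e.target) := by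
  rw [← contMDiffOn_iff_contDiffOn]
  have h1 : ContMDiffOn 𝓘(ℝ, ℝ × E m) 𝓘(ℝ, ℝ) ∞ (fun q : ℝ × E m => q.1)
      (Set.univ ×ˢ e.target) := contDiff_fst.contMDiff.contMDiffOn
  have h2 : ContMDiffOn 𝓘(ℝ, ℝ × E m) 𝓘(ℝ, E m) ∞ (fun q : ℝ × E m => e.symm q.2)
      (Set.univ ×ˢ e.target) :=
    (contMDiffOn_symm_of_mem_maximalAtlas (IsManifold.subset_maximalAtlas he)).comp
      contDiff_snd.contMDiff.contMDiffOn fun q hq => hq.2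
  exact hF.comp_contMDiffOn (h1.prodMk h2)

/-- In coordinates the tension of `F s` is a smooth function of `(s, y)` that vanishes for `s = 0`;
a local Lipschitz bound makes it `O(s)` uniformly near `p`. -/
theorem eventually_norm_tension_le (h0 : ∀ p, tension f f p = 0) {F : ℝ → X → V}
    (hF : ContMDiff (𝓘(ℝ, ℝ).prod 𝓘(ℝ, E m)) 𝓘(ℝ, V) ∞ (fun q : ℝ × X => F q.1 q.2))
    (hF0 : F 0 = f) {e : OpenPartialHomeomorph X (E m)} (he : e ∈ atlas (E m) X) {p : X}
    (hp : p ∈ e.source) :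
    ∃ C : ℝ, ∀ᶠ q : ℝ × X in 𝓝 (0, p), ‖tension f (F q.1) q.2‖ ≤ C * |q.1| := by
  obtain ⟨L, hL⟩ : ∃ L : ℝ × E m → V, L = fun q =>
      lap (f ∘ e.symm) (fun y => F q.1 (e.symm y)) q.2 :=
    ⟨_, rfl⟩
  have hLs : ContDiffOn ℝ ∞ L (Set.univ ×ˢ e.target) := by
    rw [hL]
    exact (f.immersionOn he).contDiffOn_lap_slice (G := fun q : ℝ × E m => F q.1 (e.symm q.2))
      (contDiffOn_comp_symm_slice hF he)
  have hT : ∀ s, ∀ p' ∈ e.source, tension f (F s) p' = L (s, e p') := fun s p' hp' => by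
    subst hL
    exact tension_eq_lap f he (contDiffOn_comp_symm (contMDiff_slice hF s) he) hp'
  have ho : IsOpen (Set.univ ×ˢ e.target : Set (ℝ × E m)) := isOpen_univ.prod e.open_target
  have hLat : ContDiffAt ℝ 1 L (0, e p) :=
    (hLs.contDiffAt (ho.mem_nhds ⟨Set.mem_univ _, e.map_source hp⟩)).of_le
      (WithTop.coe_le_coe.2 (le_top : (1 : ℕ∞) ≤ ⊤))
  obtain ⟨K, t, ht, hLip⟩ := hLat.exists_lipschitzOnWith
  refine ⟨K, ?_⟩
  have hc : ∀ᶠ q : ℝ × X in 𝓝 (0, p), q.2 ∈ e.source :=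
    continuous_snd.continuousAt.eventually (e.open_source.mem_nhds hp)
  have hce : Filter.Tendsto (fun q : ℝ × X => e q.2) (𝓝 (0, p)) (𝓝 (e p)) :=
    (e.continuousAt hp).tendsto.comp (continuous_snd.tendsto ((0 : ℝ), p))
  have h1 : ∀ᶠ q : ℝ × X in 𝓝 (0, p), (q.1, e q.2) ∈ t :=
    ((continuous_fst.tendsto ((0 : ℝ), p)).prodMk_nhds hce).eventually ht
  have h2 : ∀ᶠ q : ℝ × X in 𝓝 (0, p), ((0 : ℝ), e q.2) ∈ t :=
    (tendsto_const_nhds.prodMk_nhds hce).eventually ht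
  filter_upwards [hc, h1, h2] with q hq hq1 hq2
  have h3 : L (0, e q.2) = 0 := by rw [← hT 0 _ hq, hF0, h0]
  have h4 := hLip.dist_le_mul _ hq1 _ hq2
  rw [h3, dist_zero_right] at h4
  rw [hT _ _ hq]
  refine h4.trans_eq ?_
  rw [Prod.dist_eq, dist_self, max_eq_left dist_nonneg, dist_zero_right, Real.norm_eq_abs]

/-- By compactness of `Ω` the local bounds give a tension of order `s` uniformly on `Ω`, hence a
bienergy of order `s²`. No integration by parts is involved. -/
theorem isBiharmonic_of_tension_eq_zero [MeasurableSpace X] [BorelSpace X]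
    (h0 : ∀ p, tension f f p = 0) : IsBiharmonic f := by
  intro Ω F hΩ hF hF0 _
  obtain ⟨C, hC⟩ : ∃ C : ℝ, ∀ᶠ s : ℝ in 𝓝 0, ∀ p ∈ Ω, ‖tension f (F s) p‖ ≤ C * |s| := by
    refine hΩ.induction_on (p := fun S => ∃ C : ℝ, ∀ᶠ s : ℝ in 𝓝 0, ∀ p ∈ S,
      ‖tension f (F s) p‖ ≤ C * |s|) ⟨0, by simp⟩ ?_ ?_ ?_
    · rintro S T hST ⟨C, hC⟩
      exact ⟨C, hC.mono fun s hs p hp => hs p (hST hp)⟩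
    · rintro S T ⟨C, hC⟩ ⟨D, hD⟩
      refine ⟨max C D, ?_⟩
      filter_upwards [hC, hD] with s hs hs' p hp
      rcases hp with hp | hp
      · exact (hs p hp).trans (by gcongr; exact le_max_left _ _)
      · exact (hs' p hp).trans (by gcongr; exact le_max_right _ _)
    · intro p _
      obtain ⟨C, hC⟩ := eventually_norm_tension_le f h0 hF hF0
        (chart_mem_atlas (E m) p) (mem_chart_source (E m) p)
      rw [nhds_prod_eq, Filter.eventually_prod_iff] at hC
      obtain ⟨pa, ha, pb, hb, h⟩ := hC
      exact ⟨{x | pb x}, mem_nhdsWithin_of_mem_nhds hb, C, ha.mono fun s hs p' hp' => h hs hp'⟩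
  have hμ : volumeMeasure f Ω < ⊤ := hΩ.measure_lt_top
  have hO : (fun s => bienergy f (F s) Ω) =O[𝓝 0] fun s : ℝ => ‖s - 0‖ ^ 2 := by
    refine Asymptotics.IsBigO.of_bound (C ^ 2 * (volumeMeasure f).real Ω) ?_
    filter_upwards [hC] with s hs
    have h1 : ∀ p ∈ Ω, ‖‖tension f (F s) p‖ ^ 2‖ ≤ C ^ 2 * |s| ^ 2 := fun p hp => by
      rw [norm_pow, norm_norm, ← mul_pow]
      exact pow_le_pow_left₀ (norm_nonneg _) (hs p hp) 2
    refine (norm_setIntegral_le_of_norm_le_const hμ h1).trans_eq ?_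
    rw [sub_zero, norm_pow, norm_norm, Real.norm_eq_abs]
    ring
  simpa using (hO.hasFDerivAt one_lt_two).hasDerivAt

end Minimal

end Submanifold

namespace Submanifold

open Topology MeasureTheory

/-! ### The Euler–Lagrange equation of the bienergy -/

section SelfAdjoint

variable {m : ℕ} {V : Type*} [NormedAddCommGroup V] [InnerProductSpace ℝ V]
  {f : E m → V} {U : Set (E m)}

/-- Integration by parts against the constant function `1`. -/
theorem integral_pd_eq_zero (i : Fin m) {Y : E m → ℝ} (hY : ContDiff ℝ 1 Y)
    (hc : HasCompactSupport Y) : ∫ y, pd i Y y = 0 := by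
  have hi : Integrable (fun y => pd i Y y) :=
    ((hY.continuous_fderiv (by simp)).clm_apply continuous_const).integrable_of_hasCompactSupport
      (hc.fderiv_apply ℝ (EuclideanSpace.single i 1))
  have h := integral_mul_fderiv_eq_neg_fderiv_mul_of_integrable (μ := volume) (𝕜 := ℝ)
    (f := fun _ : E m => (1 : ℝ)) (g := Y) (v := EuclideanSpace.single i 1) (by simp)
    (by simpa [pd] using hi)
    (by simpa using hY.continuous.integrable_of_hasCompactSupport hc)
    (fun _ _ => differentiableAt_const _)
    (fun y _ => (hY.differentiable (by simp)).differentiableAt)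
  simpa [pd] using h

/-- Green's formula for the Laplacian. -/
theorem ImmersionOn.integral_lap_comm (hf : ImmersionOn f U) {w η : E m → ℝ}
    (hw : ContDiffOn ℝ ∞ w U) (hη : ContDiff ℝ ∞ η) (hc : HasCompactSupport η)
    (hs : tsupport η ⊆ U) :
    ∫ y in tsupport η, vol f y * (w y * lap f η y) =
      ∫ y in tsupport η, vol f y * (η y * lap f w y) := by
  have hU := hf.isOpen
  have hηU : ContDiffOn ℝ ∞ η U := hη.contDiffOn
  -- `P` and `Q` are the fluxes `√g ∇η` and `√g ∇w`. The field `Y = w P − η Q` of Green's second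
  -- identity has compact support, and its divergence is the difference of the two integrands.
  obtain ⟨P, hP⟩ : ∃ P : Fin m → E m → ℝ,
      P = fun i z => ∑ j, vol f z * (gram f z)⁻¹ i j * pd j η z := ⟨_, rfl⟩
  obtain ⟨Q, hQ⟩ : ∃ Q : Fin m → E m → ℝ,
      Q = fun i z => ∑ j, vol f z * (gram f z)⁻¹ i j * pd j w z := ⟨_, rfl⟩
  obtain ⟨Y, hY⟩ : ∃ Y : Fin m → E m → ℝ, Y = fun i z => w z * P i z - η z * Q i z := ⟨_, rfl⟩
  have hPs : ∀ i, ContDiffOn ℝ ∞ (P i) U := fun i => by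
    rw [hP]
    exact ContDiffOn.sum fun j _ => (hf.contDiffOn_vol.mul (hf.contDiffOn_gram_inv i j)).mul
      (Submanifold.contDiffOn_pd hU hηU j)
  have hQs : ∀ i, ContDiffOn ℝ ∞ (Q i) U := fun i => by
    rw [hQ]
    exact ContDiffOn.sum fun j _ => (hf.contDiffOn_vol.mul (hf.contDiffOn_gram_inv i j)).mul
      (Submanifold.contDiffOn_pd hU hw j)
  have hYs : ∀ i, ContDiffOn ℝ ∞ (Y i) U := fun i => by
    rw [hY]
    exact (hw.mul (hPs i)).sub (hηU.mul (hQs i))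
  have hη0 : ∀ z ∉ tsupport η, η =ᶠ[𝓝 z] fun _ => 0 := fun z hz =>
    notMem_tsupport_iff_eventuallyEq.1 hz
  have hY0 : ∀ i, ∀ z ∉ tsupport η, Y i z = 0 := fun i z hz => by
    have h1 : ∀ j, pd j η z = 0 := fun j => by rw [pd_congr_at j (hη0 z hz), pd_const]
    rw [hY]
    simp only [hP, h1, (hη0 z hz).eq_of_nhds]
    simp
  have hto : IsOpen (tsupport η)ᶜ := (isClosed_tsupport η).isOpen_compl
  have hYe : ∀ i, ∀ z ∉ tsupport η, Y i =ᶠ[𝓝 z] fun _ => 0 := fun i z hz =>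
    eventuallyEq_of_isOpen hto (fun z hz => hY0 i z hz) hz
  have hY1 : ∀ i, ContDiff ℝ 1 (Y i) := fun i => contDiff_iff_contDiffAt.2 fun z => by
    by_cases hz : z ∈ tsupport η
    · exact ((hYs i).contDiffAt (hU.mem_nhds (hs hz))).of_le
        (WithTop.coe_le_coe.2 (le_top : (1 : ℕ∞) ≤ ⊤))
    · exact contDiffAt_const.congr_of_eventuallyEq (hYe i z hz)
  have hYc : ∀ i, HasCompactSupport (Y i) := fun i => HasCompactSupport.intro hc (hY0 i)
  have key : ∀ y ∈ tsupport η, vol f y * (w y * lap f η y) - vol f y * (η y * lap f w y) =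
      ∑ i, pd i (Y i) y := by
    intro y hy
    have hyU := hs hy
    have dw := differentiableAt_of_contDiffOn hU hw hyU
    have dη := differentiableAt_of_contDiffOn hU hηU hyU
    have dP := fun i => differentiableAt_of_contDiffOn hU (hPs i) hyU
    have dQ := fun i => differentiableAt_of_contDiffOn hU (hQs i) hyU
    have h1 : ∀ i, pd i (Y i) y = (w y * pd i (P i) y + pd i w y * P i y) -
        (η y * pd i (Q i) y + pd i η y * Q i y) := fun i => by
      rw [hY, pd_sub (φ := fun z => w z * P i z) (ψ := fun z => η z * Q i z) i (dw.mul (dP i))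
        (dη.mul (dQ i)), pd_mul i dw (dP i), pd_mul i dη (dQ i)]
    have h2 : ∑ i, pd i w y * P i y = ∑ i, pd i η y * Q i y := by
      simp only [hP, hQ, Finset.mul_sum]
      rw [Finset.sum_comm]
      refine Finset.sum_congr rfl fun i _ => Finset.sum_congr rfl fun j _ => ?_
      rw [gram_inv_symm]; ring
    have h3 : vol f y * lap f η y = ∑ i, pd i (P i) y := by
      rw [hP]; exact hf.vol_mul_lap hyU hηU
    have h4 : vol f y * lap f w y = ∑ i, pd i (Q i) y := by
      rw [hQ]; exact hf.vol_mul_lap hyU hw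
    simp only [h1, Finset.sum_sub_distrib, Finset.sum_add_distrib, h2, ← Finset.mul_sum, ← h3, ← h4]
    ring
  have hcont : ∀ {g : E m → ℝ}, ContDiffOn ℝ ∞ g U → IntegrableOn g (tsupport η) := fun hg =>
    (hg.continuousOn.mono hs).integrableOn_compact hc
  rw [← sub_eq_zero, ← integral_sub
    (hcont (hf.contDiffOn_vol.mul (hw.mul (hf.contDiffOn_lap hηU))))
    (hcont (hf.contDiffOn_vol.mul (hηU.mul (hf.contDiffOn_lap hw)))),
    setIntegral_congr_fun (isClosed_tsupport η).measurableSet key,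
    setIntegral_eq_integral_of_forall_compl_eq_zero fun y hy =>
      Finset.sum_eq_zero fun i _ => by rw [pd_congr_at i (hYe i y hy), pd_const],
    integral_finsetSum (f := fun i y => pd i (Y i) y) _ fun i _ =>
      (((hY1 i).continuous_fderiv (by simp)).clm_apply
        continuous_const).integrable_of_hasCompactSupport
        ((hYc i).fderiv_apply ℝ (EuclideanSpace.single i 1))]
  exact Finset.sum_eq_zero fun i _ => integral_pd_eq_zero i (hY1 i) (hYc i)

/-- Green's formula moves the Laplacian onto `w`; the fundamental lemma of the calculus of
variations gives vanishing almost everywhere, and continuity gives it everywhere. -/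
theorem ImmersionOn.lap_eq_zero_of_integral (hf : ImmersionOn f U) {w : E m → ℝ}
    (hw : ContDiffOn ℝ ∞ w U)
    (h : ∀ η : E m → ℝ, ContDiff ℝ ∞ η → HasCompactSupport η → tsupport η ⊆ U →
      ∫ y in tsupport η, vol f y * (w y * lap f η y) = 0) {y : E m} (hy : y ∈ U) :
    lap f w y = 0 := by
  have hg : ContDiffOn ℝ ∞ (fun y => vol f y * lap f w y) U :=
    hf.contDiffOn_vol.mul (hf.contDiffOn_lap hw)
  have h1 : ∀ᵐ y, y ∈ U → vol f y * lap f w y = 0 := by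
    refine hf.isOpen.ae_eq_zero_of_integral_contDiff_smul_eq_zero
      (hg.continuousOn.locallyIntegrableOn hf.isOpen.measurableSet) fun η hη hc hs => ?_
    rw [← setIntegral_eq_integral_of_forall_compl_eq_zero (s := tsupport η)
      fun y hy => by rw [image_eq_zero_of_notMem_tsupport hy, zero_smul],
      ← h η hη hc hs, hf.integral_lap_comm hw hη hc hs]
    refine setIntegral_congr_fun (isClosed_tsupport η).measurableSet fun y _ => ?_
    simp only [smul_eq_mul]; ring
  have h2 := Measure.eqOn_open_of_ae_eq (μ := volume) (f := fun y => vol f y * lap f w y)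
    (g := fun _ => (0 : ℝ)) ((ae_restrict_iff' hf.isOpen.measurableSet).2 h1) hf.isOpen
    hg.continuousOn continuousOn_const hy
  exact (mul_eq_zero.1 h2).resolve_left (hf.vol_pos hy).ne'

end SelfAdjoint

/-! ### Variations supported in a chart domain -/

section ExtendChart

variable {m : ℕ} {X : Type*} [TopologicalSpace X] {V : Type*} [NormedAddCommGroup V]

open Classical in
/-- The extension by zero of a map on the domain of the chart `e`. -/
noncomputable def extendChart (e : OpenPartialHomeomorph X (E m)) (ζ : E m → V) (p : X) : V :=
  if p ∈ e.source then ζ (e p) else 0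

theorem extendChart_symm {e : OpenPartialHomeomorph X (E m)}
    {ζ : E m → V} {y : E m} (hy : y ∈ e.target) : extendChart e ζ (e.symm y) = ζ y := by
  rw [extendChart, if_pos (e.map_target hy), e.right_inv hy]

theorem extendChart_eq_zero {e : OpenPartialHomeomorph X (E m)}
    {ζ : E m → V} {p : X} (hp : p ∉ e.symm '' tsupport ζ) : extendChart e ζ p = 0 := by
  rw [extendChart]
  split_ifs with h
  · exact image_eq_zero_of_notMem_tsupport fun h' => hp ⟨_, h', e.left_inv h⟩
  · rfl

theorem isCompact_image_tsupport  {e : OpenPartialHomeomorph X (E m)} {ζ : E m → V} (hc : HasCompactSupport ζ)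
    (hs : tsupport ζ ⊆ e.target) : IsCompact (e.symm '' tsupport ζ) :=
  hc.isCompact.image_of_continuousOn (e.continuousOn_symm.mono hs)

end ExtendChart

section EulerLagrange

variable {m : ℕ} {X : Type*} [TopologicalSpace X] [T2Space X] [ChartedSpace (E m) X]
  {V : Type*} [NormedAddCommGroup V] [InnerProductSpace ℝ V]
  [IsManifold 𝓘(ℝ, E m) ∞ X] (f : Immersion m X V)

/-- Hausdorffness enters here: the compact image of the support is closed, so the extension vanishes
near every point outside the chart domain. -/
theorem contMDiff_extendChart {e : OpenPartialHomeomorph X (E m)} (he : e ∈ atlas (E m) X)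
    {ζ : E m → V} (hζ : ContDiff ℝ ∞ ζ) (hc : HasCompactSupport ζ) (hs : tsupport ζ ⊆ e.target) :
    ContMDiff 𝓘(ℝ, E m) 𝓘(ℝ, V) ∞ (extendChart e ζ) := by
  intro p
  by_cases hp : p ∈ e.source
  · have h : ContMDiffOn 𝓘(ℝ, E m) 𝓘(ℝ, V) ∞ (ζ ∘ e) e.source :=
      hζ.contMDiff.comp_contMDiffOn
        (contMDiffOn_of_mem_maximalAtlas (IsManifold.subset_maximalAtlas he))
    exact (h.congr fun q hq => if_pos hq).contMDiffAt (e.open_source.mem_nhds hp)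
  · have ho : IsOpen (e.symm '' tsupport ζ)ᶜ :=
      (isCompact_image_tsupport hc hs).isClosed.isOpen_compl
    have hp' : p ∈ (e.symm '' tsupport ζ)ᶜ := fun ⟨y, hy, hyp⟩ =>
      hp (hyp ▸ e.map_target (hs hy))
    exact contMDiffAt_const.congr_of_eventuallyEq
      (eventuallyEq_of_isOpen ho (fun q hq => extendChart_eq_zero hq) hp')

variable [MeasurableSpace X] [BorelSpace X]

/-- The metric is that of `f` throughout the variation, so the tension is linear in the map and the
integrand is quadratic in `s`. -/
theorem bienergy_extendChart {e : OpenPartialHomeomorph X (E m)} (he : e ∈ atlas (E m) X)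
    {ζ : E m → V} (hζ : ContDiff ℝ ∞ ζ) (hc : HasCompactSupport ζ) (hs : tsupport ζ ⊆ e.target)
    (s : ℝ) :
    bienergy f (fun p => f p + s • extendChart e ζ p) (e.symm '' tsupport ζ) =
      ∫ y in tsupport ζ, vol (f ∘ e.symm) y *
        ‖lap (f ∘ e.symm) (f ∘ e.symm) y + s • lap (f ∘ e.symm) ζ y‖ ^ 2 := by
  have hF : ContMDiff 𝓘(ℝ, E m) 𝓘(ℝ, V) ∞ fun p => f p + s • extendChart e ζ p :=
    f.contMDiff.add ((contMDiff_const (I' := 𝓘(ℝ, ℝ)) (c := s)).smul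
      (contMDiff_extendChart he hζ hc hs))
  have hsub : e.symm '' tsupport ζ ⊆ e.source := by
    rintro _ ⟨y, hy, rfl⟩
    exact e.map_target (hs hy)
  have hFc := contDiffOn_comp_symm hF he
  have hT : ∀ p ∈ e.source, tension f (fun p => f p + s • extendChart e ζ p) p =
      lap (f ∘ e.symm) ((fun p => f p + s • extendChart e ζ p) ∘ e.symm) (e p) := fun p hp =>
    tension_eq_lap f he hFc hp
  have hcont : ContinuousOn
      (fun p => ‖tension f (fun p => f p + s • extendChart e ζ p) p‖ ^ 2) e.source := by
    refine ((ContinuousOn.norm ?_).pow 2)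
    exact ((((f.immersionOn he).contDiffOn_lap hFc).continuousOn.comp e.continuousOn
      e.mapsTo).congr hT)
  rw [bienergy, setIntegral_volumeMeasure f he
    (isCompact_image_tsupport hc hs).isClosed.measurableSet hsub hcont]
  have hset : e.symm ⁻¹' (e.symm '' tsupport ζ) ∩ e.target = tsupport ζ := by
    ext y
    refine ⟨fun ⟨⟨z, hz, hzy⟩, hy⟩ => ?_, fun hy => ⟨⟨y, hy, rfl⟩, hs hy⟩⟩
    rwa [← e.symm.injOn (hs hz) hy hzy]
  rw [hset]
  refine setIntegral_congr_fun (isClosed_tsupport ζ).measurableSet fun y hy => ?_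
  have hy' := hs hy
  have h1 : (fun p => f p + s • extendChart e ζ p) ∘ e.symm =ᶠ[𝓝 y]
      fun z => (f ∘ e.symm) z + s • ζ z :=
    eventuallyEq_of_isOpen e.open_target (fun z hz => by
      rw [Function.comp_apply, extendChart_symm hz, Function.comp_apply]) hy'
  rw [hT _ (e.map_target hy'), e.right_inv hy', lap_congr h1,
    lap_add e.open_target (f.contDiffOn he) (hζ.contDiffOn.const_smul s) hy',
    lap_const_smul s e.open_target hζ.contDiffOn hy']

/-- Along a linear variation the bienergy is a polynomial of degree at most two in `s`; criticality
kills its linear coefficient, which is twice this integral. -/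
theorem integral_inner_lap_eq_zero (hf : IsBiharmonic f) {e : OpenPartialHomeomorph X (E m)}
    (he : e ∈ atlas (E m) X) {ζ : E m → V} (hζ : ContDiff ℝ ∞ ζ) (hc : HasCompactSupport ζ)
    (hs : tsupport ζ ⊆ e.target) :
    ∫ y in tsupport ζ, vol (f ∘ e.symm) y *
      inner ℝ (lap (f ∘ e.symm) (f ∘ e.symm) y) (lap (f ∘ e.symm) ζ y) = 0 := by
  have hζX := contMDiff_extendChart he hζ hc hs
  have h1 := hf (e.symm '' tsupport ζ) (fun s p => f p + s • extendChart e ζ p)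
    (isCompact_image_tsupport hc hs)
    ((f.contMDiff.comp contMDiff_snd).add (contMDiff_fst.smul (hζX.comp contMDiff_snd)))
    (by simp) (fun s p hp => by rw [extendChart_eq_zero hp, smul_zero, add_zero])
  simp only [bienergy_extendChart f he hζ hc hs] at h1
  have hi := f.immersionOn he
  obtain ⟨τ, hτ⟩ : ∃ τ, τ = lap (f ∘ e.symm) (f ∘ e.symm) := ⟨_, rfl⟩
  obtain ⟨η, hη⟩ : ∃ η, η = lap (f ∘ e.symm) ζ := ⟨_, rfl⟩
  obtain ⟨v, hv⟩ : ∃ v, v = vol (f ∘ e.symm) := ⟨_, rfl⟩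
  have sτ : ContDiffOn ℝ ∞ τ e.target := hτ ▸ hi.contDiffOn_lap (f.contDiffOn he)
  have sη : ContDiffOn ℝ ∞ η e.target := hη ▸ hi.contDiffOn_lap hζ.contDiffOn
  have sv : ContDiffOn ℝ ∞ v e.target := hv ▸ hi.contDiffOn_vol
  rw [← hτ, ← hη, ← hv] at h1 ⊢
  have hcont : ∀ {g : E m → ℝ}, ContDiffOn ℝ ∞ g e.target → IntegrableOn g (tsupport ζ) := fun hg =>
    (hg.continuousOn.mono hs).integrableOn_compact hc
  have iA := hcont (sv.mul (sτ.norm_sq ℝ))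
  have iB := hcont (sv.mul (sτ.inner ℝ sη))
  have iC := hcont (sv.mul (sη.norm_sq ℝ))
  have h2 : ∀ s : ℝ, ∫ y in tsupport ζ, v y * ‖τ y + s • η y‖ ^ 2 =
      (∫ y in tsupport ζ, v y * ‖τ y‖ ^ 2) + s * (2 * ∫ y in tsupport ζ, v y * inner ℝ (τ y) (η y))
        + s ^ 2 * ∫ y in tsupport ζ, v y * ‖η y‖ ^ 2 := by
    intro s
    rw [← integral_const_mul, ← integral_const_mul, ← integral_const_mul, ← integral_add,
      ← integral_add]
    · refine integral_congr_ae (Filter.Eventually.of_forall fun y => ?_)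
      simp only
      rw [norm_add_sq_real, real_inner_smul_right, norm_smul, Real.norm_eq_abs, mul_pow, sq_abs]
      ring
    · exact iA.add ((iB.const_mul 2).const_mul s)
    · exact iC.const_mul _
    · exact iA
    · exact (iB.const_mul 2).const_mul s
  simp only [h2] at h1
  have h3 := ((((hasDerivAt_id (0 : ℝ)).mul_const
    (2 * ∫ y in tsupport ζ, v y * inner ℝ (τ y) (η y))).const_add
      (∫ y in tsupport ζ, v y * ‖τ y‖ ^ 2)).add (((hasDerivAt_id (0 : ℝ)).pow 2).mul_const
        (∫ y in tsupport ζ, v y * ‖η y‖ ^ 2)))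
  have h4 := h1.unique h3
  simp at h4
  linarith

/-- The Euler–Lagrange equation of the bienergy in coordinates. -/
theorem lap_lap_eq_zero (hf : IsBiharmonic f) {e : OpenPartialHomeomorph X (E m)}
    (he : e ∈ atlas (E m) X) {y : E m} (hy : y ∈ e.target) :
    lap (f ∘ e.symm) (lap (f ∘ e.symm) (f ∘ e.symm)) y = 0 := by
  have hi := f.immersionOn he
  have sτ := hi.contDiffOn_lap (f.contDiffOn he)
  -- Test fields `η v` with a fixed vector `v` reduce the equation to the scalar function `⟨v, lap f
  -- f⟩`.
  refine ext_inner_left ℝ fun v => ?_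
  rw [inner_zero_right, ← innerSL_apply_apply ℝ v, ← lap_clm (innerSL ℝ v) e.open_target sτ hy]
  refine hi.lap_eq_zero_of_integral ((innerSL ℝ v).contDiff.comp_contDiffOn sτ)
    (fun η hη hc hs => ?_) hy
  -- For `v ≠ 0` the field `η v` has the same support as `η`, hence the same domain of integration.
  by_cases hv : v = 0
  · simp [hv]
  have hts : tsupport (fun y => η y • v) = tsupport η := by
    have : Function.support (fun y => η y • v) = Function.support η := by
      ext y; simp [hv]
    rw [tsupport, this, tsupport]
  have hcv : HasCompactSupport fun y => η y • v := by
    rw [HasCompactSupport, hts]; exact hc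
  have h1 := integral_inner_lap_eq_zero f hf he (ζ := fun y => η y • v) (hη.smul contDiff_const) hcv (hts ▸ hs)
  rw [hts] at h1
  rw [← h1]
  refine setIntegral_congr_fun (isClosed_tsupport η).measurableSet fun y hy => ?_
  have h2 : lap (f ∘ e.symm) (fun y => η y • v) y = lap (f ∘ e.symm) η y • v :=
    lap_clm ((ContinuousLinearMap.id ℝ ℝ).smulRight v) e.open_target hη.contDiffOn (hs hy)
  rw [h2, real_inner_smul_right, Function.comp_apply, innerSL_apply_apply, real_inner_comm v]
  ring

end EulerLagrange

end Submanifold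

namespace Submanifold

open Topology

/-! ### Normal coordinates -/

section NormalCoordinates

variable {m : ℕ} {V : Type*} [NormedAddCommGroup V] [InnerProductSpace ℝ V]
  {W : Type*} [NormedAddCommGroup W] [NormedSpace ℝ W]
  {f : E m → V} {U : Set (E m)}

/-- At the point `y`, the coordinates are orthonormal and the Christoffel symbols vanish. -/
structure IsNormalAt (f : E m → V) (y : E m) : Prop where
  gram_eq : gram f y = 1
  inner_eq : ∀ i j k, inner ℝ (pd i (pd j f) y) (pd k f y) = 0

theorem injective_fderiv_of_det_jacobian {ψ : E m → E m} {y : E m}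
    (h : (jacobian ψ y).det ≠ 0) : Function.Injective (fderiv ℝ ψ y) := by
  rw [injective_iff_map_eq_zero]
  intro v hv
  have h1 : (jacobian ψ y).mulVec v.ofLp = 0 := by
    rw [fderiv_eq_sum_pd] at hv
    ext a
    have := congrArg (fun w : E m => w a) hv
    simpa [Matrix.mulVec, dotProduct, jacobian, Finset.sum_apply, mul_comm] using this
  ext a
  exact congrFun (Matrix.eq_zero_of_mulVec_eq_zero h h1) a

theorem pd_coord (i j : Fin m) (y : E m) : pd i (fun z : E m => z j) y = if j = i then 1 else 0 := by
  have h : HasFDerivAt (fun z : E m => z j) (EuclideanSpace.proj (𝕜 := ℝ) j) y :=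
    (EuclideanSpace.proj (𝕜 := ℝ) j).hasFDerivAt
  rw [pd, h.fderiv]
  simp

/-- The quadratic map with given derivatives at `0`. -/
noncomputable def quadraticMap (y₀ : E m) (v : Fin m → E m) (w : Fin m → Fin m → E m) (y : E m) :
    E m :=
  y₀ + ∑ a, y a • v a - ∑ a, ∑ b, y a • (y b • ((1 / 2 : ℝ) • w a b))

theorem contDiff_quadraticMap (y₀ : E m) (v : Fin m → E m) (w : Fin m → Fin m → E m) :
    ContDiff ℝ ∞ (quadraticMap y₀ v w) := by
  have h : ∀ a : Fin m, ContDiff ℝ ∞ fun y : E m => y a := fun a =>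
    (EuclideanSpace.proj (𝕜 := ℝ) a).contDiff
  exact (contDiff_const.add (ContDiff.sum fun a _ => (h a).smul contDiff_const)).sub
    (ContDiff.sum fun a _ => ContDiff.sum fun b _ => (h a).smul ((h b).smul contDiff_const))

/-- The symmetry of `w` merges the two halves produced by the factor `1 / 2`. -/
theorem pd_quadraticMap (y₀ : E m) (v : Fin m → E m) {w : Fin m → Fin m → E m}
    (hw : ∀ i j, w i j = w j i) (i : Fin m) (y : E m) :
    pd i (quadraticMap y₀ v w) y = v i - ∑ a, y a • w i a := by
  have d : ∀ a : Fin m, DifferentiableAt ℝ (fun z : E m => z a) y := fun a =>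
    (EuclideanSpace.proj (𝕜 := ℝ) a).differentiableAt
  have d1 : ∀ a, DifferentiableAt ℝ (fun z : E m => z a • v a) y := fun a =>
    (d a).smul (differentiableAt_const _)
  have d2 : ∀ a b, DifferentiableAt ℝ (fun z : E m => z b • ((1 / 2 : ℝ) • w a b)) y := fun a b =>
    (d b).smul (differentiableAt_const _)
  have d3 : ∀ a b, DifferentiableAt ℝ (fun z : E m => z a • (z b • ((1 / 2 : ℝ) • w a b))) y :=
    fun a b => (d a).smul (d2 a b)
  have d4 : ∀ a, DifferentiableAt ℝ (fun z : E m => ∑ b, z a • (z b • ((1 / 2 : ℝ) • w a b))) y :=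
    fun a => DifferentiableAt.fun_sum fun b _ => d3 a b
  have d5 : DifferentiableAt ℝ (fun z : E m => ∑ a, z a • v a) y :=
    DifferentiableAt.fun_sum fun a _ => d1 a
  have h1 : pd i (fun z : E m => ∑ a, z a • v a) y = v i := by
    rw [pd_sum (φ := fun a z => z a • v a) _ _ fun a _ => d1 a]
    simp [pd_smul i (d _) (differentiableAt_const _), pd_coord]
  have h2 : ∀ a b, pd i (fun z : E m => z a • (z b • ((1 / 2 : ℝ) • w a b))) y =
      (if b = i then y a • ((1 / 2 : ℝ) • w a b) else 0) +
        if a = i then y b • ((1 / 2 : ℝ) • w a b) else 0 := fun a b => by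
    rw [pd_smul (φ := fun z => z b • ((1 / 2 : ℝ) • w a b)) i (d a) (d2 a b),
      pd_smul i (d b) (differentiableAt_const _), pd_const, pd_coord, pd_coord]
    split_ifs <;> simp
  rw [show quadraticMap y₀ v w = fun y => (y₀ + ∑ a, y a • v a) -
      ∑ a, ∑ b, y a • (y b • ((1 / 2 : ℝ) • w a b)) from rfl,
    pd_sub (φ := fun y => y₀ + ∑ a, y a • v a) i ((differentiableAt_const _).add d5) (DifferentiableAt.fun_sum fun a _ => d4 a),
    pd_add i (differentiableAt_const _) d5, pd_const, h1,
    pd_sum (φ := fun a z => ∑ b, z a • (z b • ((1 / 2 : ℝ) • w a b))) _ _ fun a _ => d4 a]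
  simp only [fun a => pd_sum (φ := fun b z => z a • (z b • ((1 / 2 : ℝ) • w a b)))
    Finset.univ i fun b _ => d3 a b, h2, Finset.sum_add_distrib, zero_add]
  congr 1
  rw [Finset.sum_comm (f := fun a b => if a = i then y b • ((1 / 2 : ℝ) • w a b) else 0)]
  simp only [Finset.sum_ite_eq', Finset.mem_univ, if_true, ← Finset.sum_add_distrib]
  refine Finset.sum_congr rfl fun a _ => ?_
  rw [hw a i]
  module

theorem pd_pd_quadraticMap (y₀ : E m) (v : Fin m → E m) {w : Fin m → Fin m → E m}
    (hw : ∀ i j, w i j = w j i) (i j : Fin m) (y : E m) :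
    pd i (pd j (quadraticMap y₀ v w)) y = -w i j := by
  have d : ∀ a : Fin m, DifferentiableAt ℝ (fun z : E m => z a) y := fun a =>
    (EuclideanSpace.proj (𝕜 := ℝ) a).differentiableAt
  have d1 : ∀ a, DifferentiableAt ℝ (fun z : E m => z a • w j a) y := fun a =>
    (d a).smul (differentiableAt_const _)
  rw [show pd j (quadraticMap y₀ v w) = fun y => v j - ∑ a, y a • w j a from
      funext fun y => pd_quadraticMap y₀ v hw j y,
    pd_sub i (differentiableAt_const _) (DifferentiableAt.fun_sum fun a _ => d1 a), pd_const,
    pd_sum (φ := fun a z => z a • w j a) _ _ fun a _ => d1 a]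
  simp [pd_smul i (d _) (differentiableAt_const _), pd_coord, hw j i]

/-- A quadratic change of coordinates suffices: its linear part makes the metric the identity at the
point, and its quadratic part removes the tangential component of the second derivatives there. -/
theorem ImmersionOn.exists_normal (hf : ImmersionOn f U) {y₀ : E m} (hy₀ : y₀ ∈ U) :
    ∃ (ψ : E m → E m) (U' : Set (E m)), IsOpen U' ∧ 0 ∈ U' ∧ ψ 0 = y₀ ∧ ContDiffOn ℝ ∞ ψ U' ∧
      Set.MapsTo ψ U' U ∧ (∀ y ∈ U', Function.Injective (fderiv ℝ ψ y)) ∧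
      IsNormalAt (f ∘ ψ) 0 := by
  have hinj := hf.injective y₀ hy₀
  set A : E m →ₗ[ℝ] V := (fderiv ℝ f y₀).toLinearMap with hA
  have hfin : Module.finrank ℝ (LinearMap.range A) = m := by
    rw [LinearMap.finrank_range_of_inj hinj]; simp
  -- An orthonormal basis of the tangent space; the vectors `v` below are its preimages in
  -- coordinates.
  set b := (stdOrthonormalBasis ℝ (LinearMap.range A)).reindex (finCongr hfin)
  have hb : ∀ i, ∃ v, A v = b i := fun i => (b i).2
  choose v hv using hb
  set X : Fin m → Fin m → V := fun i j => ∑ a, ∑ c, (v i a * v j c) • pd a (pd c f) y₀ with hX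
  have hXs : ∀ i j, X i j = X j i := by
    intro i j
    simp only [hX]
    rw [Finset.sum_comm]
    refine Finset.sum_congr rfl fun a _ => Finset.sum_congr rfl fun c _ => ?_
    rw [hf.pd_pd_comm hy₀, mul_comm]
  -- `X i j` is the second derivative of `f` in the directions `v i` and `v j`; `w i j` is the
  -- coordinate vector whose image is the tangential part of `X i j`.
  set w : Fin m → Fin m → E m := fun i j => ∑ k, (inner ℝ (X i j) (b k : V) : ℝ) • v k with hw
  have hws : ∀ i j, w i j = w j i := fun i j => by simp only [hw, hXs i j]
  set ψ := quadraticMap y₀ v w with hψ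
  have hψs : ContDiff ℝ ∞ ψ := contDiff_quadraticMap y₀ v w
  have hψ0 : ψ 0 = y₀ := by simp [hψ, quadraticMap]
  have hp1 : ∀ i, pd i ψ 0 = v i := fun i => by
    rw [hψ, pd_quadraticMap y₀ v hws]; simp
  have hp2 : ∀ i j, pd i (pd j ψ) 0 = -w i j := fun i j => pd_pd_quadraticMap y₀ v hws i j 0
  have hψd : DifferentiableAt ℝ ψ 0 := (hψs.differentiable (by simp)).differentiableAt
  have hfd : DifferentiableAt ℝ f (ψ 0) := by
    rw [hψ0]; exact differentiableAt_of_contDiffOn hf.isOpen hf.contDiffOn hy₀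
  have hAv : ∀ x : E m, A x = ∑ a, x a • pd a f y₀ := fun x => fderiv_eq_sum_pd f y₀ x
  have hpf : ∀ i, pd i (f ∘ ψ) 0 = b i := fun i => by
    rw [pd_comp i hfd hψd, hψ0, hp1, ← hAv, hv]
  have hbo : ∀ i j, inner ℝ (b i : V) (b j : V) = (1 : Matrix (Fin m) (Fin m) ℝ) i j := fun i j => by
    have := orthonormal_iff_ite.1 b.orthonormal i j
    rw [Matrix.one_apply]
    exact this
  have hg : gram (f ∘ ψ) 0 = 1 := by
    ext i j
    rw [gram_apply, hpf, hpf, hbo]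
  set U' : Set (E m) := {y | ψ y ∈ U ∧ (jacobian ψ y).det ≠ 0} with hU'
  have hJc : Continuous fun y => (jacobian ψ y).det := by
    refine Continuous.matrix_det (continuous_matrix fun a i => ?_)
    exact (EuclideanSpace.proj (𝕜 := ℝ) a).continuous.comp
      ((hψs.continuous_fderiv (by simp)).clm_apply continuous_const)
  have h0 : (0 : E m) ∈ U' := by
    refine ⟨by rw [hψ0]; exact hy₀, fun h => ?_⟩
    have := congrArg Matrix.det (gram_comp hfd hψd)
    rw [hg, Matrix.det_mul, Matrix.det_mul, h] at this
    simp at this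
  have hU'o : IsOpen U' := (hf.isOpen.preimage hψs.continuous).inter (isOpen_ne.preimage hJc)
  refine ⟨ψ, U', hU'o, h0, hψ0, hψs.contDiffOn, fun y hy => hy.1,
    fun y hy => injective_fderiv_of_det_jacobian hy.2, hg, fun i j k => ?_⟩
  have hs : ∀ l, inner ℝ ((inner ℝ (X i j) (b l : V) : ℝ) • (b l : V)) (b k : V) =
      inner ℝ (X i j) (b l : V) * (1 : Matrix (Fin m) (Fin m) ℝ) l k := fun l => by
    rw [real_inner_smul_left, hbo]
  have hAw : inner ℝ (A (w i j)) (b k : V) = inner ℝ (X i j) (b k : V) := by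
    simp only [hw, map_sum, map_smul, hv]
    rw [sum_inner, Finset.sum_congr rfl fun l _ => hs l]
    simp [Matrix.one_apply]
  rw [pd_pd_comp hf.isOpen hU'o hf.contDiffOn hψs.contDiffOn (fun y hy => hy.1) h0, hp2, hψ0, hpf]
  simp only [hp1]
  rw [← hAv, map_neg, show (∑ a, ∑ c, (v i a * v j c) • pd a (pd c f) y₀) = X i j from rfl,
    inner_add_left, inner_neg_left, hAw, add_neg_cancel]

/-- Where the metric is a multiple of the identity, the Christoffel terms involve only `∑ ∂ᵢ∂ᵢf`. If
this vector is normal, the Laplacian is a rescaled flat one; the conformal slices of a minimal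
surface are treated in this way. -/
theorem lap_of_gram_eq_smul {μ : ℝ} (hμ : μ ≠ 0) {y : E m} (hg : gram f y = μ • 1) (φ : E m → W) :
    lap f φ y = μ⁻¹ • (∑ i, pd i (pd i φ) y -
      ∑ k, (μ⁻¹ * inner ℝ (∑ i, pd i (pd i f) y) (pd k f y)) • pd k φ y) := by
  have h1 : (gram f y)⁻¹ = μ⁻¹ • 1 := by
    rw [hg]
    exact Matrix.inv_eq_right_inv (by rw [smul_mul_smul_comm, mul_inv_cancel₀ hμ]; simp)
  have h2 : ∀ k i j, gamma f k i j y = μ⁻¹ * inner ℝ (pd i (pd j f) y) (pd k f y) := by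
    intro k i j
    simp [gamma, h1, Matrix.one_apply]
  simp only [lap, h1, h2, Matrix.smul_apply, Matrix.one_apply, smul_eq_mul, mul_ite, mul_one,
    mul_zero, ite_smul, zero_smul, Finset.sum_ite_eq, Finset.mem_univ, if_true, ← Finset.smul_sum,
    Finset.sum_sub_distrib, sum_inner, Finset.mul_sum, Finset.sum_smul]
  congr 2
  rw [Finset.sum_comm]

theorem IsNormalAt.lap_eq {y : E m} (h : IsNormalAt f y) (φ : E m → W) :
    lap f φ y = ∑ i, pd i (pd i φ) y := by
  rw [lap_of_gram_eq_smul one_ne_zero (by rw [h.gram_eq, one_smul])]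
  simp [sum_inner, h.inner_eq]

end NormalCoordinates

end Submanifold

namespace Submanifold

open Topology

/-! ### The normal bundle in coordinates -/

section Fibred

variable {W : Type*} [NormedAddCommGroup W] [NormedSpace ℝ W]

/-- `base` as a continuous linear map. -/
noncomputable def baseL : E 3 →L[ℝ] E 2 :=
  LinearMap.toContinuousLinearMap
    { toFun := base
      map_add' := fun a b => by ext i; fin_cases i <;> simp [base]
      map_smul' := fun a b => by ext i; fin_cases i <;> simp [base] }

theorem hasFDerivAt_base (z : E 3) : HasFDerivAt base baseL z := baseL.hasFDerivAt

/-- The point of `E³` over `y` with third coordinate `t`. -/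
noncomputable def lift (t : ℝ) (y : E 2) : E 3 := !₂[y 0, y 1, t]

theorem base_lift (t : ℝ) (y : E 2) : base (lift t y) = y := base_mk y t

theorem lift_two (t : ℝ) (y : E 2) : lift t y 2 = t := rfl

theorem lift_base (z : E 3) : lift (z 2) (base z) = z := by
  ext i; fin_cases i <;> simp [lift, base]

theorem contDiff_lift (t : ℝ) : ContDiff ℝ ∞ (lift t) := by
  rw [contDiff_euclidean]
  intro i
  fin_cases i <;> simp [lift] <;> fun_prop

theorem pd_lift (t : ℝ) (i : Fin 2) (y : E 2) :
    pd i (lift t) y = EuclideanSpace.single i.castSucc 1 := by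
  have hd : DifferentiableAt ℝ (lift t) y := ((contDiff_lift t).differentiable (by simp)) y
  ext a
  rw [pd_apply i hd]
  fin_cases a
  · exact (pd_coord i 0 y).trans (by fin_cases i <;> simp)
  · exact (pd_coord i 1 y).trans (by fin_cases i <;> simp)
  · refine (pd_const i t y).trans (by fin_cases i <;> simp)

theorem pd_comp_lift (t : ℝ) (i : Fin 2) {φ : E 3 → W} {y : E 2}
    (hφ : DifferentiableAt ℝ φ (lift t y)) :
    pd i (fun y => φ (lift t y)) y = pd i.castSucc φ (lift t y) := by
  have hd : DifferentiableAt ℝ (lift t) y := ((contDiff_lift t).differentiable (by simp)) y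
  rw [show (fun y => φ (lift t y)) = φ ∘ lift t from rfl, pd_comp i hφ hd, pd_lift]
  simp

theorem baseL_single_castSucc (i : Fin 2) :
    baseL (EuclideanSpace.single i.castSucc 1) = EuclideanSpace.single i 1 := by
  change base _ = _
  ext a
  fin_cases a <;> fin_cases i <;> simp [base]

theorem baseL_single_two : baseL (EuclideanSpace.single 2 1) = 0 := by
  change base _ = _
  ext a
  fin_cases a <;> simp [base]

theorem pd_comp_base (i : Fin 2) {φ : E 2 → W} {z : E 3} (hφ : DifferentiableAt ℝ φ (base z)) :
    pd i.castSucc (fun z => φ (base z)) z = pd i φ (base z) := by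
  have := (hφ.hasFDerivAt.comp z (hasFDerivAt_base z)).fderiv
  rw [pd, show (fun z => φ (base z)) = φ ∘ base from rfl, this,
    ContinuousLinearMap.comp_apply, baseL_single_castSucc]
  rfl

theorem pd_two_comp_base {φ : E 2 → W} {z : E 3} (hφ : DifferentiableAt ℝ φ (base z)) :
    pd 2 (fun z => φ (base z)) z = 0 := by
  have := (hφ.hasFDerivAt.comp z (hasFDerivAt_base z)).fderiv
  rw [pd, show (fun z => φ (base z)) = φ ∘ base from rfl, this,
    ContinuousLinearMap.comp_apply, baseL_single_two, map_zero]

theorem contDiffOn_comp_base {φ : E 2 → W} {U : Set (E 2)} (hφ : ContDiffOn ℝ ∞ φ U) :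
    ContDiffOn ℝ ∞ (fun z => φ (base z)) (base ⁻¹' U) :=
  hφ.comp contDiff_base.contDiffOn fun _ hz => hz

theorem contDiffOn_comp_lift {φ : E 3 → W} {U : Set (E 2)} (hφ : ContDiffOn ℝ ∞ φ (base ⁻¹' U))
    (t : ℝ) : ContDiffOn ℝ ∞ (fun y => φ (lift t y)) U :=
  hφ.comp (contDiff_lift t).contDiffOn fun y hy => by rwa [Set.mem_preimage, base_lift]

theorem isOpen_preimage_base {U : Set (E 2)} (hU : IsOpen U) : IsOpen (base ⁻¹' U) :=
  hU.preimage contDiff_base.continuous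

theorem contDiff_apply_two : ContDiff ℝ ∞ fun z : E 3 => z 2 :=
  (EuclideanSpace.proj (𝕜 := ℝ) (2 : Fin 3)).contDiff

theorem differentiableAt_apply_two (z : E 3) : DifferentiableAt ℝ (fun z : E 3 => z 2) z :=
  (EuclideanSpace.proj (𝕜 := ℝ) (2 : Fin 3)).differentiableAt

theorem differentiableAt_comp_base {φ : E 2 → W} {z : E 3} (hφ : DifferentiableAt ℝ φ (base z)) :
    DifferentiableAt ℝ (fun z => φ (base z)) z :=
  (hφ.hasFDerivAt.comp z (hasFDerivAt_base z)).differentiableAt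

theorem pd_castSucc_apply_two (i : Fin 2) (z : E 3) :
    pd i.castSucc (fun z : E 3 => z 2) z = 0 :=
  (pd_coord _ _ z).trans (if_neg (by fin_cases i <;> decide))

theorem pd_two_apply_two (z : E 3) : pd 2 (fun z : E 3 => z 2) z = 1 :=
  (pd_coord _ _ z).trans (if_pos rfl)

theorem pd_castSucc_smul_comp_base (i : Fin 2) {φ : E 2 → W} {z : E 3}
    (hφ : DifferentiableAt ℝ φ (base z)) :
    pd i.castSucc (fun z => z 2 • φ (base z)) z = z 2 • pd i φ (base z) := by
  rw [pd_smul (φ := fun z => φ (base z)) _ (differentiableAt_apply_two z)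
    (differentiableAt_comp_base hφ), pd_comp_base i hφ, pd_castSucc_apply_two, zero_smul, add_zero]

theorem pd_two_smul_comp_base {φ : E 2 → W} {z : E 3} (hφ : DifferentiableAt ℝ φ (base z)) :
    pd 2 (fun z => z 2 • φ (base z)) z = φ (base z) := by
  rw [pd_smul (φ := fun z => φ (base z)) _ (differentiableAt_apply_two z)
    (differentiableAt_comp_base hφ), pd_two_comp_base hφ, pd_two_apply_two, smul_zero, zero_add,
    one_smul]

theorem sum_fin_three {M : Type*} [AddCommMonoid M] (g : Fin 3 → M) :
    ∑ i, g i = (∑ i : Fin 2, g i.castSucc) + g 2 := Fin.sum_univ_castSucc g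

end Fibred

/-! ### Unit normal fields, slices, and the metric of the normal bundle -/

section NormalField

/-- `N` is a smooth unit normal field along the immersion `u` of `U` in `E³`. -/
structure IsNormalField (u N : E 2 → E 3) (U : Set (E 2)) : Prop where
  immersionOn : ImmersionOn u U
  contDiffOn : ContDiffOn ℝ ∞ N U
  inner_self : ∀ y ∈ U, inner ℝ (N y) (N y) = 1
  inner_pd : ∀ y ∈ U, ∀ i, inner ℝ (pd i u y) (N y) = 0

theorem inner_pairL (p q : E 3 × E 3) :
    inner ℝ (pairL p) (pairL q) = inner ℝ p.1 q.1 + inner ℝ p.2 q.2 := by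
  change inner ℝ (pair p) (pair q) = _
  simp only [PiLp.inner_apply, Fin.sum_univ_six, Fin.sum_univ_three]
  simp [pair]; ring

theorem pairL_injective : Function.Injective pairL := pair_injective

/-- The surface parallel to `u` at distance `t`, in `E³ × E³`. -/
noncomputable def slice (u N : E 2 → E 3) (t : ℝ) (y : E 2) : E 6 := pairL (u y, t • N y)

/-- The normal bundle in coordinates. -/
noncomputable def normalMap (u N : E 2 → E 3) (z : E 3) : E 6 :=
  pairL (u (base z), z 2 • N (base z))

variable {u N : E 2 → E 3} {U : Set (E 2)} {W : Type*} [NormedAddCommGroup W] [NormedSpace ℝ W]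

theorem IsNormalField.isOpen (h : IsNormalField u N U) : IsOpen U := h.immersionOn.isOpen

theorem IsNormalField.differentiableAt (h : IsNormalField u N U) {y : E 2} (hy : y ∈ U) :
    DifferentiableAt ℝ N y := differentiableAt_of_contDiffOn h.isOpen h.contDiffOn hy

theorem IsNormalField.contDiffOn_slice (h : IsNormalField u N U) (t : ℝ) :
    ContDiffOn ℝ ∞ (slice u N t) U :=
  pairL.contDiff.comp_contDiffOn (h.immersionOn.contDiffOn.prodMk (h.contDiffOn.const_smul t))

theorem pd_pairL {n : ℕ} {φ χ : E n → E 3} {y : E n} (hφ : DifferentiableAt ℝ φ y)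
    (hχ : DifferentiableAt ℝ χ y) (i : Fin n) :
    pd i (fun y => pairL (φ y, χ y)) y = pairL (pd i φ y, pd i χ y) := by
  rw [pd_clm (φ := fun y => (φ y, χ y)) i pairL (hφ.prodMk hχ), pd,
    (hφ.hasFDerivAt.prodMk hχ.hasFDerivAt).fderiv]
  rfl

theorem pd_parallel {φ χ : E 2 → E 3} {y : E 2} (hφ : DifferentiableAt ℝ φ y)
    (hχ : DifferentiableAt ℝ χ y) (t : ℝ) (i : Fin 2) :
    pd i (slice φ χ t) y = slice (pd i φ) (pd i χ) t y := by
  rw [slice, ← pd_const_smul i t hχ]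
  exact pd_pairL hφ (hχ.const_smul t) i

theorem pd_castSucc_normalMap {φ χ : E 2 → E 3} {z : E 3} (hφ : DifferentiableAt ℝ φ (base z))
    (hχ : DifferentiableAt ℝ χ (base z)) (i : Fin 2) :
    pd i.castSucc (normalMap φ χ) z = normalMap (pd i φ) (pd i χ) z := by
  rw [normalMap, ← pd_comp_base i hφ, ← pd_castSucc_smul_comp_base i hχ]
  exact pd_pairL (differentiableAt_comp_base hφ)
    ((differentiableAt_apply_two z).smul (differentiableAt_comp_base hχ)) _

theorem pd_two_normalMap {φ χ : E 2 → E 3} {z : E 3} (hφ : DifferentiableAt ℝ φ (base z))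
    (hχ : DifferentiableAt ℝ χ (base z)) :
    pd 2 (normalMap φ χ) z = pairL (0, χ (base z)) := by
  rw [← pd_two_comp_base hφ, ← pd_two_smul_comp_base hχ]
  exact pd_pairL (differentiableAt_comp_base hφ)
    ((differentiableAt_apply_two z).smul (differentiableAt_comp_base hχ)) _

theorem IsNormalField.differentiableAt_left (h : IsNormalField u N U) {y : E 2} (hy : y ∈ U) :
    DifferentiableAt ℝ u y := differentiableAt_of_contDiffOn h.isOpen h.immersionOn.contDiffOn hy

theorem IsNormalField.differentiableAt_pd (h : IsNormalField u N U) {y : E 2} (hy : y ∈ U)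
    (i : Fin 2) : DifferentiableAt ℝ (pd i N) y :=
  differentiableAt_of_contDiffOn h.isOpen (contDiffOn_pd h.isOpen h.contDiffOn i) hy

theorem IsNormalField.differentiableAt_pd_left (h : IsNormalField u N U) {y : E 2} (hy : y ∈ U)
    (i : Fin 2) : DifferentiableAt ℝ (pd i u) y :=
  differentiableAt_of_contDiffOn h.isOpen (h.immersionOn.contDiffOn_pd i) hy

theorem IsNormalField.pd_slice (h : IsNormalField u N U) (t : ℝ) {y : E 2} (hy : y ∈ U)
    (i : Fin 2) : pd i (slice u N t) y = pairL (pd i u y, t • pd i N y) :=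
  pd_parallel (h.differentiableAt_left hy) (h.differentiableAt hy) t i

theorem IsNormalField.pd_pd_slice (h : IsNormalField u N U) (t : ℝ) {y : E 2} (hy : y ∈ U)
    (i j : Fin 2) :
    pd i (pd j (slice u N t)) y = pairL (pd i (pd j u) y, t • pd i (pd j N) y) := by
  rw [pd_congr_at i (eventuallyEq_of_isOpen h.isOpen (fun z hz => h.pd_slice t hz j) hy)]
  exact pd_parallel (h.differentiableAt_pd_left hy j) (h.differentiableAt_pd hy j) t i

/-- The first component alone is an immersion, so the slice is one for every `t`, even where `u + t
N` is singular in `E³`. -/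
theorem IsNormalField.immersionOn_slice (h : IsNormalField u N U) (t : ℝ) :
    ImmersionOn (slice u N t) U := by
  refine ⟨h.isOpen, h.contDiffOn_slice t, fun y hy => ?_⟩
  rw [injective_iff_map_eq_zero]
  intro v hv
  have h1 : fderiv ℝ (slice u N t) y v = pairL (fderiv ℝ u y v, t • fderiv ℝ N y v) := by
    simp only [fderiv_eq_sum_pd, h.pd_slice t hy, Finset.smul_sum, ← map_smul, ← map_sum]
    congr 1
    ext1
    · simp
    · simp [smul_comm t]
  rw [h1] at hv
  have h2 := pairL_injective (hv.trans (map_zero pairL).symm)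
  exact (injective_iff_map_eq_zero _).1 (h.immersionOn.injective y hy) v (congrArg Prod.fst h2)

theorem IsNormalField.inner_pd_self (h : IsNormalField u N U) {y : E 2} (hy : y ∈ U) (i : Fin 2) :
    inner ℝ (pd i N y) (N y) = 0 := by
  have h1 := pd_congr_at i (eventuallyEq_of_isOpen h.isOpen h.inner_self hy)
  rw [pd_const, pd_inner i (h.differentiableAt hy) (h.differentiableAt hy),
    real_inner_comm (pd i N y)] at h1
  rw [real_inner_comm] at h1 ⊢
  linarith

theorem IsNormalField.pd_castSucc_normalMap (h : IsNormalField u N U) {z : E 3}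
    (hz : base z ∈ U) (i : Fin 2) :
    pd i.castSucc (normalMap u N) z = pd i (slice u N (z 2)) (base z) := by
  rw [h.pd_slice _ hz]
  exact Submanifold.pd_castSucc_normalMap (h.differentiableAt_left hz) (h.differentiableAt hz) i

theorem IsNormalField.pd_two_normalMap (h : IsNormalField u N U) {z : E 3} (hz : base z ∈ U) :
    pd 2 (normalMap u N) z = pairL (0, N (base z)) :=
  Submanifold.pd_two_normalMap (h.differentiableAt_left hz) (h.differentiableAt hz)

theorem IsNormalField.pd_pd_normalMap (h : IsNormalField u N U) {z : E 3}
    (hz : base z ∈ U) (i j : Fin 2) :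
    pd i.castSucc (pd j.castSucc (normalMap u N)) z =
      pd i (pd j (slice u N (z 2))) (base z) := by
  rw [h.pd_pd_slice _ hz, pd_congr_at _ (eventuallyEq_of_isOpen (isOpen_preimage_base h.isOpen)
    (fun w hw => (h.pd_castSucc_normalMap hw j).trans (h.pd_slice _ hw j)) hz)]
  exact Submanifold.pd_castSucc_normalMap (h.differentiableAt_pd_left hz j)
    (h.differentiableAt_pd hz j) i

theorem IsNormalField.pd_two_pd_two_normalMap (h : IsNormalField u N U) {z : E 3}
    (hz : base z ∈ U) : pd 2 (pd 2 (normalMap u N)) z = 0 := by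
  rw [pd_congr_at _ (eventuallyEq_of_isOpen (isOpen_preimage_base h.isOpen)
    (fun w hw => h.pd_two_normalMap hw) hz), pd_pairL (differentiableAt_const _)
    (differentiableAt_comp_base (h.differentiableAt hz)), pd_const,
    pd_two_comp_base (h.differentiableAt hz)]
  exact map_zero pairL

theorem IsNormalField.inner_pd_pd_self (h : IsNormalField u N U) {y : E 2} (hy : y ∈ U)
    (i j : Fin 2) : inner ℝ (pd i (pd j N) y) (N y) = -inner ℝ (pd i N y) (pd j N y) := by
  have h1 := pd_congr_at i (eventuallyEq_of_isOpen h.isOpen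
    (fun z hz => h.inner_pd_self hz j) hy)
  rw [pd_const, pd_inner i (h.differentiableAt_pd hy j) (h.differentiableAt hy),
    real_inner_comm (pd i N y)] at h1
  linarith

theorem IsNormalField.inner_pd_pd (h : IsNormalField u N U) {y : E 2} (hy : y ∈ U)
    (i j : Fin 2) : inner ℝ (pd i (pd j u) y) (N y) = -inner ℝ (pd j u y) (pd i N y) := by
  have h1 := pd_congr_at i (eventuallyEq_of_isOpen h.isOpen (fun z hz => h.inner_pd z hz j) hy)
  rw [pd_const, pd_inner i (h.differentiableAt_pd_left hy j) (h.differentiableAt hy)] at h1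
  linarith

/-- No term linear in `t` appears, unlike for parallel surfaces in `E³`, because the two components
lie in orthogonal factors of `E³ × E³`. -/
theorem IsNormalField.gram_slice (h : IsNormalField u N U) (t : ℝ) {y : E 2} (hy : y ∈ U)
    (i j : Fin 2) : gram (slice u N t) y i j = gram u y i j + t ^ 2 * gram N y i j := by
  simp only [gram_apply]
  rw [h.pd_slice t hy, h.pd_slice t hy, inner_pairL, real_inner_smul_left, real_inner_smul_right]
  ring

theorem IsNormalField.gram_normalMap (h : IsNormalField u N U) {z : E 3} (hz : base z ∈ U)
    (i j : Fin 2) :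
    gram (normalMap u N) z i.castSucc j.castSucc = gram (slice u N (z 2)) (base z) i j := by
  rw [gram_apply, h.pd_castSucc_normalMap hz, h.pd_castSucc_normalMap hz, gram_apply]

theorem IsNormalField.gram_normalMap_castSucc_two (h : IsNormalField u N U) {z : E 3}
    (hz : base z ∈ U) (i : Fin 2) : gram (normalMap u N) z i.castSucc 2 = 0 := by
  rw [gram_apply, h.pd_castSucc_normalMap hz, h.pd_two_normalMap hz, h.pd_slice _ hz, inner_pairL,
    real_inner_smul_left, h.inner_pd_self hz]
  simp

theorem IsNormalField.gram_normalMap_two_two (h : IsNormalField u N U) {z : E 3}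
    (hz : base z ∈ U) : gram (normalMap u N) z 2 2 = 1 := by
  rw [gram_apply, h.pd_two_normalMap hz, inner_pairL, h.inner_self _ hz]
  simp

theorem IsNormalField.contDiffOn_normalMap (h : IsNormalField u N U) :
    ContDiffOn ℝ ∞ (normalMap u N) (base ⁻¹' U) :=
  pairL.contDiff.comp_contDiffOn ((contDiffOn_comp_base h.immersionOn.contDiffOn).prodMk
    (contDiff_apply_two.contDiffOn.smul (contDiffOn_comp_base h.contDiffOn)))

theorem IsNormalField.immersionOn_normalMap (h : IsNormalField u N U) :
    ImmersionOn (normalMap u N) (base ⁻¹' U) := by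
  refine ⟨isOpen_preimage_base h.isOpen, h.contDiffOn_normalMap, fun z hz => ?_⟩
  rw [injective_iff_map_eq_zero]
  intro v hv
  have h1 : fderiv ℝ (normalMap u N) z v = pairL (fderiv ℝ u (base z) (base v),
      z 2 • fderiv ℝ N (base z) (base v) + v 2 • N (base z)) := by
    have hb : ∀ i : Fin 2, base v i = v i.castSucc := fun i => by fin_cases i <;> rfl
    rw [fderiv_eq_sum_pd, sum_fin_three, h.pd_two_normalMap hz]
    simp only [fderiv_eq_sum_pd, h.pd_castSucc_normalMap hz, h.pd_slice _ hz, ← map_smul,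
      ← map_sum, ← map_add, hb]
    congr 1
    ext1
    · simp
    · simp [smul_comm (z 2)]
  rw [h1] at hv
  have h2 := pairL_injective (hv.trans (map_zero pairL).symm)
  have h3 : base v = 0 :=
    (injective_iff_map_eq_zero _).1 (h.immersionOn.injective _ hz) _ (congrArg Prod.fst h2)
  have h4 : z 2 • fderiv ℝ N (base z) (base v) + v 2 • N (base z) = 0 := congrArg Prod.snd h2
  have h5 : N (base z) ≠ 0 := fun h0 => by
    have := h.inner_self _ hz
    rw [h0, inner_zero_left] at this
    exact zero_ne_one this
  rw [h3, map_zero, smul_zero, zero_add, smul_eq_zero, or_iff_left h5] at h4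
  rw [← lift_base v, h3, h4]
  ext i; fin_cases i <;> simp [lift]

/-- The inverse of the metric of the normal bundle. -/
theorem IsNormalField.gram_normalMap_inv (h : IsNormalField u N U) {z : E 3} (hz : base z ∈ U) :
    (∀ i j : Fin 2, (gram (normalMap u N) z)⁻¹ i.castSucc j.castSucc =
      (gram (slice u N (z 2)) (base z))⁻¹ i j) ∧
    (∀ i : Fin 2, (gram (normalMap u N) z)⁻¹ i.castSucc 2 = 0) ∧
    (∀ i : Fin 2, (gram (normalMap u N) z)⁻¹ 2 i.castSucc = 0) ∧
    (gram (normalMap u N) z)⁻¹ 2 2 = 1 := by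
  set G := gram (slice u N (z 2)) (base z) with hG
  -- The metric is block diagonal, so its inverse is assembled from `G⁻¹` and the entry `1`.
  obtain ⟨H, hH⟩ : ∃ H : Matrix (Fin 3) (Fin 3) ℝ, H = Matrix.of fun i j =>
      Fin.lastCases (Fin.lastCases 1 (fun _ => 0) j)
        (fun i' => Fin.lastCases 0 (fun j' => G⁻¹ i' j') j) i := ⟨_, rfl⟩
  have e1 : ∀ i j : Fin 2, H i.castSucc j.castSucc = G⁻¹ i j := fun i j => by simp [hH]
  have e2 : ∀ i : Fin 2, H i.castSucc 2 = 0 := fun i => by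
    rw [hH, Matrix.of_apply, Fin.lastCases_castSucc]; rfl
  have e3 : ∀ i : Fin 2, H 2 i.castSucc = 0 := fun i => by
    rw [hH, Matrix.of_apply, Fin.lastCases_castSucc]; rfl
  have e4 : H 2 2 = 1 := by
    rw [hH, Matrix.of_apply]; rfl
  have h2s : ∀ i : Fin 2, gram (normalMap u N) z 2 i.castSucc = 0 := fun i => by
    rw [← h.gram_normalMap_castSucc_two hz i, gram_apply, gram_apply, real_inner_comm]
  have hu : IsUnit G.det := (h.immersionOn_slice (z 2)).isUnit_det hz
  have hinv : (gram (normalMap u N) z)⁻¹ = H := by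
    refine Matrix.inv_eq_right_inv ?_
    ext i j
    rw [Matrix.mul_apply, sum_fin_three]
    induction i using Fin.lastCases with
    | last =>
      change (∑ k : Fin 2, gram (normalMap u N) z 2 k.castSucc * _) + gram (normalMap u N) z 2 2 * _ = _
      simp only [h2s, h.gram_normalMap_two_two hz, zero_mul, Finset.sum_const_zero, zero_add, one_mul]
      induction j using Fin.lastCases with
      | last => rw [Matrix.one_apply_eq]; exact e4
      | cast j => rw [e3, Matrix.one_apply_ne (Fin.castSucc_lt_last j).ne']
    | cast i =>
      simp only [h.gram_normalMap hz, h.gram_normalMap_castSucc_two hz, zero_mul, add_zero, ← hG]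
      induction j using Fin.lastCases with
      | last =>
        rw [Matrix.one_apply_ne (Fin.castSucc_lt_last i).ne]
        exact Finset.sum_eq_zero fun k _ => by
          rw [show H k.castSucc (Fin.last 2) = 0 from e2 k, mul_zero]
      | cast j =>
        simp only [e1]
        rw [← Matrix.mul_apply, Matrix.mul_nonsing_inv _ hu, Matrix.one_apply, Matrix.one_apply]
        simp
  rw [hinv]
  exact ⟨e1, e2, e3, e4⟩

/-- The Laplacian of the normal bundle in terms of the Laplacians of the parallel surfaces. -/
theorem IsNormalField.lap_normalMap (h : IsNormalField u N U) {φ : E 3 → W}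
    (hφ : ContDiffOn ℝ ∞ φ (base ⁻¹' U)) {t : ℝ} {y : E 2} (hy : y ∈ U) :
    lap (normalMap u N) φ (lift t y) = pd 2 (pd 2 φ) (lift t y) +
      lap (slice u N t) (fun y => φ (lift t y)) y +
      (t * ∑ i, ∑ j, (gram (slice u N t) y)⁻¹ i j * gram N y i j) • pd 2 φ (lift t y) := by
  have hV := isOpen_preimage_base h.isOpen
  have hz : base (lift t y) ∈ U := by rwa [base_lift]
  obtain ⟨e1, e2, e3, e4⟩ := h.gram_normalMap_inv hz
  -- The fibres are straight lines of `E⁶`. Mixed symbols are not needed, because the mixed entries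
  -- of the inverse metric vanish.
  have g2 : ∀ k, gamma (normalMap u N) k 2 2 (lift t y) = 0 := fun k => by
    simp [gamma, h.pd_two_pd_two_normalMap hz]
  have hp : ∀ w ∈ U, ∀ i : Fin 2, pd i.castSucc φ (lift t w) = pd i (fun y => φ (lift t y)) w :=
    fun w hw i => (pd_comp_lift t i (differentiableAt_of_contDiffOn hV hφ (y := lift t w)
      (by rwa [Set.mem_preimage, base_lift]))).symm
  have hpp : ∀ i j : Fin 2, pd i.castSucc (pd j.castSucc φ) (lift t y) =
      pd i (pd j fun y => φ (lift t y)) y := fun i j => by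
    rw [← pd_congr_at i (eventuallyEq_of_isOpen h.isOpen (fun w hw => hp w hw j) hy)]
    exact (pd_comp_lift t i (differentiableAt_of_contDiffOn hV
      (contDiffOn_pd hV hφ j.castSucc) hz)).symm
  have g1 : ∀ k i j : Fin 2, gamma (normalMap u N) k.castSucc i.castSucc j.castSucc (lift t y) =
      gamma (slice u N t) k i j y := fun k i j => by
    simp only [gamma, sum_fin_three, e1, e2, zero_mul, add_zero, h.pd_pd_normalMap hz,
      h.pd_castSucc_normalMap hz, base_lift, lift_two]
  -- Here `⟨∂ᵢ∂ⱼN, N⟩ = −⟨∂ᵢN, ∂ⱼN⟩` enters. The trace of these symbols is the coefficient of the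
  -- first-order term in `∂ₜ`.
  have g3 : ∀ i j : Fin 2, gamma (normalMap u N) 2 i.castSucc j.castSucc (lift t y) =
      -(t * gram N y i j) := fun i j => by
    simp only [gamma, sum_fin_three, e3, e4, zero_mul, Finset.sum_const_zero, zero_add, one_mul,
      h.pd_pd_normalMap hz, h.pd_two_normalMap hz, base_lift, lift_two]
    rw [h.pd_pd_slice t hy, inner_pairL, real_inner_smul_left, h.inner_pd_pd_self hy, inner_zero_right,
      gram_apply]
    ring
  simp only [lap, sum_fin_three, e1, e2, e3, e4, g1, g2, g3, hpp, hp y hy, zero_smul, add_zero,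
    Finset.sum_const_zero, sub_zero, one_smul, zero_add, base_lift, lift_two]
  rw [Finset.mul_sum, Finset.sum_smul, add_comm (pd 2 (pd 2 φ) (lift t y)), add_right_comm,
    ← Finset.sum_add_distrib]
  congr 1
  refine Finset.sum_congr rfl fun i _ => ?_
  rw [Finset.mul_sum, Finset.sum_smul, ← Finset.sum_add_distrib]
  refine Finset.sum_congr rfl fun j _ => ?_
  module

end NormalField

end Submanifold

namespace Submanifold

open Topology

/-! ### The Laplacian of the normal bundle -/

section Components

variable {u N : E 2 → E 3} {U : Set (E 2)} {W : Type*} [NormedAddCommGroup W] [NormedSpace ℝ W]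
  {V : Type*} [NormedAddCommGroup V] [InnerProductSpace ℝ V]

/-- The map `T : (v, r) ↦ du(v) + r N` is injective between spaces of dimension three, hence onto,
and `w − ⟨w, N⟩ N` is orthogonal to its whole image. -/
theorem IsNormalField.eq_smul (h : IsNormalField u N U) {y : E 2} (hy : y ∈ U) {w : E 3}
    (hw : ∀ i, inner ℝ (pd i u y) w = 0) : w = (inner ℝ w (N y) : ℝ) • N y := by
  have hN := h.inner_self y hy
  obtain ⟨T, hT⟩ : ∃ T : E 3 →ₗ[ℝ] E 3, ∀ v, T v = fderiv ℝ u y (base v) + v 2 • N y :=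
    ⟨((fderiv ℝ u y).comp baseL + (EuclideanSpace.proj (𝕜 := ℝ) (2 : Fin 3)).smulRight
      (N y)).toLinearMap, fun v => rfl⟩
  have hort : ∀ v, inner ℝ (fderiv ℝ u y v) w = 0 := fun v => by
    rw [fderiv_eq_sum_pd, sum_inner]
    exact Finset.sum_eq_zero fun i _ => by rw [real_inner_smul_left, hw, mul_zero]
  have hort' : ∀ v, inner ℝ (fderiv ℝ u y v) (N y) = 0 := fun v => by
    rw [fderiv_eq_sum_pd, sum_inner]
    exact Finset.sum_eq_zero fun i _ => by rw [real_inner_smul_left, h.inner_pd y hy, mul_zero]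
  have hinj : Function.Injective T := by
    rw [injective_iff_map_eq_zero]
    intro v hv
    rw [hT] at hv
    have h2 := congrArg (fun a => (inner ℝ a (N y) : ℝ)) hv
    simp only [inner_add_left, hort', real_inner_smul_left, hN, inner_zero_left, zero_add,
      mul_one] at h2
    rw [h2, zero_smul, add_zero] at hv
    have h3 := (injective_iff_map_eq_zero _).1 (h.immersionOn.injective y hy) _ hv
    rw [← lift_base v, h2, h3]
    ext i; fin_cases i <;> simp [lift]
  obtain ⟨v, hv⟩ := (LinearMap.injective_iff_surjective.1 hinj) (w - (inner ℝ w (N y) : ℝ) • N y)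
  have hx : inner ℝ (T v) (w - (inner ℝ w (N y) : ℝ) • N y) = (0 : ℝ) := by
    simp only [hT, inner_add_left, inner_sub_right, real_inner_smul_left, real_inner_smul_right,
      hort, hort', hN, real_inner_comm (N y) w]
    ring
  rwa [hv, inner_self_eq_zero, sub_eq_zero] at hx

/-- The trace of the second fundamental form of `u` with respect to the unit normal `N`. -/
noncomputable def traceForm (u N : E 2 → E 3) (y : E 2) : ℝ := inner ℝ (lap u u y) (N y)

theorem IsNormalField.lap_self (h : IsNormalField u N U) {y : E 2} (hy : y ∈ U) :
    lap u u y = traceForm u N y • N y :=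
  h.eq_smul hy fun i => by rw [real_inner_comm]; exact h.immersionOn.inner_lap_self hy i

/-- Parseval's identity in the orthonormal frame `∂₀u, ∂₁u, N`. -/
theorem IsNormalField.inner_eq (h : IsNormalField u N U) {y : E 2} (hy : y ∈ U)
    (hn : IsNormalAt u y) (w w' : E 3) :
    (inner ℝ w w' : ℝ) = ∑ i, inner ℝ w (pd i u y) * inner ℝ w' (pd i u y) +
      inner ℝ w (N y) * inner ℝ w' (N y) := by
  have hg : ∀ i j, inner ℝ (pd i u y) (pd j u y) = if i = j then (1 : ℝ) else 0 := fun i j => by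
    rw [← gram_apply, hn.gram_eq, Matrix.one_apply]
  have h1 := h.eq_smul hy (w := w - ∑ i, (inner ℝ w (pd i u y) : ℝ) • pd i u y) fun j => by
    rw [inner_sub_right, inner_sum]
    simp [real_inner_smul_right, hg, real_inner_comm w]
  have h2 : w = ∑ i, (inner ℝ w (pd i u y) : ℝ) • pd i u y + (inner ℝ w (N y) : ℝ) • N y := by
    have h3 : (inner ℝ (w - ∑ i, (inner ℝ w (pd i u y) : ℝ) • pd i u y) (N y) : ℝ) =
        inner ℝ w (N y) := by
      rw [inner_sub_left, sum_inner]
      simp [real_inner_smul_left, h.inner_pd y hy]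
    rw [h3] at h1
    rw [← h1]; abel
  refine (congrArg (fun a => (inner ℝ a w' : ℝ)) h2).trans ?_
  simp only [inner_add_left, sum_inner, real_inner_smul_left, real_inner_comm _ w']

theorem differentiableAt_of_contDiffOn_preimage {φ : E 3 → W} (hU : IsOpen U)
    (hφ : ContDiffOn ℝ ∞ φ (base ⁻¹' U)) {z : E 3} (hz : base z ∈ U) : DifferentiableAt ℝ φ z :=
  differentiableAt_of_contDiffOn (isOpen_preimage_base hU) hφ hz

theorem pd_two_inner_comp_base (hU : IsOpen U) {φ : E 3 → V} {χ : E 2 → V}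
    (hφ : ContDiffOn ℝ ∞ φ (base ⁻¹' U)) (hχ : ContDiffOn ℝ ∞ χ U) {z : E 3} (hz : base z ∈ U) :
    pd 2 (fun z => (inner ℝ (φ z) (χ (base z)) : ℝ)) z = inner ℝ (pd 2 φ z) (χ (base z)) := by
  have hd := differentiableAt_of_contDiffOn hU hχ hz
  rw [pd_inner (ψ := fun z => χ (base z)) 2 (differentiableAt_of_contDiffOn_preimage hU hφ hz)
    (differentiableAt_comp_base hd), pd_two_comp_base hd, inner_zero_right, add_zero]

theorem pd_two_pd_two_inner_comp_base (hU : IsOpen U) {φ : E 3 → V} {χ : E 2 → V}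
    (hφ : ContDiffOn ℝ ∞ φ (base ⁻¹' U)) (hχ : ContDiffOn ℝ ∞ χ U) {z : E 3} (hz : base z ∈ U) :
    pd 2 (pd 2 fun z => (inner ℝ (φ z) (χ (base z)) : ℝ)) z =
      inner ℝ (pd 2 (pd 2 φ) z) (χ (base z)) := by
  rw [pd_congr_at 2 (eventuallyEq_of_isOpen (isOpen_preimage_base hU)
    (fun w hw => pd_two_inner_comp_base hU hφ hχ hw) hz)]
  exact pd_two_inner_comp_base hU (contDiffOn_pd (isOpen_preimage_base hU) hφ 2) hχ hz

/-- The second derivative at `t = 0` of `α + t² q`. -/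
theorem pd_two_pd_two_of_eq_add (hU : IsOpen U) {φ q : E 3 → ℝ} {α : E 2 → ℝ}
    (hα : ContDiffOn ℝ ∞ α U) (hq : ContDiffOn ℝ ∞ q (base ⁻¹' U))
    (h : ∀ z, base z ∈ U → φ z = α (base z) + z 2 ^ 2 * q z) {y : E 2} (hy : y ∈ U) :
    pd 2 (pd 2 φ) (lift 0 y) = 2 * q (lift 0 y) := by
  have hV := isOpen_preimage_base hU
  have hz : base (lift 0 y) ∈ U := by rwa [base_lift]
  have hsq : ∀ z : E 3, DifferentiableAt ℝ (fun z : E 3 => z 2 ^ 2) z :=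
    fun z => (differentiableAt_apply_two z).pow 2
  have dsq : ∀ z : E 3, pd 2 (fun z : E 3 => z 2 ^ 2) z = 2 * z 2 := fun z => by
    simp only [pow_two]
    rw [pd_mul (φ := fun z : E 3 => z 2) 2 (differentiableAt_apply_two z)
      (differentiableAt_apply_two z), pd_two_apply_two]
    ring
  have h1 : ∀ z ∈ base ⁻¹' U, pd 2 φ z = z 2 ^ 2 * pd 2 q z + z 2 * (2 * q z) := fun z hw => by
    have hqd := differentiableAt_of_contDiffOn hV hq hw
    have hαd := differentiableAt_of_contDiffOn hU hα hw
    rw [pd_congr_at 2 (eventuallyEq_of_isOpen hV h hw),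
      pd_add (φ := fun z => α (base z)) (ψ := fun z => z 2 ^ 2 * q z) 2
      (differentiableAt_comp_base hαd) ((hsq z).mul hqd), pd_two_comp_base hαd,
      pd_mul (c := fun z : E 3 => z 2 ^ 2) 2 (hsq z) hqd, dsq]
    ring
  have hqd := differentiableAt_of_contDiffOn hV hq hz
  have hqd' := differentiableAt_of_contDiffOn hV (contDiffOn_pd hV hq 2) hz
  rw [pd_congr_at 2 (eventuallyEq_of_isOpen hV h1 hz),
    pd_add (φ := fun z => z 2 ^ 2 * pd 2 q z) (ψ := fun z => z 2 * (2 * q z)) 2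
      ((hsq _).mul hqd') ((differentiableAt_apply_two _).mul (hqd.const_mul 2)),
    pd_mul (c := fun z : E 3 => z 2 ^ 2) 2 (hsq _) hqd', dsq,
    pd_mul (c := fun z : E 3 => z 2) 2 (differentiableAt_apply_two _) (hqd.const_mul 2),
    pd_two_apply_two, lift_two]
  ring

/-- The first component of the Laplacian of the normal bundle. -/
noncomputable def lapPoint (u N : E 2 → E 3) (z : E 3) : E 3 :=
  lap (normalMap u N) (fun z => u (base z)) z

/-- The Laplacian of the unit normal field on the normal bundle. -/
noncomputable def lapNormal (u N : E 2 → E 3) (z : E 3) : E 3 :=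
  lap (normalMap u N) (fun z => N (base z)) z

/-- The component of `lapNormal` orthogonal to the unit normal field. -/
noncomputable def lapTangent (u N : E 2 → E 3) (z : E 3) : E 3 :=
  lapNormal u N z - (inner ℝ (lapNormal u N z) (N (base z)) : ℝ) • N (base z)

theorem IsNormalField.contDiffOn_lapPoint (h : IsNormalField u N U) :
    ContDiffOn ℝ ∞ (lapPoint u N) (base ⁻¹' U) :=
  h.immersionOn_normalMap.contDiffOn_lap (contDiffOn_comp_base h.immersionOn.contDiffOn)

theorem IsNormalField.contDiffOn_lapNormal (h : IsNormalField u N U) :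
    ContDiffOn ℝ ∞ (lapNormal u N) (base ⁻¹' U) :=
  h.immersionOn_normalMap.contDiffOn_lap (contDiffOn_comp_base h.contDiffOn)

theorem IsNormalField.contDiffOn_lapTangent (h : IsNormalField u N U) :
    ContDiffOn ℝ ∞ (lapTangent u N) (base ⁻¹' U) :=
  h.contDiffOn_lapNormal.sub ((h.contDiffOn_lapNormal.inner ℝ (contDiffOn_comp_base
    h.contDiffOn)).smul (contDiffOn_comp_base h.contDiffOn))

theorem IsNormalField.inner_lapTangent (h : IsNormalField u N U) {z : E 3} (hz : base z ∈ U) :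
    inner ℝ (lapTangent u N z) (N (base z)) = 0 := by
  rw [lapTangent, inner_sub_left, real_inner_smul_left, h.inner_self _ hz, mul_one, sub_self]

/-- A function constant along the fibres has no `t`-derivatives, so only the Laplacian of the slice
survives. -/
theorem IsNormalField.lap_normalMap_comp_base (h : IsNormalField u N U) {χ : E 2 → W}
    (hχ : ContDiffOn ℝ ∞ χ U) {t : ℝ} {y : E 2} (hy : y ∈ U) :
    lap (normalMap u N) (fun z => χ (base z)) (lift t y) = lap (slice u N t) χ y := by
  have h1 : ∀ z ∈ base ⁻¹' U, pd 2 (fun z => χ (base z)) z = 0 := fun z hz =>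
    pd_two_comp_base (differentiableAt_of_contDiffOn h.isOpen hχ hz)
  have hz : lift t y ∈ base ⁻¹' U := by rwa [Set.mem_preimage, base_lift]
  rw [h.lap_normalMap (contDiffOn_comp_base hχ) hy, h1 _ hz,
    pd_congr_at 2 (eventuallyEq_of_isOpen (isOpen_preimage_base h.isOpen) h1 hz), pd_const]
  simp [base_lift]

theorem IsNormalField.lapPoint_lift (h : IsNormalField u N U) (t : ℝ) {y : E 2} (hy : y ∈ U) :
    lapPoint u N (lift t y) = lap (slice u N t) u y :=
  h.lap_normalMap_comp_base h.immersionOn.contDiffOn hy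

theorem IsNormalField.lapNormal_lift (h : IsNormalField u N U) (t : ℝ) {y : E 2} (hy : y ∈ U) :
    lapNormal u N (lift t y) = lap (slice u N t) N y :=
  h.lap_normalMap_comp_base h.contDiffOn hy

/-- Differentiate `|N| = 1` twice; the Christoffel terms drop because `∂ₖN ⊥ N`. The metric is that
of an arbitrary `f`, so that this applies to every slice. -/
theorem IsNormalField.inner_lap_normal (h : IsNormalField u N U) {f : E 2 → V} {y : E 2}
    (hy : y ∈ U) :
    inner ℝ (lap f N y) (N y) = -∑ i, ∑ j, (gram f y)⁻¹ i j * gram N y i j := by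
  rw [lap, sum_inner, ← Finset.sum_neg_distrib]
  refine Finset.sum_congr rfl fun i _ => ?_
  rw [sum_inner, ← Finset.sum_neg_distrib]
  refine Finset.sum_congr rfl fun j _ => ?_
  rw [real_inner_smul_left, inner_sub_left, h.inner_pd_pd_self hy, sum_inner, gram_apply,
    Finset.sum_eq_zero fun k _ => by rw [real_inner_smul_left, h.inner_pd_self hy, mul_zero]]
  ring

theorem lap_pairL {m : ℕ} {f : E m → V} {S : Set (E m)} {φ χ : E m → E 3} (hS : IsOpen S)
    (hφ : ContDiffOn ℝ ∞ φ S) (hχ : ContDiffOn ℝ ∞ χ S) {z : E m} (hz : z ∈ S) :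
    lap f (fun z => pairL (φ z, χ z)) z = pairL (lap f φ z, lap f χ z) := by
  have hsum : (fun z => pairL (φ z, χ z)) = fun z =>
      pairL.comp (ContinuousLinearMap.inl ℝ _ _) (φ z) +
        pairL.comp (ContinuousLinearMap.inr ℝ _ _) (χ z) := by
    funext z
    change _ = pairL (φ z, 0) + pairL (0, χ z)
    rw [← map_add]
    simp
  rw [hsum, lap_add (φ := fun z => pairL.comp (ContinuousLinearMap.inl ℝ _ _) (φ z))
    (ψ := fun z => pairL.comp (ContinuousLinearMap.inr ℝ _ _) (χ z))
    hS ((ContinuousLinearMap.contDiff _).comp_contDiffOn hφ)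
    ((ContinuousLinearMap.contDiff _).comp_contDiffOn hχ) hz, lap_clm _ hS hφ hz,
    lap_clm _ hS hχ hz]
  change pairL (lap f φ z, 0) + pairL (0, lap f χ z) = _
  rw [← map_add]
  simp

/-- The components of the Laplacian of the normal bundle. -/
theorem IsNormalField.lap_normalMap_self (h : IsNormalField u N U) {z : E 3} (hz : base z ∈ U) :
    lap (normalMap u N) (normalMap u N) z = pairL (lapPoint u N z, z 2 • lapTangent u N z) := by
  have hV := isOpen_preimage_base h.isOpen
  have hu := contDiffOn_comp_base h.immersionOn.contDiffOn
  have hN := contDiffOn_comp_base h.contDiffOn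
  have h2 : ContDiffOn ℝ ∞ (fun z : E 3 => z 2) (base ⁻¹' U) := contDiff_apply_two.contDiffOn
  -- `Δt` is `t` times the trace of `III`, written through the normal component of `ΔN`: in `Δ(t N)`
  -- it removes exactly that component.
  have hz2 : lap (normalMap u N) (fun z : E 3 => z 2) z =
      -(z 2 * inner ℝ (lapNormal u N z) (N (base z))) := by
    have e1 := h.lap_normalMap h2 (t := z 2) hz
    have e2 := h.lapNormal_lift (z 2) hz
    rw [lift_base] at e1 e2
    have e3 : pd 2 (pd 2 fun z : E 3 => z 2) z = 0 := by
      rw [show pd 2 (fun z : E 3 => z 2) = fun _ => (1 : ℝ) from funext pd_two_apply_two, pd_const]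
    have e4 : lap (slice u N (z 2)) (fun y => lift (z 2) y 2) (base z) = 0 := by
      simp only [lift_two]
      simp [lap, show ∀ j : Fin 2, pd j (fun _ : E 2 => z 2) = fun _ => 0 from
        fun j => funext fun w => pd_const _ _ _]
    rw [e1, e2, e3, e4, pd_two_apply_two, h.inner_lap_normal hz, zero_add,
      zero_add, smul_eq_mul]
    ring
  obtain ⟨-, e2, -, -⟩ := h.gram_normalMap_inv hz
  have hB : lap (normalMap u N) (fun z => z 2 • N (base z)) z = z 2 • lapTangent u N z := by
    rw [lap_smul (φ := fun z => N (base z)) hV h2 hN hz, hz2]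
    -- The gradient of `t` is `∂ₜ`, along which `N` is constant.
    have hcross : ∑ i, ∑ j, ((gram (normalMap u N) z)⁻¹ i j * pd i (fun z : E 3 => z 2) z) •
        pd j (fun z => N (base z)) z = 0 := by
      refine Finset.sum_eq_zero fun i _ => Finset.sum_eq_zero fun j _ => ?_
      induction i using Fin.lastCases with
      | cast i => rw [pd_castSucc_apply_two, mul_zero, zero_smul]
      | last =>
        induction j using Fin.lastCases with
        | last =>
          rw [show Fin.last 2 = (2 : Fin 3) from rfl, pd_two_comp_base (h.differentiableAt hz),
            smul_zero]
        | cast j => rw [gram_inv_symm, show Fin.last 2 = (2 : Fin 3) from rfl, e2, zero_mul,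
            zero_smul]
    rw [hcross, lapTangent, lapNormal]
    module
  rw [← hB]
  exact lap_pairL hV hu (h2.smul hN) hz

/-- At `t = 0` the slice is `u` placed in the first factor, with the same metric and Christoffel
symbols. -/
theorem IsNormalField.lap_slice_zero (h : IsNormalField u N U) {y : E 2} (hy : y ∈ U)
    (φ : E 2 → W) : lap (slice u N 0) φ y = lap u φ y := by
  have hg : gram (slice u N 0) y = gram u y := by
    ext i j
    rw [h.gram_slice 0 hy]
    ring
  have hG : ∀ k i j, gamma (slice u N 0) k i j y = gamma u k i j y := fun k i j => by
    simp only [gamma, hg, h.pd_pd_slice 0 hy, h.pd_slice 0 hy, inner_pairL, zero_smul,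
      inner_zero_left, add_zero]
  simp only [lap, hg, hG]

theorem IsNormalField.lap_normalMap_lift_zero (h : IsNormalField u N U) {φ : E 3 → W}
    (hφ : ContDiffOn ℝ ∞ φ (base ⁻¹' U)) {y : E 2} (hy : y ∈ U) :
    lap (normalMap u N) φ (lift 0 y) =
      pd 2 (pd 2 φ) (lift 0 y) + lap u (fun y => φ (lift 0 y)) y := by
  rw [h.lap_normalMap hφ hy, h.lap_slice_zero hy, zero_mul, zero_smul, add_zero]

/-- The normal bundle is biharmonic in coordinates. -/
def IsBiharmonicOn (u N : E 2 → E 3) (U : Set (E 2)) : Prop :=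
  ∀ z, base z ∈ U → lap (normalMap u N) (lap (normalMap u N) (normalMap u N)) z = 0

theorem IsNormalField.lap_lap_eq (h : IsNormalField u N U) {z : E 3} (hz : base z ∈ U) :
    lap (normalMap u N) (lap (normalMap u N) (normalMap u N)) z =
      pairL (lap (normalMap u N) (lapPoint u N) z,
        lap (normalMap u N) (fun z => z 2 • lapTangent u N z) z) := by
  have hV := isOpen_preimage_base h.isOpen
  rw [lap_congr (eventuallyEq_of_isOpen hV (fun w hw => h.lap_normalMap_self hw) hz)]
  exact lap_pairL hV h.contDiffOn_lapPoint
    (contDiff_apply_two.contDiffOn.smul h.contDiffOn_lapTangent) hz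

theorem IsNormalField.lap_lapPoint_eq_zero (h : IsNormalField u N U) (hb : IsBiharmonicOn u N U)
    {z : E 3} (hz : base z ∈ U) : lap (normalMap u N) (lapPoint u N) z = 0 := by
  have h1 := hb z hz
  rw [h.lap_lap_eq hz] at h1
  exact congrArg Prod.fst (pairL_injective (h1.trans (map_zero pairL).symm))

theorem IsNormalField.lap_smul_lapTangent_eq_zero (h : IsNormalField u N U)
    (hb : IsBiharmonicOn u N U) {z : E 3} (hz : base z ∈ U) :
    lap (normalMap u N) (fun z => z 2 • lapTangent u N z) z = 0 := by
  have h1 := hb z hz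
  rw [h.lap_lap_eq hz] at h1
  exact congrArg Prod.snd (pairL_injective (h1.trans (map_zero pairL).symm))

end Components

end Submanifold

namespace Submanifold

open Topology

/-! ### The equations of a biharmonic normal bundle along the zero section -/

section Equations

variable {u N : E 2 → E 3} {U : Set (E 2)}

theorem base_lift_mem {y : E 2} (hy : y ∈ U) (t : ℝ) : base (lift t y) ∈ U := by rwa [base_lift]

theorem IsNormalField.contDiffOn_traceForm (h : IsNormalField u N U) :
    ContDiffOn ℝ ∞ (traceForm u N) U :=
  (h.immersionOn.contDiffOn_lap h.immersionOn.contDiffOn).inner ℝ h.contDiffOn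

theorem IsNormalField.lapPoint_lift_zero (h : IsNormalField u N U) {y : E 2} (hy : y ∈ U) :
    lapPoint u N (lift 0 y) = lap u u y := by
  rw [h.lapPoint_lift 0 hy, h.lap_slice_zero hy]

theorem IsNormalField.lapNormal_lift_zero (h : IsNormalField u N U) {y : E 2} (hy : y ∈ U) :
    lapNormal u N (lift 0 y) = lap u N y := by
  rw [h.lapNormal_lift 0 hy, h.lap_slice_zero hy]

/-- The Laplacian `(P, t ΔN)` of the slice is orthogonal to its tangent vectors `(∂ₘu, t ∂ₘN)`. Thus
the tangential part of `P` is of second order in `t`. -/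
theorem IsNormalField.inner_lapPoint_pd (h : IsNormalField u N U) {z : E 3} (hz : base z ∈ U)
    (m : Fin 2) : inner ℝ (lapPoint u N z) (pd m u (base z)) =
      z 2 ^ 2 * -inner ℝ (lapNormal u N z) (pd m N (base z)) := by
  have h1 := (h.immersionOn_slice (z 2)).inner_lap_self hz m
  have e1 := h.lapPoint_lift (z 2) hz
  have e2 := h.lapNormal_lift (z 2) hz
  rw [lift_base] at e1 e2
  have e3 : lap (slice u N (z 2)) (slice u N (z 2)) (base z) =
      pairL (lapPoint u N z, z 2 • lapNormal u N z) := by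
    rw [e1, e2, ← lap_const_smul (z 2) h.isOpen h.contDiffOn hz]
    exact lap_pairL h.isOpen h.immersionOn.contDiffOn (h.contDiffOn.const_smul (z 2)) hz
  rw [e3, h.pd_slice _ hz, inner_pairL, real_inner_smul_left, real_inner_smul_right] at h1
  linarith

theorem IsNormalField.inner_lap_left (h : IsNormalField u N U) {V : Type*} [NormedAddCommGroup V]
    [InnerProductSpace ℝ V] {f : E 2 → V} {y : E 2} (hy : y ∈ U) :
    inner ℝ (lap f u y) (N y) = ∑ i, ∑ j, (gram f y)⁻¹ i j * inner ℝ (pd i (pd j u) y) (N y) := by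
  rw [lap, sum_inner]
  refine Finset.sum_congr rfl fun i _ => ?_
  rw [sum_inner]
  refine Finset.sum_congr rfl fun j _ => ?_
  rw [real_inner_smul_left, inner_sub_left, sum_inner,
    Finset.sum_eq_zero fun k _ => by rw [real_inner_smul_left, h.inner_pd y hy, mul_zero], sub_zero]

/-- The exact identity `G⁻¹ = g⁻¹ − t² g⁻¹ III G⁻¹` takes the place of a Taylor expansion; the
result has the shape required by `pd_two_pd_two_of_eq_add`. -/
theorem IsNormalField.inner_lapPoint_normal (h : IsNormalField u N U) {z : E 3}
    (hz : base z ∈ U) : inner ℝ (lapPoint u N z) (N (base z)) = traceForm u N (base z) +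
      z 2 ^ 2 * -∑ i, ∑ j, ∑ a, ∑ b, (gram u (base z))⁻¹ i a * gram N (base z) a b *
        (gram (normalMap u N) z)⁻¹ b.castSucc j.castSucc *
          inner ℝ (pd i (pd j u) (base z)) (N (base z)) := by
  obtain ⟨e1, -⟩ := h.gram_normalMap_inv hz
  have e := h.lapPoint_lift (z 2) hz
  rw [lift_base] at e
  set G := gram (slice u N (z 2)) (base z) with hG
  have hGu : IsUnit G.det := (h.immersionOn_slice (z 2)).isUnit_det hz
  have hIu := h.immersionOn.isUnit_det hz
  have hGI : G = gram u (base z) + z 2 ^ 2 • gram N (base z) := by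
    ext i j
    simp [hG, h.gram_slice _ hz]
  have key : G⁻¹ = (gram u (base z))⁻¹ -
      z 2 ^ 2 • ((gram u (base z))⁻¹ * gram N (base z) * G⁻¹) := by
    have h2 : (gram u (base z))⁻¹ * G * G⁻¹ = G⁻¹ + z 2 ^ 2 •
        ((gram u (base z))⁻¹ * gram N (base z) * G⁻¹) := by
      conv_lhs => enter [1, 2]; rw [hGI]
      rw [mul_add, add_mul, Matrix.nonsing_inv_mul _ hIu, one_mul, Matrix.mul_smul, Matrix.smul_mul]
    rw [Matrix.mul_assoc, Matrix.mul_nonsing_inv _ hGu, mul_one] at h2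
    exact eq_sub_of_add_eq h2.symm
  have key' : ∀ i j, G⁻¹ i j = (gram u (base z))⁻¹ i j - z 2 ^ 2 * ∑ a, ∑ b,
      (gram u (base z))⁻¹ i a * gram N (base z) a b * G⁻¹ b j := fun i j => by
    conv_lhs => rw [key]
    rw [Matrix.sub_apply, Matrix.smul_apply, smul_eq_mul, Matrix.mul_assoc, Matrix.mul_apply]
    simp only [Matrix.mul_apply, Finset.mul_sum, mul_assoc]
  rw [e, h.inner_lap_left hz, ← hG, traceForm, h.inner_lap_left hz]
  simp only [e1]
  rw [mul_neg, ← sub_eq_add_neg, Finset.mul_sum, ← Finset.sum_sub_distrib]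
  refine Finset.sum_congr rfl fun i _ => ?_
  rw [Finset.mul_sum, ← Finset.sum_sub_distrib]
  refine Finset.sum_congr rfl fun j _ => ?_
  rw [key']
  simp only [← Finset.sum_mul]
  ring

/-- The equation `ΔP = 0` on the zero section, where `P` restricts to `Δu` and the first-order term
in `∂ₜ` vanishes. -/
theorem IsNormalField.lap_lap_eq_neg (h : IsNormalField u N U) (hb : IsBiharmonicOn u N U)
    {y : E 2} (hy : y ∈ U) :
    lap u (lap u u) y = -pd 2 (pd 2 (lapPoint u N)) (lift 0 y) := by
  have h1 := h.lap_lapPoint_eq_zero hb (base_lift_mem hy 0)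
  rw [h.lap_normalMap_lift_zero h.contDiffOn_lapPoint hy, lap_congr (eventuallyEq_of_isOpen
    h.isOpen (fun w hw => h.lapPoint_lift_zero hw) hy)] at h1
  exact (neg_eq_of_add_eq_zero_right h1).symm

/-- The coefficient of `t²` in `IsNormalField.inner_lapPoint_pd` gives half the second
`t`-derivative of the tangential part of `P`; its sign cancels that of
`IsNormalField.lap_lap_eq_neg`. -/
theorem IsNormalField.inner_lap_lap_pd (h : IsNormalField u N U) (hb : IsBiharmonicOn u N U)
    {y : E 2} (hy : y ∈ U) (m : Fin 2) :
    inner ℝ (lap u (lap u u) y) (pd m u y) = 2 * inner ℝ (lap u N y) (pd m N y) := by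
  have h1 := pd_two_pd_two_inner_comp_base h.isOpen h.contDiffOn_lapPoint
    (h.immersionOn.contDiffOn_pd m) (base_lift_mem hy 0)
  rw [pd_two_pd_two_of_eq_add (α := fun _ => 0) h.isOpen contDiffOn_const
    ((h.contDiffOn_lapNormal.inner ℝ (contDiffOn_comp_base
      (contDiffOn_pd h.isOpen h.contDiffOn m))).neg)
    (fun z hz => by rw [zero_add]; exact h.inner_lapPoint_pd hz m) hy] at h1
  rw [h.lap_lap_eq_neg hb hy, inner_neg_left]
  simp only [base_lift, h.lapNormal_lift_zero hy] at h1
  linarith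

/-- The same argument with `IsNormalField.inner_lapPoint_normal`. The fourfold sum is the invariant
form of `tr A³`. -/
theorem IsNormalField.inner_lap_lap_normal (h : IsNormalField u N U) (hb : IsBiharmonicOn u N U)
    {y : E 2} (hy : y ∈ U) :
    inner ℝ (lap u (lap u u) y) (N y) = 2 * ∑ i, ∑ j, ∑ a, ∑ b, (gram u y)⁻¹ i a * gram N y a b *
      (gram u y)⁻¹ b j * inner ℝ (pd i (pd j u) y) (N y) := by
  have h1 := pd_two_pd_two_inner_comp_base h.isOpen h.contDiffOn_lapPoint h.contDiffOn
    (base_lift_mem hy 0)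
  have hg : ∀ i j, (gram (normalMap u N) (lift 0 y))⁻¹ i.castSucc j.castSucc =
      (gram u y)⁻¹ i j := fun i j => by
    have hG : gram (slice u N 0) y = gram u y := by
      ext i j
      rw [h.gram_slice 0 hy]
      ring
    rw [(h.gram_normalMap_inv (base_lift_mem hy 0)).1, base_lift, lift_two, hG]
  have hu := fun i => h.immersionOn.contDiffOn_pd i
  have hN := fun i => contDiffOn_pd h.isOpen h.contDiffOn i
  rw [pd_two_pd_two_of_eq_add h.isOpen h.contDiffOn_traceForm (ContDiffOn.neg
    (ContDiffOn.sum fun i _ => ContDiffOn.sum fun j _ => ContDiffOn.sum fun a _ =>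
      ContDiffOn.sum fun b _ => (((contDiffOn_comp_base
        (h.immersionOn.contDiffOn_gram_inv i a)).mul (contDiffOn_comp_base
        ((hN a).inner ℝ (hN b)))).mul
        (h.immersionOn_normalMap.contDiffOn_gram_inv b.castSucc j.castSucc)).mul
        (contDiffOn_comp_base ((contDiffOn_pd h.isOpen (hu j) i).inner ℝ h.contDiffOn))))
    (fun z hz => h.inner_lapPoint_normal hz) hy] at h1
  rw [h.lap_lap_eq_neg hb hy, inner_neg_left]
  simp only [base_lift, hg] at h1
  simp only [gram_apply] at h1 ⊢
  linarith

/-- The normal component of `Δ(t T) = 0`. As `N` does not depend on `t`, the `t`-derivatives of `T`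
are orthogonal to `N` like `T` itself, and what remains is `t ⟨ΔT, N⟩ = 0`. Differentiating at `t =
0` divides by `t`. -/
theorem IsNormalField.inner_lap_lapTangent (h : IsNormalField u N U) (hb : IsBiharmonicOn u N U)
    {y : E 2} (hy : y ∈ U) :
    inner ℝ (lap u (fun y => lapTangent u N (lift 0 y)) y) (N y) = 0 := by
  have hV := isOpen_preimage_base h.isOpen
  have h2 : ContDiffOn ℝ ∞ (fun z : E 3 => z 2) (base ⁻¹' U) := contDiff_apply_two.contDiffOn
  have hc := h.contDiffOn_lapTangent
  have ht : ∀ z, base z ∈ U → inner ℝ (pd 2 (lapTangent u N) z) (N (base z)) = 0 := fun z hz => by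
    rw [← pd_two_inner_comp_base h.isOpen hc h.contDiffOn hz,
      pd_congr_at 2 (eventuallyEq_of_isOpen hV (fun w hw => h.inner_lapTangent hw) hz), pd_const]
  have htt : ∀ z, base z ∈ U → inner ℝ (pd 2 (pd 2 (lapTangent u N)) z) (N (base z)) = 0 :=
    fun z hz => by
      rw [← pd_two_inner_comp_base h.isOpen (contDiffOn_pd hV hc 2) h.contDiffOn hz,
        pd_congr_at 2 (eventuallyEq_of_isOpen hV ht hz), pd_const]
  have hlap := h.immersionOn_normalMap.contDiffOn_lap hc
  have h0 : ∀ z ∈ base ⁻¹' U,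
      z 2 * inner ℝ (lap (normalMap u N) (lapTangent u N) z) (N (base z)) = 0 := fun z hz => by
    obtain ⟨-, e2, -, -⟩ := h.gram_normalMap_inv hz
    have h3 := h.lap_smul_lapTangent_eq_zero hb hz
    rw [lap_smul hV h2 hc hz] at h3
    have h4 := congrArg (fun a => (inner ℝ a (N (base z)) : ℝ)) h3
    have hcross : inner ℝ (∑ i, ∑ j, ((gram (normalMap u N) z)⁻¹ i j *
        pd i (fun z : E 3 => z 2) z) • pd j (lapTangent u N) z) (N (base z)) = (0 : ℝ) := by
      rw [sum_inner]
      refine Finset.sum_eq_zero fun i _ => ?_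
      rw [sum_inner]
      refine Finset.sum_eq_zero fun j _ => ?_
      rw [real_inner_smul_left]
      induction i using Fin.lastCases with
      | cast i => rw [pd_castSucc_apply_two, mul_zero, zero_mul]
      | last =>
        induction j using Fin.lastCases with
        | last => rw [show Fin.last 2 = (2 : Fin 3) from rfl, ht z hz, mul_zero]
        | cast j => rw [gram_inv_symm, show Fin.last 2 = (2 : Fin 3) from rfl, e2, zero_mul,
            zero_mul]
    simpa only [inner_add_left, real_inner_smul_left, hcross, h.inner_lapTangent hz, mul_zero,
      add_zero, inner_zero_left] using h4
  have hz := base_lift_mem hy 0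
  have h5 := pd_congr_at 2 (eventuallyEq_of_isOpen hV h0 hz)
  rw [pd_const, pd_mul (c := fun z : E 3 => z 2) 2 (differentiableAt_apply_two _)
    (differentiableAt_of_contDiffOn hV (hlap.inner ℝ (contDiffOn_comp_base h.contDiffOn)) hz),
    pd_two_apply_two, lift_two, zero_mul, zero_add, one_mul, h.lap_normalMap_lift_zero hc hy,
    inner_add_left, htt _ hz, zero_add, base_lift] at h5
  exact h5

end Equations

end Submanifold

namespace Submanifold

open Topology

/-! ### Surfaces at the origin of normal coordinates -/

section NormalPoint

variable {u N : E 2 → E 3} {U : Set (E 2)} {y : E 2}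

/-- The coefficients of the second fundamental form of `u` with respect to the unit normal `N`. -/
noncomputable def secondForm (u N : E 2 → E 3) (y : E 2) (i j : Fin 2) : ℝ :=
  inner ℝ (pd i (pd j u) y) (N y)

theorem IsNormalField.secondForm_symm (h : IsNormalField u N U) (hy : y ∈ U) (i j : Fin 2) :
    secondForm u N y i j = secondForm u N y j i := by
  rw [secondForm, h.immersionOn.pd_pd_comm hy, secondForm]

theorem IsNormalField.inner_pd_normal (h : IsNormalField u N U) (hy : y ∈ U) (i j : Fin 2) :
    inner ℝ (pd i N y) (pd j u y) = -secondForm u N y i j := by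
  rw [secondForm, h.inner_pd_pd hy, neg_neg, real_inner_comm]

/-- In normal coordinates `∂ᵢ∂ⱼu` is normal to the surface at the point, while `∂ₖN` is tangent. -/
theorem IsNormalField.inner_pd_pd_pd (h : IsNormalField u N U) (hy : y ∈ U)
    (hn : IsNormalAt u y) (i j k : Fin 2) : inner ℝ (pd i (pd j u) y) (pd k N y) = 0 := by
  rw [h.inner_eq hy hn, h.inner_pd_self hy, mul_zero, add_zero]
  exact Finset.sum_eq_zero fun a _ => by rw [hn.inner_eq, zero_mul]

theorem IsNormalField.gram_normal (h : IsNormalField u N U) (hy : y ∈ U)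
    (hn : IsNormalAt u y) (i j : Fin 2) :
    gram N y i j = ∑ k, secondForm u N y i k * secondForm u N y j k := by
  rw [gram_apply, h.inner_eq hy hn, h.inner_pd_self hy, zero_mul, add_zero]
  exact Finset.sum_congr rfl fun k _ => by
    rw [h.inner_pd_normal hy, h.inner_pd_normal hy, neg_mul_neg]

theorem ImmersionOn.pd_gram_inv_of_isNormalAt (h : ImmersionOn u U) (hy : y ∈ U)
    (hn : IsNormalAt u y) (p i j : Fin 2) : pd p (fun z => (gram u z)⁻¹ i j) y = 0 := by
  rw [pd_inv_apply h.isOpen h.contDiffOn_gram (fun z hz => (h.det_pos hz).ne') hy,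
    neg_eq_zero]
  exact Finset.sum_eq_zero fun a _ => Finset.sum_eq_zero fun b _ => by
    rw [h.pd_gram hy, hn.inner_eq, hn.inner_eq, add_zero, mul_zero, zero_mul]

/-- At a normal point neither the inverse metric nor `N` contributes to the derivative of the traced
second fundamental form. -/
theorem IsNormalField.pd_traceForm (h : IsNormalField u N U) (hy : y ∈ U)
    (hn : IsNormalAt u y) (i : Fin 2) :
    pd i (traceForm u N) y = ∑ a, inner ℝ (pd i (pd a (pd a u)) y) (N y) := by
  have hU := h.isOpen
  have hd : ∀ a b, ContDiffOn ℝ ∞ (pd a (pd b u)) U := fun a b =>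
    contDiffOn_pd hU (h.immersionOn.contDiffOn_pd b) a
  have hd' : ∀ a b, DifferentiableAt ℝ (fun z => (inner ℝ (pd a (pd b u) z) (N z) : ℝ)) y :=
    fun a b => differentiableAt_of_contDiffOn hU ((hd a b).inner ℝ h.contDiffOn) hy
  have hg : ∀ a b, DifferentiableAt ℝ (fun z => (gram u z)⁻¹ a b) y := fun a b =>
    differentiableAt_of_contDiffOn hU (h.immersionOn.contDiffOn_gram_inv a b) hy
  have hp : ∀ a b, DifferentiableAt ℝ (fun z => (gram u z)⁻¹ a b *
      (inner ℝ (pd a (pd b u) z) (N z) : ℝ)) y := fun a b => (hg a b).mul (hd' a b)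
  have ht : ∀ z ∈ U, traceForm u N z = ∑ i, ∑ j, (gram u z)⁻¹ i j *
      inner ℝ (pd i (pd j u) z) (N z) := fun z hz => h.inner_lap_left hz
  rw [pd_congr_at i (eventuallyEq_of_isOpen hU ht hy), pd_sum _ _ fun a _ => DifferentiableAt.fun_sum fun b _ => hp a b]
  refine Finset.sum_congr rfl fun a _ => ?_
  rw [pd_sum _ _ fun b _ => hp a b, Finset.sum_eq_single a]
  · rw [pd_mul i (hg a a) (hd' a a), h.immersionOn.pd_gram_inv_of_isNormalAt hy hn, zero_mul,
      add_zero, hn.gram_eq, inv_one, Matrix.one_apply_eq, one_mul,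
      pd_inner i (differentiableAt_of_contDiffOn hU (hd a a) hy) (h.differentiableAt hy),
      h.inner_pd_pd_pd hy hn, add_zero]
  · intro b _ hb
    rw [pd_mul i (hg a b) (hd' a b), h.immersionOn.pd_gram_inv_of_isNormalAt hy hn, zero_mul,
      add_zero, hn.gram_eq, inv_one, Matrix.one_apply_ne hb.symm, zero_mul]
  · exact fun ha => absurd (Finset.mem_univ a) ha

/-- The Codazzi equation, traced. -/
theorem IsNormalField.inner_lap_normal_pd (h : IsNormalField u N U) (hy : y ∈ U)
    (hn : IsNormalAt u y) (i : Fin 2) :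
    inner ℝ (lap u N y) (pd i u y) = -pd i (traceForm u N) y := by
  have hU := h.isOpen
  have hu := h.immersionOn.contDiffOn
  rw [hn.lap_eq, sum_inner, h.pd_traceForm hy hn, ← Finset.sum_neg_distrib]
  refine Finset.sum_congr rfl fun j _ => ?_
  have hc : ContDiffOn ℝ ∞ (pd j (pd i u)) U := contDiffOn_pd hU (contDiffOn_pd hU hu i) j
  have h1 := pd_congr_at j (eventuallyEq_of_isOpen hU (fun z hz => h.inner_pd_pd hz j i) hy)
  rw [pd_inner j (differentiableAt_of_contDiffOn hU hc hy) (h.differentiableAt hy),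
    h.inner_pd_pd_pd hy hn, add_zero] at h1
  have h2 : pd j (fun z => -(inner ℝ (pd i u z) (pd j N z) : ℝ)) y =
      -(inner ℝ (pd j (pd i u) y) (pd j N y) + inner ℝ (pd i u y) (pd j (pd j N) y)) := by
    have h3 := pd_inner j (h.differentiableAt_pd_left hy i) (h.differentiableAt_pd hy j)
    rw [← h3]
    have h4 := pd_const_mul (φ := fun z => (inner ℝ (pd i u z) (pd j N z) : ℝ)) j (-1)
      ((h.differentiableAt_pd_left hy i).inner ℝ (h.differentiableAt_pd hy j))
    simpa only [neg_mul, one_mul] using h4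
  rw [h2, h.inner_pd_pd_pd hy hn, zero_add] at h1
  -- In a flat ambient space the Codazzi equation is the symmetry of the third derivatives of `u`.
  have h5 : pd i (pd j (pd j u)) y = pd j (pd j (pd i u)) y := by
    rw [pd_comm (contDiffAt_two hU (contDiffOn_pd hU hu j) hy) i j]
    exact pd_congr_at j (eventuallyEq_of_isOpen hU
      (fun z hz => h.immersionOn.pd_pd_comm hz i j) hy)
  rw [h5, h1, neg_neg, real_inner_comm]

/-- The value is `(A∇τ)ₘ`. In the frame `∂ᵢu, N` the tangential components are `−∂ᵢτ` and `−Aₘᵢ`,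
and the normal ones do not contribute because `∂ₘN ⊥ N`. -/
theorem IsNormalField.inner_lap_normal_pd_normal (h : IsNormalField u N U) (hy : y ∈ U)
    (hn : IsNormalAt u y) (m : Fin 2) :
    inner ℝ (lap u N y) (pd m N y) = ∑ i, secondForm u N y m i * pd i (traceForm u N) y := by
  rw [h.inner_eq hy hn, h.inner_pd_self hy, mul_zero, add_zero]
  exact Finset.sum_congr rfl fun i _ => by
    rw [h.inner_lap_normal_pd hy hn, h.inner_pd_normal hy]; ring

/-- The Leibniz rule for `Δ(τ N)`, since `Δu = τ N`. -/
theorem IsNormalField.lap_lap_of_isNormalAt (h : IsNormalField u N U) (hy : y ∈ U)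
    (hn : IsNormalAt u y) : lap u (lap u u) y = traceForm u N y • lap u N y +
      (2 : ℝ) • ∑ i, pd i (traceForm u N) y • pd i N y + lap u (traceForm u N) y • N y := by
  rw [lap_congr (eventuallyEq_of_isOpen h.isOpen (fun z hz => h.lap_self hz) hy),
    lap_smul h.isOpen h.contDiffOn_traceForm h.contDiffOn hy, hn.gram_eq]
  congr 3
  refine Finset.sum_congr rfl fun i _ => ?_
  rw [Finset.sum_eq_single i]
  · simp
  · intro j _ hj
    rw [inv_one, Matrix.one_apply_ne hj.symm, zero_mul, zero_smul]
  · exact fun hi => absurd (Finset.mem_univ i) hi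

/-- The tangential part of `Δ²u` is `−τ ∂ₘτ − 2 (A∇τ)ₘ` when computed from `Δ(τ N)`, and `2 (A∇τ)ₘ`
by biharmonicity. -/
theorem IsNormalField.four_mul_inner_of_isNormalAt (h : IsNormalField u N U)
    (hb : IsBiharmonicOn u N U) (hy : y ∈ U) (hn : IsNormalAt u y) (m : Fin 2) :
    4 * inner ℝ (lap u N y) (pd m N y) = -traceForm u N y * pd m (traceForm u N) y := by
  have h1 := h.inner_lap_lap_pd hb hy m
  have h3 := h.inner_lap_normal_pd_normal hy hn m
  rw [h.lap_lap_of_isNormalAt hy hn, inner_add_left, inner_add_left, real_inner_smul_left,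
    real_inner_smul_left, real_inner_smul_left, sum_inner, h.inner_lap_normal_pd hy hn,
    real_inner_comm, h.inner_pd y hy] at h1
  simp only [real_inner_smul_left, h.inner_pd_normal hy, h.secondForm_symm hy _ m] at h1
  have h4 : ∑ i, pd i (traceForm u N) y * -secondForm u N y m i =
      -inner ℝ (lap u N y) (pd m N y) := by
    rw [h3, ← Finset.sum_neg_distrib]
    exact Finset.sum_congr rfl fun i _ => by ring
  rw [h4] at h1
  linarith

/-- The normal part of `Δ²u` is `Δτ − τ|A|²` when computed from `Δ(τ N)`, and `2 tr A³` by
biharmonicity. -/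
theorem IsNormalField.lap_traceForm_of_isNormalAt (h : IsNormalField u N U)
    (hb : IsBiharmonicOn u N U) (hy : y ∈ U) (hn : IsNormalAt u y) :
    lap u (traceForm u N) y = traceForm u N y * ∑ i, gram N y i i +
      2 * ∑ i, ∑ j, gram N y i j * secondForm u N y i j := by
  have h1 := h.inner_lap_lap_normal hb hy
  rw [h.lap_lap_of_isNormalAt hy hn, inner_add_left, inner_add_left, real_inner_smul_left,
    real_inner_smul_left, real_inner_smul_left, sum_inner, h.inner_self y hy, mul_one,
    h.inner_lap_normal hy, hn.gram_eq, inv_one] at h1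
  simp only [real_inner_smul_left, h.inner_pd_self hy, Finset.sum_const_zero, add_zero,
    Matrix.one_apply, ite_mul, mul_ite, one_mul, zero_mul, mul_one, mul_zero,
    Finset.sum_ite_eq, Finset.sum_ite_eq', Finset.mem_univ, if_true] at h1
  simp only [secondForm]
  linarith

end NormalPoint

/-! ### Changes of coordinates on the surface -/

section Reparametrization

variable {u N : E 2 → E 3} {U U' : Set (E 2)} {ψ : E 2 → E 2}

theorem IsNormalField.comp (h : IsNormalField u N U) (hU' : IsOpen U') (hψ : ContDiffOn ℝ ∞ ψ U')
    (hm : Set.MapsTo ψ U' U) (hi : ∀ y ∈ U', Function.Injective (fderiv ℝ ψ y)) :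
    IsNormalField (u ∘ ψ) (N ∘ ψ) U' where
  immersionOn := h.immersionOn.comp hU' hψ hm hi
  contDiffOn := h.contDiffOn.comp hψ hm
  inner_self y hy := h.inner_self _ (hm hy)
  inner_pd y hy i := by
    rw [pd_comp i (h.differentiableAt_left (hm hy)) (differentiableAt_of_contDiffOn hU' hψ hy),
      sum_inner]
    exact Finset.sum_eq_zero fun a _ => by
      rw [real_inner_smul_left, Function.comp_apply, h.inner_pd _ (hm hy), mul_zero]

theorem IsNormalField.traceForm_comp (h : IsNormalField u N U) (hU' : IsOpen U')
    (hψ : ContDiffOn ℝ ∞ ψ U') (hm : Set.MapsTo ψ U' U)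
    (hi : ∀ y ∈ U', Function.Injective (fderiv ℝ ψ y)) {y : E 2} (hy : y ∈ U') :
    traceForm (u ∘ ψ) (N ∘ ψ) y = traceForm u N (ψ y) := by
  rw [traceForm, h.immersionOn.lap_comp hU' hψ hm hy (hi y hy) h.immersionOn.contDiffOn]
  rfl

/-- The change of coordinates lifts to the bundle as `Ψ = (ψ, id)`, and the invariance of the
Laplacian under `Ψ` is applied twice. -/
theorem IsBiharmonicOn.comp (hb : IsBiharmonicOn u N U) (h : IsNormalField u N U)
    (hU' : IsOpen U') (hψ : ContDiffOn ℝ ∞ ψ U') (hm : Set.MapsTo ψ U' U)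
    (hi : ∀ y ∈ U', Function.Injective (fderiv ℝ ψ y)) :
    IsBiharmonicOn (u ∘ ψ) (N ∘ ψ) U' := by
  obtain ⟨Ψ, hΨ⟩ : ∃ Ψ : E 3 → E 3, Ψ = fun z => lift (z 2) (ψ (base z)) := ⟨_, rfl⟩
  have hV' := isOpen_preimage_base hU'
  have hbase : ∀ z, base (Ψ z) = ψ (base z) := fun z => by rw [hΨ]; exact base_lift _ _
  have htwo : ∀ z, Ψ z 2 = z 2 := fun z => by rw [hΨ]; rfl
  have hmap : normalMap (u ∘ ψ) (N ∘ ψ) = normalMap u N ∘ Ψ := by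
    funext z
    simp only [normalMap, Function.comp_apply, hbase, htwo]
  have hm' : Set.MapsTo Ψ (base ⁻¹' U') (base ⁻¹' U) := fun z hz => by
    rw [Set.mem_preimage, hbase]; exact hm hz
  have hc : ContDiffOn ℝ ∞ Ψ (base ⁻¹' U') :=
    contDiffOn_euclideanThree ((contDiffOn_comp_base hψ).congr fun z _ => hbase z)
      (contDiff_apply_two.contDiffOn.congr fun z _ => htwo z)
  have hinj : ∀ z ∈ base ⁻¹' U', Function.Injective (fderiv ℝ Ψ z) := fun z hz => by
    have hd := (differentiableAt_of_contDiffOn hV' hc hz).hasFDerivAt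
    have h1 := (hasFDerivAt_base (Ψ z)).comp z hd
    have h2 := ((EuclideanSpace.proj (𝕜 := ℝ) (2 : Fin 3)).hasFDerivAt (x := Ψ z)).comp z hd
    have h1' := (differentiableAt_of_contDiffOn hU' hψ hz).hasFDerivAt.comp z (hasFDerivAt_base z)
    have h2' := (EuclideanSpace.proj (𝕜 := ℝ) (2 : Fin 3)).hasFDerivAt (x := z)
    have e1 := h1.unique (h1'.congr_of_eventuallyEq (Filter.Eventually.of_forall hbase))
    have e2 := h2.unique (h2'.congr_of_eventuallyEq (Filter.Eventually.of_forall htwo))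
    rw [injective_iff_map_eq_zero]
    intro v hv
    have f1 : fderiv ℝ ψ (base z) (base v) = 0 := by
      have := DFunLike.congr_fun e1 v
      simp only [ContinuousLinearMap.comp_apply, hv, map_zero] at this
      exact this.symm
    have f2 : v 2 = 0 := by
      have := DFunLike.congr_fun e2 v
      simp only [ContinuousLinearMap.comp_apply, hv, map_zero] at this
      exact this.symm
    rw [← lift_base v, f2, (injective_iff_map_eq_zero _).1 (hi _ hz) _ f1]
    ext i; fin_cases i <;> simp [lift]
  have hI := h.immersionOn_normalMap
  intro z hz
  have h3 : ∀ w ∈ base ⁻¹' U', lap (normalMap u N ∘ Ψ) (normalMap u N ∘ Ψ) w =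
      (lap (normalMap u N) (normalMap u N) ∘ Ψ) w := fun w hw =>
    hI.lap_comp hV' hc hm' hw (hinj w hw) hI.contDiffOn
  rw [hmap, lap_congr (eventuallyEq_of_isOpen hV' h3 hz),
    hI.lap_comp hV' hc hm' hz (hinj z hz) (hI.contDiffOn_lap hI.contDiffOn)]
  exact hb _ (hm' hz)

end Reparametrization

end Submanifold

namespace Submanifold

open Topology

/-! ### Biharmonic normal bundles and minimal surfaces in coordinates -/

section Biharmonic

variable {u N : E 2 → E 3} {U : Set (E 2)} {y : E 2}

/-- Both sides are covectors, so the identity passes from normal coordinates to arbitrary ones. It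
is needed on all of `U` in fixed coordinates because `IsNormalField.three_mul_sum_sq` differentiates
it. -/
theorem IsNormalField.four_mul_inner (h : IsNormalField u N U) (hb : IsBiharmonicOn u N U)
    (hy : y ∈ U) (m : Fin 2) :
    4 * inner ℝ (lap u N y) (pd m N y) = -traceForm u N y * pd m (traceForm u N) y := by
  obtain ⟨ψ, U', hU', h0, rfl, hψ, hm, hi, hn⟩ := h.immersionOn.exists_normal hy
  have h' := h.comp hU' hψ hm hi
  have hb' := hb.comp h hU' hψ hm hi
  have hψd := differentiableAt_of_contDiffOn hU' hψ h0
  have ht : traceForm (u ∘ ψ) (N ∘ ψ) =ᶠ[𝓝 0] traceForm u N ∘ ψ :=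
    eventuallyEq_of_isOpen hU' (fun z hz => h.traceForm_comp hU' hψ hm hi hz) h0
  have key : ∀ w, 4 * inner ℝ (lap u N (ψ 0)) (fderiv ℝ (N ∘ ψ) 0 w) =
      -traceForm u N (ψ 0) * fderiv ℝ (traceForm u N ∘ ψ) 0 w := fun w => by
    have h1 := fun m => h'.four_mul_inner_of_isNormalAt hb' h0 hn m
    rw [h.immersionOn.lap_comp hU' hψ hm h0 (hi 0 h0) h.contDiffOn, ht.eq_of_nhds] at h1
    simp only [pd_congr_at _ ht, Function.comp_apply] at h1
    rw [fderiv_eq_sum_pd, fderiv_eq_sum_pd, inner_sum, Finset.mul_sum, Finset.mul_sum]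
    refine Finset.sum_congr rfl fun i _ => ?_
    rw [real_inner_smul_right, smul_eq_mul, mul_left_comm, h1, mul_left_comm]
  -- `w` is the vector that the differential of `ψ` sends to the `m`-th coordinate direction.
  obtain ⟨w, hw⟩ := (LinearMap.injective_iff_surjective (f := (fderiv ℝ ψ 0).toLinearMap)).1
    (hi 0 h0) (EuclideanSpace.single m 1)
  have hw' : fderiv ℝ ψ 0 w = EuclideanSpace.single m 1 := hw
  have h2 := key w
  rw [fderiv_comp 0 (h.differentiableAt hy) hψd, fderiv_comp 0
    (differentiableAt_of_contDiffOn h.isOpen h.contDiffOn_traceForm hy) hψd,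
    ContinuousLinearMap.comp_apply, ContinuousLinearMap.comp_apply, hw'] at h2
  exact h2

/-- The symmetric matrix `A` with entries `l, m, n` is the shape operator, `τ = l + n`, and `(a, b)`
is `∇τ`. The first two hypotheses say `(4A + τ)∇τ = 0`, with `det (4A + τ) = 16 det A + 5τ²`. If
this determinant vanishes, the third becomes `3|∇τ|² = −(11/2) τ⁴`. Otherwise `∇τ = 0`, and `3τ² − 8
det A = τ² + 2(l − n)² + 8m²` leaves only `τ = 0`. -/
theorem eq_zero_of_shape {l m n a b : ℝ} (h0 : 4 * (l * a + m * b) = -(l + n) * a)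
    (h1 : 4 * (m * a + n * b) = -(l + n) * b)
    (h : 3 * (a ^ 2 + b ^ 2) = -(l + n) ^ 2 * (3 * (l + n) ^ 2 - 8 * (l * n - m ^ 2))) :
    l + n = 0 := by
  -- Multiplication by the adjugate of `4A + τ`.
  have ha : (16 * (l * n - m ^ 2) + 5 * (l + n) ^ 2) * a = 0 := by
    linear_combination (4 * n + (l + n)) * h0 - 4 * m * h1
  have hb : (16 * (l * n - m ^ 2) + 5 * (l + n) ^ 2) * b = 0 := by
    linear_combination (4 * l + (l + n)) * h1 - 4 * m * h0
  have h4 : (l + n) ^ 4 ≤ 0 := by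
    by_cases hK : 16 * (l * n - m ^ 2) + 5 * (l + n) ^ 2 = 0
    · have e : 3 * (a ^ 2 + b ^ 2) = -(11 / 2 * (l + n) ^ 4) := by
        linear_combination h + (l + n) ^ 2 * (1 / 2) * hK
      nlinarith [sq_nonneg a, sq_nonneg b]
    · rw [(mul_eq_zero.1 ha).resolve_left hK, (mul_eq_zero.1 hb).resolve_left hK] at h
      have h5 : 0 ≤ (l + n) ^ 2 * (2 * (l - n) ^ 2 + 8 * m ^ 2) := by positivity
      nlinarith
  exact pow_eq_zero_iff (by norm_num) |>.1 (le_antisymm h4 (by positivity))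

theorem traceForm_of_isNormalAt (hn : IsNormalAt u y) :
    traceForm u N y = secondForm u N y 0 0 + secondForm u N y 1 1 := by
  rw [traceForm, hn.lap_eq, sum_inner, Fin.sum_univ_two]
  rfl

/-- Let `c = −∇τ` be the tangential part of `ΔN` on the surface. Three facts are combined: the
traced second derivative of `⟨c, N⟩ = 0`, in which `⟨Δc, N⟩ = 0` by
`IsNormalField.inner_lap_lapTangent`; the divergence of `4⟨c, ∂ᵢN⟩ = −τ ∂ᵢτ`; and `⟨c, ΔN⟩ = |∇τ|²`.
Eliminating `∑ ⟨∂ᵢc, ∂ᵢN⟩` gives the claim. -/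
theorem IsNormalField.three_mul_sum_sq (h : IsNormalField u N U) (hb : IsBiharmonicOn u N U)
    (hy : y ∈ U) (hn : IsNormalAt u y) : 3 * ∑ i, pd i (traceForm u N) y ^ 2 =
      -traceForm u N y * lap u (traceForm u N) y := by
  have hU := h.isOpen
  obtain ⟨c, hc⟩ : ∃ c : E 2 → E 3, c = fun y => lapTangent u N (lift 0 y) := ⟨_, rfl⟩
  have hcs : ContDiffOn ℝ ∞ c U := hc ▸ contDiffOn_comp_lift h.contDiffOn_lapTangent 0
  have hce : ∀ z ∈ U, c z = lap u N z - (inner ℝ (lap u N z) (N z) : ℝ) • N z := fun z hz => by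
    simp only [hc, lapTangent, h.lapNormal_lift_zero hz, base_lift]
  have hci := fun i => contDiffOn_pd hU hcs i
  have hNi := fun i => contDiffOn_pd hU h.contDiffOn i
  have hti := fun i => contDiffOn_pd hU h.contDiffOn_traceForm i
  have d : ∀ {W : Type} [NormedAddCommGroup W] [NormedSpace ℝ W] {φ : E 2 → W} {z : E 2},
    ContDiffOn ℝ ∞ φ U → z ∈ U → DifferentiableAt ℝ φ z := fun hφ hz =>
      differentiableAt_of_contDiffOn hU hφ hz
  have hcN : ∀ z ∈ U, inner ℝ (c z) (N z) = (0 : ℝ) := fun z hz => by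
    rw [hce z hz, inner_sub_left, real_inner_smul_left, h.inner_self z hz, mul_one, sub_self]
  have hcN' : ∀ i, ∀ z ∈ U, (inner ℝ (pd i c z) (N z) + inner ℝ (c z) (pd i N z) : ℝ) = 0 :=
    fun i z hz => by
      rw [← pd_inner i (d hcs hz) (d h.contDiffOn hz),
        pd_congr_at i (eventuallyEq_of_isOpen hU hcN hz), pd_const]
  have e1 : ∀ i, (inner ℝ (pd i (pd i c) y) (N y) + 2 * inner ℝ (pd i c y) (pd i N y) +
      inner ℝ (c y) (pd i (pd i N) y) : ℝ) = 0 := fun i => by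
    have h1 := pd_congr_at i (eventuallyEq_of_isOpen hU (hcN' i) hy)
    rw [pd_const, pd_add i ((d (hci i) hy).inner ℝ (d h.contDiffOn hy))
      ((d hcs hy).inner ℝ (d (hNi i) hy)), pd_inner i (d (hci i) hy) (d h.contDiffOn hy),
      pd_inner i (d hcs hy) (d (hNi i) hy)] at h1
    linarith
  have hF : ∀ i, ∀ z ∈ U, 4 * inner ℝ (c z) (pd i N z) =
      -1 * (traceForm u N z * pd i (traceForm u N) z) := fun i z hz => by
    rw [hce z hz, inner_sub_left, real_inner_smul_left, real_inner_comm (pd i N z) (N z),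
      h.inner_pd_self hz, mul_zero, sub_zero, h.four_mul_inner hb hz]
    ring
  have e2 : ∀ i, 4 * (inner ℝ (pd i c y) (pd i N y) + inner ℝ (c y) (pd i (pd i N) y)) =
      -(traceForm u N y * pd i (pd i (traceForm u N)) y + pd i (traceForm u N) y ^ 2) :=
    fun i => by
      have h1 := pd_congr_at i (eventuallyEq_of_isOpen hU (hF i) hy)
      rw [pd_const_mul i 4 ((d hcs hy).inner ℝ (d (hNi i) hy)), pd_const_mul
        (φ := fun z => traceForm u N z * pd i (traceForm u N) z) i (-1)
        ((d h.contDiffOn_traceForm hy).mul (d (hti i) hy)), pd_inner i (d hcs hy) (d (hNi i) hy),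
        pd_mul i (d h.contDiffOn_traceForm hy) (d (hti i) hy)] at h1
      linarith
  have e3 : ∑ i, (inner ℝ (pd i (pd i c) y) (N y) : ℝ) = 0 := by
    rw [← sum_inner, ← hn.lap_eq, hc]
    exact h.inner_lap_lapTangent hb hy
  have e4 : ∑ i, (inner ℝ (c y) (pd i (pd i N) y) : ℝ) = ∑ i, pd i (traceForm u N) y ^ 2 := by
    rw [← inner_sum, ← hn.lap_eq, h.inner_eq hy hn, hcN y hy, zero_mul, add_zero]
    refine Finset.sum_congr rfl fun i _ => ?_
    rw [hce y hy, inner_sub_left, real_inner_smul_left, real_inner_comm (pd i u y) (N y), h.inner_pd y hy,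
      h.inner_lap_normal_pd hy hn]
    ring
  rw [hn.lap_eq]
  simp only [Fin.sum_univ_two] at e3 e4 ⊢
  linarith [e1 0, e1 1, e2 0, e2 1]

/-- By `|A|² = τ² − 2 det A` and `tr A³ = τ³ − 3τ det A`, the equations take the form of
`eq_zero_of_shape`. -/
theorem IsNormalField.traceForm_eq_zero_of_isNormalAt (h : IsNormalField u N U)
    (hb : IsBiharmonicOn u N U) (hy : y ∈ U) (hn : IsNormalAt u y) : traceForm u N y = 0 := by
  have h1 := h.three_mul_sum_sq hb hy hn
  have h2 := fun m => h.four_mul_inner hb hy m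
  simp only [h.inner_lap_normal_pd_normal hy hn] at h2
  rw [h.lap_traceForm_of_isNormalAt hb hy hn] at h1
  simp only [h.gram_normal hy hn, traceForm_of_isNormalAt hn] at h1 h2 ⊢
  simp only [Fin.sum_univ_two, h.secondForm_symm hy 1 0] at h1 h2 ⊢
  refine eq_zero_of_shape (m := secondForm u N y 0 1) (by simpa using h2 0)
    (by simpa [h.secondForm_symm hy 1 0] using h2 1) ?_
  rw [h1]
  ring

/-- If the normal bundle is biharmonic, then the mean curvature of the surface vanishes. -/
theorem IsNormalField.traceForm_eq_zero (h : IsNormalField u N U) (hb : IsBiharmonicOn u N U)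
    (hy : y ∈ U) : traceForm u N y = 0 := by
  obtain ⟨ψ, U', hU', h0, rfl, hψ, hm, hi, hn⟩ := h.immersionOn.exists_normal hy
  rw [← h.traceForm_comp hU' hψ hm hi h0]
  exact (h.comp hU' hψ hm hi).traceForm_eq_zero_of_isNormalAt (hb.comp h hU' hψ hm hi) h0 hn

end Biharmonic

/-! ### Normal bundles of minimal surfaces -/

section Minimal

variable {u N : E 2 → E 3} {U : Set (E 2)} {y : E 2}

/-- A trace-free symmetric `2 × 2` matrix squares to a multiple of the identity, so `III` is
proportional to `g` and the slice is conformal to the surface. As `Δu = 0` and `∇τ = 0`, the traced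
second derivative `(0, t ΔN)` of the slice is normal to it, and its Laplacian is a rescaling of that
of `u`. -/
theorem IsNormalField.lap_slice_of_isNormalAt (h : IsNormalField u N U)
    (h0 : ∀ y ∈ U, traceForm u N y = 0) (hy : y ∈ U) (hn : IsNormalAt u y) (t : ℝ) :
    lap (slice u N t) u y = 0 ∧ ∃ r : ℝ, lap (slice u N t) N y = r • N y := by
  have hd : ∀ i, pd i (traceForm u N) y = 0 := fun i => by
    rw [pd_congr_at i (eventuallyEq_of_isOpen h.isOpen h0 hy), pd_const]
  have htr := traceForm_of_isNormalAt (N := N) hn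
  rw [h0 y hy] at htr
  -- The conformal factor `1 + t²|A|²/2`, for trace-free `A`.
  obtain ⟨μ, hμ⟩ : ∃ μ, μ = 1 + t ^ 2 * (secondForm u N y 0 0 ^ 2 + secondForm u N y 0 1 ^ 2) :=
    ⟨_, rfl⟩
  have hμ0 : μ ≠ 0 := by
    rw [hμ]; positivity
  have hg : gram (slice u N t) y = μ • 1 := by
    have h11 : secondForm u N y 1 1 = -secondForm u N y 0 0 := by linarith
    ext i j
    rw [h.gram_slice t hy, h.gram_normal hy hn, hn.gram_eq, hμ, Fin.sum_univ_two]
    fin_cases i <;> fin_cases j <;>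
      simp only [Fin.zero_eta, Fin.mk_one, Fin.isValue, Matrix.smul_apply, Matrix.one_apply,
        smul_eq_mul, h11, h.secondForm_symm hy 1 0, one_ne_zero, zero_ne_one, if_true, if_false] <;>
      ring
  have hu : ∑ i, pd i (pd i u) y = 0 := by
    rw [← hn.lap_eq, h.lap_self hy, h0 y hy, zero_smul]
  have hs : ∀ k, inner ℝ (∑ i, pd i (pd i (slice u N t)) y) (pd k (slice u N t) y) = (0 : ℝ) :=
    fun k => by
      have h1 : ∑ i, pd i (pd i (slice u N t)) y = pairL (0, t • lap u N y) := by
        simp only [h.pd_pd_slice t hy, ← map_sum]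
        congr 1
        ext1
        · rw [Prod.fst_sum, hu]
        · rw [Prod.snd_sum, hn.lap_eq, Finset.smul_sum]
      rw [h1, h.pd_slice t hy, inner_pairL, real_inner_smul_left, real_inner_smul_right,
        h.inner_lap_normal_pd_normal hy hn]
      simp [hd]
  have hN := h.eq_smul hy (w := lap u N y) fun i => by
    rw [real_inner_comm, h.inner_lap_normal_pd hy hn, hd, neg_zero]
  constructor
  · rw [lap_of_gram_eq_smul hμ0 hg, hu]
    simp only [hs, mul_zero, zero_smul, Finset.sum_const_zero, sub_zero, smul_zero]
  · refine ⟨μ⁻¹ * inner ℝ (lap u N y) (N y), ?_⟩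
    rw [lap_of_gram_eq_smul hμ0 hg, mul_smul, ← hN, hn.lap_eq]
    simp only [hs, mul_zero, zero_smul, Finset.sum_const_zero, sub_zero]

theorem slice_comp {ψ : E 2 → E 2} (t : ℝ) : slice (u ∘ ψ) (N ∘ ψ) t = slice u N t ∘ ψ := rfl

theorem IsNormalField.lap_slice_of_traceForm (h : IsNormalField u N U)
    (h0 : ∀ y ∈ U, traceForm u N y = 0) (hy : y ∈ U) (t : ℝ) :
    lap (slice u N t) u y = 0 ∧ ∃ r : ℝ, lap (slice u N t) N y = r • N y := by
  obtain ⟨ψ, U', hU', hz, rfl, hψ, hm, hi, hn⟩ := h.immersionOn.exists_normal hy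
  have h1 := (h.comp hU' hψ hm hi).lap_slice_of_isNormalAt
    (fun y hy => by rw [h.traceForm_comp hU' hψ hm hi hy, h0 _ (hm hy)]) hz hn t
  rwa [slice_comp, (h.immersionOn_slice t).lap_comp hU' hψ hm hz (hi 0 hz) h.immersionOn.contDiffOn,
    (h.immersionOn_slice t).lap_comp hU' hψ hm hz (hi 0 hz) h.contDiffOn] at h1

/-- If the mean curvature of the surface vanishes, then so does that of its normal bundle. -/
theorem IsNormalField.lap_normalMap_eq_zero (h : IsNormalField u N U)
    (h0 : ∀ y ∈ U, traceForm u N y = 0) {z : E 3} (hz : base z ∈ U) :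
    lap (normalMap u N) (normalMap u N) z = 0 := by
  obtain ⟨h1, r, h2⟩ := h.lap_slice_of_traceForm h0 hz (z 2)
  rw [← h.lapPoint_lift _ hz, lift_base] at h1
  rw [← h.lapNormal_lift _ hz, lift_base] at h2
  rw [h.lap_normalMap_self hz, h1, lapTangent, h2, real_inner_smul_left, h.inner_self _ hz, mul_one,
    sub_self, smul_zero]
  exact map_zero pairL

/-- On the zero section the first component of `Δf` is `Δu`. -/
theorem IsNormalField.lap_self_eq_zero (h : IsNormalField u N U)
    (h0 : ∀ z, base z ∈ U → lap (normalMap u N) (normalMap u N) z = 0) (hy : y ∈ U) :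
    lap u u y = 0 := by
  have h1 := h0 _ (base_lift_mem hy 0)
  rw [h.lap_normalMap_self (base_lift_mem hy 0)] at h1
  rw [← h.lapPoint_lift_zero hy]
  exact congrArg Prod.fst (pairL_injective (h1.trans (map_zero pairL).symm))

end Minimal

end Submanifold
namespace Submanifold
open Topology

/-! ### From coordinates to the manifold -/

section Main

variable {M : Type*} [TopologicalSpace M] [ChartedSpace (E 2) M]

theorem NormalBundle.incl_injective (x : Immersion 2 M (E 3)) :
    Function.Injective (NormalBundle.incl (x := x)) := fun _ _ h =>
  NormalBundle.ext (congrArg Prod.fst h) (congrArg Prod.snd h)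

instance [T2Space M] (x : Immersion 2 M (E 3)) : T2Space (NormalBundle x) :=
  T2Space.of_injective_continuous (NormalBundle.incl_injective x) (NormalBundle.continuous_incl x)

variable [IsManifold 𝓘(ℝ, E 2) ∞ M] (x : Immersion 2 M (E 3))
  {e : OpenPartialHomeomorph M (E 2)}

theorem isNormalField_unitNormal (he : e ∈ atlas (E 2) M) :
    IsNormalField (x ∘ e.symm) (unitNormal x e) e.target where
  immersionOn := x.immersionOn he
  contDiffOn := contDiffOn_unitNormal x he
  inner_self y hy := by rw [real_inner_self_eq_norm_sq, norm_unitNormal x he hy, one_pow]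
  inner_pd y _ i := inner_fderiv_unitNormal x e y _

theorem normalBundleImmersion_comp_symm (he : e ∈ atlas (E 2) M) {z : E 3}
    (hz : base z ∈ e.target) :
    normalBundleImmersion x ((NormalBundle.chart x he).symm z) =
      normalMap (x ∘ e.symm) (unitNormal x e) z :=
  normalBundleMap_comp_symm x he hz

/-- `IsMinimal` refers to preferred charts only. The form over the whole atlas is the one that can
be compared, chart by chart, between the surface and its normal bundle. -/
theorem isMinimal_iff_lap {m : ℕ} (hm : m ≠ 0) {X : Type*} [TopologicalSpace X]
    [ChartedSpace (E m) X] [IsManifold 𝓘(ℝ, E m) ∞ X] {V : Type*} [NormedAddCommGroup V]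
    [InnerProductSpace ℝ V] (f : Immersion m X V) :
    IsMinimal f ↔ ∀ e ∈ atlas (E m) X, ∀ y ∈ e.target, lap (f ∘ e.symm) (f ∘ e.symm) y = 0 := by
  rw [isMinimal_iff_tension f hm]
  constructor
  · intro h e he y hy
    have h1 := tension_eq_lap f he (f.contDiffOn he) (e.map_target hy)
    rw [e.right_inv hy] at h1
    rw [← h1, h]
  · intro h p
    rw [tension_eq_lap_chartAt]
    exact h _ (chart_mem_atlas _ p) _ (mem_chart_target _ p)

theorem lap_normalBundleImmersion (he : e ∈ atlas (E 2) M) {W : Type*} [NormedAddCommGroup W]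
    [NormedSpace ℝ W] (φ : E 3 → W) {z : E 3} (hz : base z ∈ e.target) :
    lap (normalBundleImmersion x ∘ (NormalBundle.chart x he).symm) φ z =
      lap (normalMap (x ∘ e.symm) (unitNormal x e)) φ z :=
  lap_congr_left (eventuallyEq_of_isOpen (isOpen_preimage_base e.open_target)
    (fun _ hw => normalBundleImmersion_comp_symm x he hw) hz)

theorem lap_normalBundleImmersion_self (he : e ∈ atlas (E 2) M) {z : E 3}
    (hz : base z ∈ e.target) :
    lap (normalBundleImmersion x ∘ (NormalBundle.chart x he).symm)
        (normalBundleImmersion x ∘ (NormalBundle.chart x he).symm) z =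
      lap (normalMap (x ∘ e.symm) (unitNormal x e))
        (normalMap (x ∘ e.symm) (unitNormal x e)) z := by
  rw [lap_normalBundleImmersion x he _ hz]
  exact lap_congr (eventuallyEq_of_isOpen (isOpen_preimage_base e.open_target)
    (fun _ hw => normalBundleImmersion_comp_symm x he hw) hz)

theorem isMinimal_iff_traceForm :
    IsMinimal x ↔ ∀ e ∈ atlas (E 2) M, ∀ y ∈ e.target,
      traceForm (x ∘ e.symm) (unitNormal x e) y = 0 := by
  rw [isMinimal_iff_lap two_ne_zero]
  refine forall₄_congr fun e he y hy => ?_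
  have h := isNormalField_unitNormal x he
  constructor
  · intro h0
    rw [traceForm, h0, inner_zero_left]
  · intro h0
    rw [h.lap_self hy, h0, zero_smul]

theorem isMinimal_normalBundleImmersion_iff :
    IsMinimal (normalBundleImmersion x) ↔ IsMinimal x := by
  rw [isMinimal_iff_lap three_ne_zero]
  constructor
  · intro h
    rw [isMinimal_iff_lap two_ne_zero]
    intro e he y hy
    refine (isNormalField_unitNormal x he).lap_self_eq_zero (fun z hz => ?_) hy
    rw [← lap_normalBundleImmersion_self x he hz]
    exact h _ ⟨e, he, rfl⟩ z hz
  · rw [isMinimal_iff_traceForm]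
    rintro h _ ⟨e, he, rfl⟩ z hz
    rw [lap_normalBundleImmersion_self x he hz]
    exact (isNormalField_unitNormal x he).lap_normalMap_eq_zero (h e he) hz

/-- The Euler–Lagrange equation holds in every bundle chart, which is `IsBiharmonicOn` for the
corresponding chart of the surface. -/
theorem isMinimal_of_isBiharmonic_normalBundleImmersion [T2Space M]
    (hb : IsBiharmonic (normalBundleImmersion x)) : IsMinimal x := by
  rw [isMinimal_iff_traceForm]
  intro e he y hy
  refine (isNormalField_unitNormal x he).traceForm_eq_zero (fun z hz => ?_) hy
  rw [← lap_normalBundleImmersion x he _ hz, ← lap_congr (eventuallyEq_of_isOpen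
    (isOpen_preimage_base e.open_target) (fun _ hw => lap_normalBundleImmersion_self x he hw) hz)]
  exact lap_lap_eq_zero (normalBundleImmersion x) hb ⟨e, he, rfl⟩ hz

end Main

end Submanifold
theorem proposition4 {M : Type*} [TopologicalSpace M] [T2Space M] [SecondCountableTopology M]
    [ChartedSpace (Submanifold.E 2) M] [IsManifold 𝓘(ℝ, Submanifold.E 2) ∞ M]
    (x : Submanifold.Immersion 2 M (Submanifold.E 3)) :
    (Submanifold.IsBiharmonic (Submanifold.normalBundleImmersion x) ↔
      Submanifold.IsMinimal (Submanifold.normalBundleImmersion x)) ∧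
    (Submanifold.IsMinimal (Submanifold.normalBundleImmersion x) ↔ Submanifold.IsMinimal x) := by
  have hs := Submanifold.isMinimal_normalBundleImmersion_iff x
  refine ⟨⟨fun hb => hs.2 (Submanifold.isMinimal_of_isBiharmonic_normalBundleImmersion x hb),
    fun hm => ?_⟩, hs⟩
  exact Submanifold.isBiharmonic_of_tension_eq_zero _
    ((Submanifold.isMinimal_iff_tension _ three_ne_zero).1 hm)
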